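/- Let $T>0$, let $\rho:[0,\infty)\to[-1,1]$ and $\sigma_1,\sigma_2:[0,\infty)\to(0,\infty)$ be measurable deterministic functions, with $\sigma_1,\sigma_2$ bounded on $[0,T]$. Let $(B_1,B_2)$ be a two-dimensional centred Gaussian process with independent increments such that $E[B_{i,t}^2]=t$ and $E[B_{1,t}B_{2,t}]=\int_0^t\rho_s\,ds$, and let $X_1,X_2$ be continuous processes with $dX_{i,t}=\sigma_{i,t}\,dB_{i,t}$ on $[0,T]$ (no drift). For each $n$ let $\Pi_n=(\Pi_n^1,\Pi_n^2)$ be a random pair of finite partitions of $(0,T]$ into intervals $I=(S^{i-1},S^i]\in\Pi^1_n$ and $J=(T^{j-1},T^j]\in\Pi_n^2$, independent of $\{(X_{1,t}-X_{1,0},X_{2,t}-X_{2,0})\}_{t\in[0,T]}$; let $r_n$ be the length of the longest of these intervals and $E^\Pi$ the conditional expectation given $\Pi_n$, computed from the regular conditional distribution. Put $\theta=\int_0^T\rho\,\sigma_1\sigma_2\,dt$, $K_{IJ}=\mathbf 1(I\cap J\ne\emptyset)$, $$\hat\theta_n=\sum_{I\in\Pi_n^1,\,J\in\Pi_n^2}\Delta_IX_1\,\Delta_JX_2\,K_{IJ},$$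 where $\Delta_IX_i$ is the increment of $X_i$ over $I$, and, for Borel sets $A\subset[0,T]$, $v(A)=\int_A\rho\,\sigma_1\sigma_2\,dt$, $v_i(A)=\int_A\sigma_i^2\,dt$. Let $$\mu_{2,n}=\tfrac12\Big\{\sum_{I,J}v_1(I)v_2(J)K_{IJ}+\sum_Iv(I)^2+\sum_Jv(J)^2-\sum_{I,J}v(I\cap J)^2\Big\},$$ $$\mu_{3,n}=\tfrac14\Big\{\sum_Iv(I)^3+\sum_Jv(J)^3+2\sum_{I,J}v(I\cap J)^3+3\sum_{I,J}v_1(I)v_2(J)v(I\cup J)K_{IJ}-3\sum_{I,J}\big[v(I\cap J)^2(v(I)+v(J))-v(I\cap J)v(I)v(J)\big]\Big\}.$$ Let $b_n>0$ be a deterministic sequence with $b_n\to0$, and set $\bar\lambda_{2,n}=2b_n^{-1}\mu_{2,n}$, $\bar\lambda_{3,n}=8b_n^{-2}\mu_{3,n}$, $\mathcal X_n=b_n^{-1/2}(\hat\theta_n-\theta)$. Let $\phi(z;V)$ be the density of $N(0,V)$ and $h_r(z;V)=(-1)^r\phi(z;V)^{-1}\partial_z^r\phi(z;V)$. For $\mathfrak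 c>0$ let $\Psi_n^\Pi$ and $\tilde\Psi_n^\Pi$ be the random signed measures on $\mathbb R$ with densities $$\phi(z;\bar\lambda_{2,n})\Big[1+\tfrac{\sqrt{b_n}}6\bar\lambda_{3,n}h_3(z;\bar\lambda_{2,n})\Big],\qquad \phi(z;\mathfrak c)\Big[1+\tfrac12(\bar\lambda_{2,n}-\mathfrak c)h_2(z;\mathfrak c)+\tfrac{\sqrt{b_n}}6\bar\lambda_{3,n}h_3(z;\mathfrak c)\Big].$$ For $M,\gamma>0$ let $\mathcal E(M,\gamma)$ be the set of Borel functions $f:\mathbb R\to\mathbb R$ with $|f(x)|\le M(1+|x|^\gamma)$ for all $x$; for $C,\eta,r_0,\mathfrak c^*>0$ let $\mathcal E^0(C,\eta,r_0,\mathfrak c^*)$ be the set of $f$ with $\int_{\mathbb R}\sup_{|x|\le r}|f(z+x)-f(z)|\,\phi(z;\mathfrak c^*)\,dz\le Cr^\eta$ for all $0<r\le r_0$. **Theorem.** Let $M,\gamma,C,\eta,r_0>0$, $a\in(\frac34,1)$ and $\mathfrak c,\mathfrak c_0,\mathfrak c_1>0$. There is a sequence $\varepsilon_n=O(b_n^{2a-1})$,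 determined by these parameters, $(b_n)$, $T$, $\rho$, $\sigma_1$, $\sigma_2$ only, such that for every $\mathfrak c^*>\max(\mathfrak c,\mathfrak c_0,\mathfrak c_1)$, all $B,X$ and all random sampling schemes $(\Pi_n)$ as above, and every $n$, almost surely $f(\mathcal X_n)$ is conditionally integrable for all $f$ in the suprema and: 1. on the event $\{\mathfrak c_0<\bar\lambda_{2,n}<\mathfrak c_1,\ r_n\le b_n^a\}$, $$\sup_{f\in\mathcal E(M,\gamma)\cap\mathcal E^0(C,\eta,r_0,\mathfrak c^*)}\big|E^\Pi[f(\mathcal X_n)]-\Psi_n^\Pi[f]\big|\le\varepsilon_n;$$ 2. on the event $A_n(a)=\{(\bar\lambda_{2,n}-\mathfrak c)^2\le b_n^{2a-1},\ r_n\le b_n^a\}$, $$\sup_{f\in\mathcal E(M,\gamma)\cap\mathcal E^0(C,\eta,r_0,\mathfrak c^*)}\big|E^\Pi[f(\mathcal X_n)]-\tilde\Psi_n^\Pi[f]\big|\le\varepsilon_n.$$ -/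

import Mathlib

open MeasureTheory ProbabilityTheory Filter Topology Asymptotics
open scoped NNReal ENNReal

namespace HY

noncomputable section

/-! ### The driving process and the driftless diffusion -/

/-- `B = (B 0, B 1)` is a two-dimensional centred Gaussian process with independent increments and
`E[B_t B_tᵀ] = [[t, ∫₀ᵗ ρ], [∫₀ᵗ ρ, t]]`: two Brownian motions with correlation function `ρ`. -/
structure IsCorrelatedBM {Ω : Type*} [MeasurableSpace Ω] (P : Measure Ω) (ρ : ℝ → ℝ)
    (B : Fin 2 → ℝ≥0 → Ω → ℝ) : Prop where
  gaussian : IsGaussianProcess (fun (t : ℝ≥0) (ω : Ω) (i : Fin 2) => B i t ω) P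
  indep : HasIndepIncrements (fun (t : ℝ≥0) (ω : Ω) (i : Fin 2) => B i t ω) P
  centred : ∀ i t, ∫ ω, B i t ω ∂P = 0
  cov : ∀ i j t, ∫ ω, B i t ω * B j t ω ∂P =
    if i = j then (t : ℝ) else ∫ s in Set.Ioc (0 : ℝ) t, ρ s

/-- Data for the deterministic step function `∑ₖ cₖ 1_{(lₖ, rₖ]}` on the half line. -/
structure StepFn where
  m : ℕ
  c : Fin m → ℝ
  l : Fin m → ℝ≥0
  r : Fin m → ℝ≥0
  l_le_r : ∀ k, l k ≤ r k

/-- The step function `∑ₖ cₖ 1_{(lₖ, rₖ]}`. -/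
def StepFn.eval (φ : StepFn) (s : ℝ) : ℝ :=
  ∑ k, (Set.Ioc (φ.l k : ℝ) (φ.r k)).indicator (fun _ => φ.c k) s

/-- The elementary integral `∑ₖ cₖ (W_{rₖ} - W_{lₖ})`. -/
def StepFn.integral {Ω : Type*} (φ : StepFn) (W : ℝ≥0 → Ω → ℝ) (ω : Ω) : ℝ :=
  ∑ k, φ.c k * (W (φ.r k) ω - W (φ.l k) ω)

/-- `Y` is the Wiener integral `∫₀^∞ g dW` of the deterministic function `g`: the `L²(P)`-limit of
elementary integrals of step functions converging to `g` in `L²(0, ∞)`. -/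
def IsWienerIntegral {Ω : Type*} [MeasurableSpace Ω] (P : Measure Ω) (W : ℝ≥0 → Ω → ℝ)
    (g : ℝ → ℝ) (Y : Ω → ℝ) : Prop :=
  ∃ φ : ℕ → StepFn,
    Tendsto (fun k => eLpNorm (fun s => (φ k).eval s - g s) 2 (volume.restrict (Set.Ioi (0 : ℝ))))
      atTop (𝓝 0) ∧
    Tendsto (fun k => eLpNorm (fun ω => (φ k).integral W ω - Y ω) 2 P) atTop (𝓝 0)

/-- `X = (X 0, X 1)` is a continuous process on `[0, T]` with `dX_t = diag(σ_t) dB_t`, that is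
`X_{i,t} - X_{i,0} = ∫₀ᵗ σ_{i,s} dB_{i,s}` for `t ∈ [0, T]`; the initial value is arbitrary. -/
structure IsDriftlessDiffusion {Ω : Type*} [MeasurableSpace Ω] (P : Measure Ω) (T : ℝ≥0)
    (σ : Fin 2 → ℝ → ℝ) (B X : Fin 2 → ℝ≥0 → Ω → ℝ) : Prop where
  measurable : ∀ i t, Measurable (X i t)
  continuous : ∀ i, ∀ᵐ ω ∂P, ContinuousOn (fun t => X i t ω) (Set.Icc 0 T)
  sde : ∀ i, ∀ t ≤ T, IsWienerIntegral P (B i) ((Set.Ioc (0 : ℝ) t).indicator (σ i))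
    (fun ω => X i t ω - X i 0 ω)

/-! ### Sampling times -/

/-- A partition `0 = pt 0 < pt 1 < ⋯ < pt N = T` of `[0, T]`, continued by `pt i = T` for
`i ≥ N`. -/
structure TimePartition (T : ℝ≥0) where
  N : ℕ
  pt : ℕ → ℝ≥0
  first : pt 0 = 0
  strict : ∀ i < N, pt i < pt (i + 1)
  last : ∀ i, N ≤ i → pt i = T

/-- The σ-algebra generated by the number of cells and the partition points. -/
instance (T : ℝ≥0) : MeasurableSpace (TimePartition T) :=
  MeasurableSpace.comap (fun p => (p.N, p.pt)) inferInstance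

/-- The `i`-th cell `(pt i, pt (i + 1)]`, for `i < N`. -/
def TimePartition.cell {T : ℝ≥0} (p : TimePartition T) (i : ℕ) : Set ℝ :=
  Set.Ioc (p.pt i : ℝ) (p.pt (i + 1))

/-- The length of the longest cell. -/
def TimePartition.mesh {T : ℝ≥0} (p : TimePartition T) : ℝ≥0 :=
  (Finset.range p.N).sup (fun i => p.pt (i + 1) - p.pt i)

/-- A sampling scheme: a partition for the first and a partition for the second component. -/
abbrev Scheme (T : ℝ≥0) : Type := Fin 2 → TimePartition T

/-- The maximal lag of the sampling times. -/
def maxLag {T : ℝ≥0} (S : Scheme T) : ℝ := max (S 0).mesh (S 1).mesh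

/-- Sum over all pairs of cells `(I, J)`, as pairs of indices. -/
def pairSum {T : ℝ≥0} (S : Scheme T) (g : ℕ → ℕ → ℝ) : ℝ :=
  ∑ i ∈ Finset.range (S 0).N, ∑ j ∈ Finset.range (S 1).N, g i j

open Classical in
/-- The indicator `1(I ∩ J ≠ ∅)`. -/
def overlap (I J : Set ℝ) : ℝ := if (I ∩ J).Nonempty then 1 else 0

/-! ### The Hayashi-Yoshida estimator -/

/-- `v(A) = ∫_A ρ σ₁ σ₂ dt`. -/
def v (ρ : ℝ → ℝ) (σ : Fin 2 → ℝ → ℝ) (A : Set ℝ) : ℝ := ∫ t in A, ρ t * σ 0 t * σ 1 t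

/-- `v₁(A)` and `v₂(A)`: `∫_A σᵢ² dt`. -/
def vv (σ : Fin 2 → ℝ → ℝ) (i : Fin 2) (A : Set ℝ) : ℝ := ∫ t in A, σ i t ^ 2

/-- The parameter `θ = ∫₀ᵀ ρ σ₁ σ₂ dt`. -/
def theta (T : ℝ≥0) (ρ : ℝ → ℝ) (σ : Fin 2 → ℝ → ℝ) : ℝ := v ρ σ (Set.Ioc 0 T)

/-- The Hayashi-Yoshida estimator computed from the paths `x 0`, `x 1` sampled along `S`. -/
def hyEstimator {T : ℝ≥0} (S : Scheme T) (x : Fin 2 → ℝ≥0 → ℝ) : ℝ :=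
  pairSum S fun i j =>
    (x 0 ((S 0).pt (i + 1)) - x 0 ((S 0).pt i)) * (x 1 ((S 1).pt (j + 1)) - x 1 ((S 1).pt j)) *
      overlap ((S 0).cell i) ((S 1).cell j)

/-- The normalized error `b^{-1/2} (θ̂ - θ)`. -/
def normError {T : ℝ≥0} (ρ : ℝ → ℝ) (σ : Fin 2 → ℝ → ℝ) (b : ℝ) (S : Scheme T)
    (x : Fin 2 → ℝ≥0 → ℝ) : ℝ :=
  b ^ (-(1 / 2) : ℝ) * (hyEstimator S x - theta T ρ σ)

/-- The regular conditional distribution of the normalized error `b^{-1/2} (θ̂ - θ)` given the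
random sampling scheme `S`: `∫ f d(condLaw … (S ω))` is `E^Π[f(b^{-1/2} (θ̂ - θ))]` at `ω`. -/
def condLaw {Ω : Type*} [MeasurableSpace Ω] (P : Measure Ω) [IsFiniteMeasure P] {T : ℝ≥0}
    (ρ : ℝ → ℝ) (σ : Fin 2 → ℝ → ℝ) (b : ℝ) (X : Fin 2 → ℝ≥0 → Ω → ℝ) (S : Ω → Scheme T) :
    Kernel (Scheme T) ℝ :=
  condDistrib (fun ω => normError ρ σ b (S ω) (fun i t => X i t ω)) S P

/-! ### The cumulant functionals -/

/-- The functional `μ₂` of the sampling scheme. -/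
def mu2 {T : ℝ≥0} (ρ : ℝ → ℝ) (σ : Fin 2 → ℝ → ℝ) (S : Scheme T) : ℝ :=
  1 / 2 *
    (pairSum S (fun i j => vv σ 0 ((S 0).cell i) * vv σ 1 ((S 1).cell j) *
        overlap ((S 0).cell i) ((S 1).cell j))
      + ∑ i ∈ Finset.range (S 0).N, v ρ σ ((S 0).cell i) ^ 2
      + ∑ j ∈ Finset.range (S 1).N, v ρ σ ((S 1).cell j) ^ 2
      - pairSum S (fun i j => v ρ σ ((S 0).cell i ∩ (S 1).cell j) ^ 2))

/-- The functional `μ₃` of the sampling scheme. -/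
def mu3 {T : ℝ≥0} (ρ : ℝ → ℝ) (σ : Fin 2 → ℝ → ℝ) (S : Scheme T) : ℝ :=
  1 / 4 *
    (∑ i ∈ Finset.range (S 0).N, v ρ σ ((S 0).cell i) ^ 3
      + ∑ j ∈ Finset.range (S 1).N, v ρ σ ((S 1).cell j) ^ 3
      + 2 * pairSum S (fun i j => v ρ σ ((S 0).cell i ∩ (S 1).cell j) ^ 3)
      + 3 * pairSum S (fun i j => vv σ 0 ((S 0).cell i) * vv σ 1 ((S 1).cell j) *
          v ρ σ ((S 0).cell i ∪ (S 1).cell j) * overlap ((S 0).cell i) ((S 1).cell j))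
      - 3 * pairSum S (fun i j =>
          v ρ σ ((S 0).cell i ∩ (S 1).cell j) ^ 2 *
              (v ρ σ ((S 0).cell i) + v ρ σ ((S 1).cell j))
            - v ρ σ ((S 0).cell i ∩ (S 1).cell j) *
                v ρ σ ((S 0).cell i) * v ρ σ ((S 1).cell j)))

/-- `λ̄₂ = 2 b⁻¹ μ₂`. -/
def lam2 {T : ℝ≥0} (ρ : ℝ → ℝ) (σ : Fin 2 → ℝ → ℝ) (b : ℝ) (S : Scheme T) : ℝ :=
  2 * b⁻¹ * mu2 ρ σ S

/-- `λ̄₃ = 8 b⁻² μ₃`. -/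
def lam3 {T : ℝ≥0} (ρ : ℝ → ℝ) (σ : Fin 2 → ℝ → ℝ) (b : ℝ) (S : Scheme T) : ℝ :=
  8 * (b ^ 2)⁻¹ * mu3 ρ σ S

/-! ### The approximating signed measures -/

/-- The density `φ(z; V)` of the centred normal law with variance `V > 0`. -/
def phi (V z : ℝ) : ℝ := gaussianPDFReal 0 V.toNNReal z

/-- The Hermite polynomial `h_r(z; V) = (-1)^r φ(z; V)⁻¹ ∂_z^r φ(z; V)`. -/
def hermite (r : ℕ) (V z : ℝ) : ℝ := (-1) ^ r * (phi V z)⁻¹ * iteratedDeriv r (phi V) z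

/-- The density of `Ψ`, with `L₂ = λ̄₂` and `L₃ = λ̄₃`. -/
def psiDensity (b L₂ L₃ z : ℝ) : ℝ :=
  phi L₂ z * (1 + b ^ (1 / 2 : ℝ) / 6 * L₃ * hermite 3 L₂ z)

/-- The density of `Ψ̃`, centred at the fixed variance `c`, with `L₂ = λ̄₂` and `L₃ = λ̄₃`. -/
def psiTildeDensity (b c L₂ L₃ z : ℝ) : ℝ :=
  phi c z * (1 + 1 / 2 * (L₂ - c) * hermite 2 c z + b ^ (1 / 2 : ℝ) / 6 * L₃ * hermite 3 c z)

/-! ### The classes of test functions -/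

/-- The class `𝓔(M, γ)`: Borel functions with `|f(x)| ≤ M (1 + |x|^γ)`. -/
def growthClass (M γ : ℝ) : Set (ℝ → ℝ) :=
  {f | Measurable f ∧ ∀ x, |f x| ≤ M * (1 + |x| ^ γ)}

/-- The modulus `ω̄_f(z, r) = sup_{|x| ≤ r} |f(z + x) - f(z)|`, with values in `[0, ∞]`. -/
def modulus (f : ℝ → ℝ) (z r : ℝ) : ℝ≥0∞ :=
  ⨆ (x : ℝ) (_ : |x| ≤ r), ENNReal.ofReal |f (z + x) - f z|

/-- The class `𝓔⁰(C, η, r₀, c*)`. -/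
def smoothClass (C η r₀ cstar : ℝ) : Set (ℝ → ℝ) :=
  {f | ∀ r, 0 < r → r ≤ r₀ →
    ∫⁻ z, modulus f z r * ENNReal.ofReal (phi cstar z) ≤ ENNReal.ofReal (C * r ^ η)}

end

end HY

open HY

/-! ### Fourier inversion: densities from characteristic functions and from Laplace transforms. -/

namespace HY

open scoped FourierTransform

/-! Independence lets the sampling scheme be frozen: the conditional law given `Π_n` is almost
surely the law of the normalized error for a deterministic scheme (`condLaw_ae_eq`). For such a
scheme the increments over all cells form a centred Gaussian vector with covariance `Σ`
(`map_incVec`), and the estimator is the quadratic form with matrix `B`, whose off-diagonal blocks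
are half the overlap indicators. Diagonalising `Σ^{1/2} B Σ^{1/2}` shows that the error has the law
of `∑ l_k (ξ_k² - 1)` with independent standard normal `ξ_k` (`exists_map_normError`). Its second
and third cumulants are `2 ∑ l_k²` and `8 ∑ l_k³`, that is, rescaled traces of `(BΣ)²` and `(BΣ)³`.

Two facts about the scheme enter. First, two interval partitions have an overlap graph without
cycles, so closed walks in it collapse; this turns the traces into the explicit functionals `μ₂` and
`μ₃` (`sum_pathWeight_sq`, `sum_pathWeight_cube`). Second, every eigenvalue is at most the maximal
row sum of `BΣ`. A cell meets cells of total length at most three meshes, so `|l_k| ≤ δ` with `δ` of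
order `r_n b_n^{-1/2} ≤ b_n^{a - 1/2}`. The rate in the theorem is `δ²`, of order `b_n^{2a-1}`.

The analytic core is the Laplace transform `chiMGF` on a vertical strip. Where `δ|z|` is small, a
Taylor expansion of its logarithm differs from the transform of the second-order expansion by
`O(δ²)`. Where `δ|z|` is not small, the product of the factors `(1 - 2 l_k z)^{-1/2}` has size at
most about `(1 + (δu)²)^{-L/(8δ²)}` with `L = 2 ∑ l_k²`, which is far below `δ²`. Hence the
transforms differ by at most `K δ² / (1 + u²)` uniformly on the strip (`exists_norm_chiMGF_sub_le`).

Fourier inversion on the two lines `Re z = ± s` turns this into a pointwise bound `K δ² exp(-s|x|)`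
for the difference of densities (`exists_chiLaw_density`). Integration against any measurable `f` of
at most polynomial growth gives the first claim, uniformly in `f`. For the second, the transform is
expanded once more in `λ̄₂ - 𝔠`, which is at most `δ` on the event considered. Values of `δ` that
are not small are handled by crude exponential moment bounds, so the estimate holds for every `n`.
-/

lemma gaussian_smoothing_eq (μ : Measure ℝ) [IsFiniteMeasure μ] {v : ℝ≥0} (hv : v ≠ 0) (x : ℝ) :
    ∫ w : ℝ, Complex.exp (-(2 * Real.pi ^ 2 * v * w ^ 2 : ℝ)) *
      (Complex.exp (-(2 * Real.pi * w * x : ℝ) * Complex.I) * charFun μ (2 * Real.pi * w))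
      = ((∫ y, gaussianPDFReal x v y ∂μ : ℝ) : ℂ) := by
  have hv' : (0 : ℝ) < v := by positivity
  have hτ : 0 < 2 * Real.pi ^ 2 * (v : ℝ) := by positivity
  simp_rw [charFun_apply_real, ← integral_const_mul]
  -- After Fubini the inner integral is the Fourier transform of a Gaussian, which is the normal
  -- density in `y` with mean `x` and variance `v`.
  rw [integral_integral_swap]
  · rw [← integral_complex_ofReal]
    congr 1 with y
    have h := fourierIntegral_gaussian (b := ((2 * Real.pi ^ 2 * v : ℝ) : ℂ)) (by rw [Complex.ofReal_re]; exact hτ)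
      ((2 * Real.pi * (y - x) : ℝ) : ℂ)
    rw [← integral_congr_ae (f := fun w : ℝ => Complex.exp (Complex.I * ((2 * Real.pi * (y - x) : ℝ) : ℂ) * w)
      * Complex.exp (-((2 * Real.pi ^ 2 * v : ℝ) : ℂ) * w ^ 2)), h]
    · have h1 : ((Real.pi : ℂ) / ((2 * Real.pi ^ 2 * v : ℝ) : ℂ)) ^ (1 / 2 : ℂ)
          = ((Real.sqrt (2 * Real.pi * v))⁻¹ : ℝ) := by
        rw [← Complex.ofReal_div, show (1 / 2 : ℂ) = ((1 / 2 : ℝ) : ℂ) by norm_num,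
          ← Complex.ofReal_cpow (by positivity), ← Real.sqrt_eq_rpow, ← Real.sqrt_inv]
        congr 2
        field_simp
      rw [h1, gaussianPDFReal, Complex.ofReal_mul (Real.sqrt _)⁻¹, Complex.ofReal_exp]
      congr 2
      push_cast
      have : (v : ℂ) ≠ 0 := by exact_mod_cast hv
      have hpi : (Real.pi : ℂ) ≠ 0 := by exact_mod_cast Real.pi_ne_zero
      field_simp
      ring
    · refine ae_of_all _ fun w => ?_
      simp only
      rw [← Complex.exp_add, ← Complex.exp_add, ← Complex.exp_add]
      congr 1
      push_cast
      ring
  · have hI : Integrable (fun w : ℝ => Real.exp (-(2 * Real.pi ^ 2 * v) * w ^ 2)) :=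
      integrable_exp_neg_mul_sq hτ
    have := (hI.mul_prod (integrable_const (1 : ℝ) (μ := μ)))
    refine this.mono' (Continuous.aestronglyMeasurable (by fun_prop)) (ae_of_all _ fun z => ?_)
    simp only [Function.uncurry, norm_mul, mul_one]
    have e2 : ‖Complex.exp (-(2 * Real.pi * z.1 * x : ℝ) * Complex.I)‖ = 1 := by
      rw [← Complex.ofReal_neg, Complex.norm_exp_ofReal_mul_I]
    have e3 : ‖Complex.exp (((2 * Real.pi * z.1 : ℝ) : ℂ) * z.2 * Complex.I)‖ = 1 := by
      rw [← Complex.ofReal_mul, Complex.norm_exp_ofReal_mul_I]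
    rw [e2, e3, ← Complex.ofReal_neg, Complex.norm_exp_ofReal]
    simp

/-- A finite measure on the line with integrable characteristic function has a continuous
density. -/
theorem exists_density_of_integrable_charFun (μ : Measure ℝ) [IsFiniteMeasure μ]
    (h : Integrable (charFun μ)) :
    ∃ p : ℝ → ℝ, Continuous p ∧ (∀ x, 0 ≤ p x) ∧ Integrable p ∧
      μ = volume.withDensity (fun x => ENNReal.ofReal (p x)) := by
  set F : ℝ → ℂ := fun w => charFun μ (2 * Real.pi * w) with hF
  have hFc : Continuous F := by
    have : Continuous (charFun μ) := continuous_charFun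
    exact this.comp (by fun_prop)
  have hFi : Integrable F := h.comp_mul_left' (by positivity)
  have hpc : Continuous (𝓕 F) := by
    exact VectorFourier.fourierIntegral_continuous Real.continuous_fourierChar (by fun_prop) hFi
  -- The mollified densities of `μ` converge pointwise to `𝓕 F` as the variance `1 / (n + 1)` tends
  -- to zero. The limit is therefore real and nonnegative.
  have key : ∀ x, Tendsto (fun n : ℕ => ((∫ y, gaussianPDFReal x ((n : ℝ≥0) + 1)⁻¹ y ∂μ : ℝ) : ℂ))
      atTop (𝓝 (𝓕 F x)) := by
    intro x
    simp_rw [← fun n : ℕ => gaussian_smoothing_eq μ (v := ((n : ℝ≥0) + 1)⁻¹) (by positivity) x]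
    rw [Real.fourier_real_eq_integral_exp_smul]
    refine tendsto_integral_of_dominated_convergence (fun w => ‖F w‖) ?_ hFi.norm ?_ ?_
    · intro n
      exact Continuous.aestronglyMeasurable (by fun_prop)
    · intro n
      refine ae_of_all _ fun w => ?_
      rw [norm_mul, norm_mul, ← Complex.ofReal_neg, ← Complex.ofReal_neg,
        Complex.norm_exp_ofReal_mul_I, one_mul, Complex.norm_exp_ofReal]
      refine mul_le_of_le_one_left (norm_nonneg _) ?_
      rw [Real.exp_le_one_iff]
      have : (0 : ℝ) ≤ 2 * Real.pi ^ 2 * (((n : ℝ≥0) + 1)⁻¹ : ℝ≥0) * w ^ 2 := by positivity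
      linarith
    · refine ae_of_all _ fun w => ?_
      have h0 : Tendsto (fun n : ℕ => (((n : ℝ≥0) + 1)⁻¹ : ℝ≥0)) atTop (𝓝 0) := by
        have := tendsto_one_div_add_atTop_nhds_zero_nat (𝕜 := ℝ≥0)
        simpa using this
      have h1 : Tendsto (fun n : ℕ => Complex.exp
          (-(2 * Real.pi ^ 2 * (((n : ℝ≥0) + 1)⁻¹ : ℝ≥0) * w ^ 2 : ℝ))) atTop (𝓝 1) := by
        have hc : Continuous (fun r : ℝ≥0 => Complex.exp (-(2 * Real.pi ^ 2 * (r : ℝ) * w ^ 2 : ℝ))) := by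
          fun_prop
        have := (hc.tendsto 0).comp h0
        simpa [Function.comp_def] using this
      have := h1.mul_const (Complex.exp (-(2 * Real.pi * w * x : ℝ) * Complex.I) * F w)
      convert! this using 2
      rw [one_mul, smul_eq_mul]
      congr 3
      push_cast; ring
  have hre : ∀ x, 0 ≤ (𝓕 F x).re := fun x => by
    refine ge_of_tendsto ((Complex.continuous_re.tendsto _).comp (key x)) (Eventually.of_forall fun n => ?_)
    simp only [Function.comp, Complex.ofReal_re]
    exact integral_nonneg fun y => gaussianPDFReal_nonneg _ _ _
  have him : ∀ x, (𝓕 F x).im = 0 := fun x => by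
    refine tendsto_nhds_unique ((Complex.continuous_im.tendsto _).comp (key x)) ?_
    simp [Function.comp_def]
  have hpe : ∀ x, 𝓕 F x = (((𝓕 F x).re : ℝ) : ℂ) := fun x => Complex.ext (by simp) (by simp [him])
  have hcont : Continuous fun x => (𝓕 F x).re := Complex.continuous_re.comp hpc
  -- Fatou: every mollified density has total mass `μ univ`, so the limit is integrable. This
  -- integrability is what the inversion formula needs below.
  have hfat : ∫⁻ x, ENNReal.ofReal (𝓕 F x).re ≤ μ Set.univ := by
    have hlim : ∀ x, Tendsto (fun n : ℕ => ∫⁻ y, gaussianPDF x ((n : ℝ≥0) + 1)⁻¹ y ∂μ) atTop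
        (𝓝 (ENNReal.ofReal (𝓕 F x).re)) := by
      intro x
      have h1 := ENNReal.tendsto_ofReal ((Complex.continuous_re.tendsto _).comp (key x))
      refine h1.congr fun n => ?_
      simp only [Function.comp, Complex.ofReal_re]
      rw [ofReal_integral_eq_lintegral_ofReal]
      · rfl
      · refine Integrable.of_bound (C := gaussianPDFReal x ((n : ℝ≥0) + 1)⁻¹ x)
          (measurable_gaussianPDFReal _ _).aestronglyMeasurable (ae_of_all _ fun y => ?_)
        rw [Real.norm_of_nonneg (gaussianPDFReal_nonneg _ _ _)]
        simp only [gaussianPDFReal]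
        refine mul_le_mul_of_nonneg_left (Real.exp_le_exp.2 ?_) (by positivity)
        rw [neg_div, sub_self]
        have : 0 ≤ (y - x) ^ 2 / (2 * ((((n : ℝ≥0) + 1)⁻¹ : ℝ≥0) : ℝ)) := by positivity
        simpa using this
      · exact ae_of_all _ fun y => gaussianPDFReal_nonneg _ _ _
    calc ∫⁻ x, ENNReal.ofReal (𝓕 F x).re
        = ∫⁻ x, liminf (fun n : ℕ => ∫⁻ y, gaussianPDF x ((n : ℝ≥0) + 1)⁻¹ y ∂μ) atTop :=
          lintegral_congr fun x => (hlim x).liminf_eq.symm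
      _ ≤ liminf (fun n : ℕ => ∫⁻ x, ∫⁻ y, gaussianPDF x ((n : ℝ≥0) + 1)⁻¹ y ∂μ) atTop := by
          refine lintegral_liminf_le fun n => ?_
          refine Measurable.lintegral_prod_right' (f := fun z : ℝ × ℝ => gaussianPDF z.1 _ z.2) ?_
          unfold gaussianPDF gaussianPDFReal
          fun_prop
      _ = liminf (fun n : ℕ => μ Set.univ) atTop := by
          congr 1 with n
          rw [lintegral_lintegral_swap]
          · have : ∀ y, ∫⁻ x, gaussianPDF x ((n : ℝ≥0) + 1)⁻¹ y = 1 := fun y => by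
              rw [← lintegral_gaussianPDF_eq_one y (v := ((n : ℝ≥0) + 1)⁻¹) (by positivity)]
              refine lintegral_congr fun x => ?_
              simp only [gaussianPDF, gaussianPDFReal]
              congr 4
              ring
            simp [this]
          · refine Measurable.aemeasurable ?_
            unfold gaussianPDF gaussianPDFReal Function.uncurry
            fun_prop
      _ = μ Set.univ := by simp
  have hint : Integrable fun x => (𝓕 F x).re := by
    refine ⟨hcont.aestronglyMeasurable, ?_⟩
    rw [hasFiniteIntegral_iff_ofReal (ae_of_all _ hre)]
    exact hfat.trans_lt (measure_lt_top _ _)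
  refine ⟨fun x => (𝓕 F x).re, hcont, hre, hint, ?_⟩
  have : IsFiniteMeasure (volume.withDensity (fun x => ENNReal.ofReal (𝓕 F x).re)) :=
    isFiniteMeasure_withDensity_ofReal hint.2
  refine Measure.ext_of_charFun (funext fun t => ?_)
  have hFint : Integrable (𝓕 F) := by
    rw [funext hpe]; exact hint.ofReal
  have hinv := congrFun (hFc.fourierInv_fourier_eq hFi hFint) (t / (2 * Real.pi))
  rw [Real.fourierInv_eq'] at hinv
  have h2 : F (t / (2 * Real.pi)) = charFun μ t := by
    simp only [hF]; congr 1; field_simp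
  rw [← h2, ← hinv, charFun_apply_real, integral_withDensity_eq_integral_toReal_smul]
  · refine integral_congr_ae (ae_of_all _ fun x => ?_)
    simp only
    rw [ENNReal.toReal_ofReal (hre x), Complex.real_smul, ← hpe, smul_eq_mul, mul_comm]
    congr 2
    simp
    field_simp
  · exact hcont.measurable.ennreal_ofReal
  · exact ae_of_all _ fun x => ENNReal.ofReal_lt_top

lemma integral_inv_one_add_two_pi_sq : ∫ w : ℝ, (1 + (2 * Real.pi * w) ^ 2)⁻¹ = 1 / 2 := by
  rw [Measure.integral_comp_mul_left (fun u : ℝ => (1 + u ^ 2)⁻¹), integral_univ_inv_one_add_sq,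
    abs_of_pos (by positivity), smul_eq_mul]
  field_simp

/-- A bound of order `(1 + u²)⁻¹` for the two-sided Laplace transform on a vertical line gives an
exponential bound for the function. -/
theorem abs_le_exp_of_laplace_bound {q : ℝ → ℝ} (hq : Continuous q) {s K : ℝ}
    (hint : Integrable fun x => Real.exp (s * x) * q x)
    (hb : ∀ u : ℝ, ‖∫ x : ℝ, Complex.exp ((s + u * Complex.I) * x) * q x‖ ≤ K / (1 + u ^ 2)) (x : ℝ) :
    |q x| ≤ K / 2 * Real.exp (-(s * x)) := by
  -- Exponential tilting: the Fourier transform of `exp (s x) q x` is the Laplace transform of `q`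
  -- along the line of real part `s`.
  set f : ℝ → ℂ := fun x => ((Real.exp (s * x) * q x : ℝ) : ℂ) with hf
  have hfc : Continuous f := by fun_prop
  have hfi : Integrable f := hint.ofReal
  have hFb : ∀ w, ‖𝓕 f w‖ ≤ K * (1 + (2 * Real.pi * w) ^ 2)⁻¹ := by
    intro w
    have := hb (-(2 * Real.pi * w))
    rw [neg_sq] at this
    rw [Real.fourier_real_eq_integral_exp_smul, ← div_eq_mul_inv]
    refine le_trans (le_of_eq ?_) this
    congr 2 with y
    simp only [hf, smul_eq_mul]
    push_cast
    rw [← mul_assoc, ← Complex.exp_add]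
    congr 2
    ring
  have hFi0 : Integrable fun w : ℝ => (1 + (2 * Real.pi * w) ^ 2)⁻¹ :=
    integrable_inv_one_add_sq.comp_mul_left' (by positivity)
  have hFc : Continuous (𝓕 f) :=
    VectorFourier.fourierIntegral_continuous Real.continuous_fourierChar (by fun_prop) hfi
  have hFi : Integrable (𝓕 f) :=
    (hFi0.const_mul K).mono' hFc.aestronglyMeasurable (ae_of_all _ hFb)
  have hinv := congrFun (hfc.fourierInv_fourier_eq hfi hFi) x
  have h1 : ‖f x‖ ≤ K / 2 := by
    rw [← hinv, Real.fourierInv_eq']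
    refine (norm_integral_le_integral_norm _).trans ?_
    have : ∫ w : ℝ, K * (1 + (2 * Real.pi * w) ^ 2)⁻¹ = K / 2 := by
      rw [integral_const_mul, integral_inv_one_add_two_pi_sq]; ring
    rw [← this]
    refine integral_mono_of_nonneg (ae_of_all _ fun _ => norm_nonneg _) (hFi0.const_mul K)
      (ae_of_all _ fun w => ?_)
    simp only
    rw [norm_smul, Complex.norm_exp_ofReal_mul_I, one_mul]
    exact hFb w
  simp only [hf] at h1
  rw [Complex.norm_real, Real.norm_eq_abs, abs_mul, Real.abs_exp] at h1
  rw [Real.exp_neg, ← div_eq_mul_inv, le_div_iff₀ (Real.exp_pos _)]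
  linarith

end HY

/-! ### The Laplace transform of a weighted chi-square sum and its expansion near the real axis. -/

namespace HY

/-- The function `w ↦ E[exp (w (ξ² - 1))]` for a standard normal variable `ξ`. -/
noncomputable def chiFactor (w : ℂ) : ℂ := Complex.exp (-(1 / 2) * Complex.log (1 - 2 * w) - w)

/-- The function `z ↦ E[exp (z ∑ₖ lₖ (ξₖ² - 1))]` for independent standard normal variables. -/
noncomputable def chiMGF {ι : Type*} [Fintype ι] (l : ι → ℝ) (z : ℂ) : ℂ :=
  ∏ k, chiFactor (l k * z)

/-- The two-sided Laplace transform of the second-order expansion with variance `L` and third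
cumulant `κ`. -/
noncomputable def edgeMGF (L κ : ℝ) (z : ℂ) : ℂ :=
  Complex.exp (L * z ^ 2 / 2) * (1 + κ * z ^ 3 / 6)

/-- The centring `-w` cancels the linear term of `-(1/2) log (1 - 2w)`. The two terms kept produce
the second and third cumulants. The constant 4 is half of `2 * 2 ^ 4 / 4`, where the first factor 2
bounds `(1 - ‖2w‖)⁻¹`. -/
lemma norm_chiFactor_log_sub_le {w : ℂ} (hw : ‖w‖ ≤ 1 / 4) :
    ‖-(1 / 2) * Complex.log (1 - 2 * w) - w - w ^ 2 - 4 / 3 * w ^ 3‖ ≤ 4 * ‖w‖ ^ 4 := by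
  have hz : ‖-(2 * w)‖ ≤ 1 / 2 := by rw [norm_neg, norm_mul]; norm_num; linarith
  have h := Complex.norm_log_sub_logTaylor_le 3 (z := -(2 * w)) (by linarith)
  have ht : Complex.logTaylor (3 + 1) (-(2 * w)) = -(2 * w) - 2 * w ^ 2 - 8 / 3 * w ^ 3 := by
    simp only [Complex.logTaylor_succ, Complex.logTaylor_zero]
    simp
    ring
  rw [ht] at h
  have e : -(1 / 2) * Complex.log (1 - 2 * w) - w - w ^ 2 - 4 / 3 * w ^ 3 =
      -(1 / 2) * (Complex.log (1 + -(2 * w)) - (-(2 * w) - 2 * w ^ 2 - 8 / 3 * w ^ 3)) := by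
    rw [← sub_eq_add_neg]; ring
  rw [e, norm_mul]
  have h2 : (1 - ‖-(2 * w)‖)⁻¹ ≤ 2 := by
    rw [inv_le_comm₀ (by linarith) (by norm_num)]; linarith
  have h3 : ‖-(2 * w)‖ ^ (3 + 1) = 16 * ‖w‖ ^ 4 := by
    rw [norm_neg, norm_mul, mul_pow]; norm_num
  rw [h3] at h
  have h4 : ‖(-(1 / 2) : ℂ)‖ = 1 / 2 := by norm_num
  rw [h4]
  have h5 : 16 * ‖w‖ ^ 4 * (1 - ‖-(2 * w)‖)⁻¹ ≤ 16 * ‖w‖ ^ 4 * 2 := by gcongr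
  have h6 := h.trans (div_le_div_of_nonneg_right h5 (by positivity))
  norm_num at h6 ⊢
  linarith

/-- Summing the logarithms and using `l_k⁴ ≤ δ² l_k²` makes the quartic remainder `δ²` times the
variance, whatever the number of terms. -/
lemma chiMGF_eq_exp {ι : Type*} [Fintype ι] (l : ι → ℝ) {δ : ℝ} (hl : ∀ k, |l k| ≤ δ) {z : ℂ}
    (hz : δ * ‖z‖ ≤ 1 / 4) :
    ∃ R : ℂ, ‖R‖ ≤ 2 * δ ^ 2 * (2 * ∑ k, l k ^ 2) * ‖z‖ ^ 4 ∧
      chiMGF l z = Complex.exp ((2 * ∑ k, l k ^ 2 : ℝ) * z ^ 2 / 2 +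
        (8 * ∑ k, l k ^ 3 : ℝ) * z ^ 3 / 6 + R) := by
  have hn : ∀ k, ‖(l k : ℂ) * z‖ = |l k| * ‖z‖ := fun k => by
    rw [norm_mul, Complex.norm_real, Real.norm_eq_abs]
  have hk : ∀ k, ‖(l k : ℂ) * z‖ ≤ 1 / 4 := fun k => by
    rw [hn]; exact (mul_le_mul_of_nonneg_right (hl k) (norm_nonneg _)).trans hz
  refine ⟨∑ k, (-(1 / 2) * Complex.log (1 - 2 * (l k * z)) - l k * z - (l k * z) ^ 2
    - 4 / 3 * (l k * z) ^ 3), ?_, ?_⟩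
  · refine (norm_sum_le _ _).trans ?_
    calc ∑ k, ‖_‖ ≤ ∑ k, 4 * (δ ^ 2 * l k ^ 2 * ‖z‖ ^ 4) := by
          refine Finset.sum_le_sum fun k _ => (norm_chiFactor_log_sub_le (hk k)).trans ?_
          rw [hn, mul_pow]
          have : |l k| ^ 4 = l k ^ 2 * l k ^ 2 := by rw [← sq_abs]; ring
          rw [this]
          have hsq : l k ^ 2 ≤ δ ^ 2 := sq_le_sq.2 ((hl k).trans (le_abs_self _))
          exact mul_le_mul_of_nonneg_left (mul_le_mul_of_nonneg_right
            (mul_le_mul_of_nonneg_right hsq (sq_nonneg _)) (by positivity)) (by norm_num)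
      _ = _ := by simp_rw [Finset.mul_sum, Finset.sum_mul]; congr 1 with k; ring
  · simp only [chiMGF, chiFactor]
    rw [← Complex.exp_sum]
    congr 1
    push_cast
    simp_rw [Finset.mul_sum, Finset.sum_mul, Finset.sum_div, ← Finset.sum_add_distrib]
    congr 1 with k
    ring

/-- The squared modulus of `1 - 2w` is `(1 - 2x)² + 4y²`, which is at least `(1 - 2x)² (1 + y²)`
because `(1 - 2x)² ≤ 4`. This separates the decay in `y` from a real factor, which the Taylor bound
controls. -/
lemma norm_chiFactor_le {x y : ℝ} (hx : |x| ≤ 1 / 4) :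
    ‖chiFactor (x + y * Complex.I)‖ ≤ Real.exp (2 * x ^ 2) * (1 + y ^ 2) ^ (-(1 / 4) : ℝ) := by
  obtain ⟨hx1, hx2⟩ := abs_le.1 hx
  have hw : (1 - 2 * ((x : ℂ) + y * Complex.I)) = ((1 - 2 * x : ℝ) : ℂ) + (-(2 * y) : ℝ) * Complex.I := by
    push_cast; ring
  have hne : (1 - 2 * ((x : ℂ) + y * Complex.I)) ≠ 0 := by
    intro h
    have := congrArg Complex.re h
    simp at this
    linarith
  have hpos : 0 < 1 - 2 * x := by linarith
  have hnorm : ‖chiFactor (x + y * Complex.I)‖ =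
      Real.exp (-(1 / 2) * Real.log ‖1 - 2 * ((x : ℂ) + y * Complex.I)‖ - x) := by
    rw [chiFactor, Complex.norm_exp]
    congr 1
    have h1 : (-(1 / 2) * Complex.log (1 - 2 * ((x : ℂ) + y * Complex.I))).re =
        -(1 / 2) * Real.log ‖1 - 2 * ((x : ℂ) + y * Complex.I)‖ := by
      rw [← Complex.log_re, show (-(1 / 2) : ℂ) = ((-(1 / 2) : ℝ) : ℂ) by norm_num,
        Complex.re_ofReal_mul]
    rw [Complex.sub_re, h1]
    simp
  have hsq : Real.log ‖1 - 2 * ((x : ℂ) + y * Complex.I)‖ =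
      1 / 2 * Real.log ((1 - 2 * x) ^ 2 + (2 * y) ^ 2) := by
    rw [hw, Complex.norm_add_mul_I, Real.log_sqrt (by positivity)]
    ring_nf
  have hlow : 2 * Real.log (1 - 2 * x) + Real.log (1 + y ^ 2) ≤
      Real.log ((1 - 2 * x) ^ 2 + (2 * y) ^ 2) := by
    have : 2 * Real.log (1 - 2 * x) = Real.log ((1 - 2 * x) ^ 2) := by
      rw [Real.log_pow]; norm_num
    rw [this, ← Real.log_mul (by positivity) (by positivity)]
    refine Real.log_le_log (by positivity) ?_
    have : (1 - 2 * x) ^ 2 ≤ 4 := by nlinarith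
    nlinarith [sq_nonneg y]
  have hreal : -(1 / 2) * Real.log (1 - 2 * x) - x ≤ 2 * x ^ 2 := by
    have h := norm_chiFactor_log_sub_le (w := (x : ℂ)) (by
      rwa [Complex.norm_real, Real.norm_eq_abs])
    have e : (-(1 / 2) * Complex.log (1 - 2 * (x : ℂ)) - x - (x : ℂ) ^ 2 - 4 / 3 * (x : ℂ) ^ 3) =
        ((-(1 / 2) * Real.log (1 - 2 * x) - x - x ^ 2 - 4 / 3 * x ^ 3 : ℝ) : ℂ) := by
      have : (1 - 2 * (x : ℂ)) = ((1 - 2 * x : ℝ) : ℂ) := by push_cast; ring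
      rw [this, ← Complex.ofReal_log hpos.le]
      push_cast; ring
    rw [e, Complex.norm_real, Complex.norm_real, Real.norm_eq_abs, Real.norm_eq_abs] at h
    have h' := (abs_le.1 h).2
    have : |x| ^ 4 = x ^ 4 := by rw [← abs_pow, abs_of_nonneg (by positivity)]
    rw [this] at h'
    nlinarith [sq_nonneg x, mul_nonneg (sq_nonneg x) (sub_nonneg.2 hx2),
      mul_nonneg (sq_nonneg x) (show 0 ≤ 1 / 16 - x ^ 2 by nlinarith)]
  rw [hnorm, hsq, Real.rpow_def_of_pos (by positivity), ← Real.exp_add]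
  refine Real.exp_le_exp.2 ?_
  linarith

/-- Bernoulli's inequality with exponent `l_k² / δ² ≤ 1` gives `(1 + (δu)²)^{l_k²/δ²} ≤ 1 + (l_k
u)²`. All factors are then powers of one base, and the exponents add up to the variance over `8δ²`.
-/
lemma prod_one_add_rpow_le {ι : Type*} [Fintype ι] (l : ι → ℝ) {δ : ℝ} (hδ : 0 < δ)
    (hl : ∀ k, |l k| ≤ δ) (u : ℝ) :
    ∏ k, (1 + (l k * u) ^ 2) ^ (-(1 / 4) : ℝ) ≤
      (1 + (δ * u) ^ 2) ^ (-((2 * ∑ k, l k ^ 2) / (8 * δ ^ 2)) : ℝ) := by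
  have hb : 0 < 1 + (δ * u) ^ 2 := by positivity
  have e : (-((2 * ∑ k, l k ^ 2) / (8 * δ ^ 2)) : ℝ) = ∑ k, (l k ^ 2 / δ ^ 2) * (-(1 / 4)) := by
    rw [Finset.mul_sum, Finset.sum_div, ← Finset.sum_neg_distrib]
    congr 1 with k
    field_simp
    ring
  rw [e, Real.rpow_sum_of_pos hb]
  refine Finset.prod_le_prod (fun k _ => by positivity) fun k _ => ?_
  rw [Real.rpow_mul hb.le]
  refine Real.rpow_le_rpow_of_nonpos (by positivity) ?_ (by norm_num)
  have h := rpow_one_add_le_one_add_mul_self (s := (δ * u) ^ 2) (p := l k ^ 2 / δ ^ 2)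
    (by linarith [sq_nonneg (δ * u)]) (by positivity) (by
      rw [div_le_one (by positivity)]
      exact sq_le_sq.2 ((hl k).trans (le_abs_self _)))
  refine h.trans (le_of_eq ?_)
  field_simp

lemma norm_chiMGF_le {ι : Type*} [Fintype ι] (l : ι → ℝ) {δ : ℝ} (hδ : 0 < δ)
    (hl : ∀ k, |l k| ≤ δ) {s : ℝ} (hs : δ * |s| ≤ 1 / 4) (u : ℝ) :
    ‖chiMGF l (s + u * Complex.I)‖ ≤ Real.exp (s ^ 2 * (2 * ∑ k, l k ^ 2)) *
      (1 + (δ * u) ^ 2) ^ (-((2 * ∑ k, l k ^ 2) / (8 * δ ^ 2)) : ℝ) := by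
  rw [chiMGF, norm_prod]
  calc ∏ k, ‖_‖ ≤ ∏ k, Real.exp (2 * (l k * s) ^ 2) * (1 + (l k * u) ^ 2) ^ (-(1 / 4) : ℝ) := by
        refine Finset.prod_le_prod (fun k _ => norm_nonneg _) fun k _ => ?_
        have : (l k : ℂ) * (s + u * Complex.I) = ((l k * s : ℝ) : ℂ) + (l k * u : ℝ) * Complex.I := by
          push_cast; ring
        rw [this]
        refine norm_chiFactor_le ?_
        rw [abs_mul]
        exact (mul_le_mul_of_nonneg_right (hl k) (abs_nonneg _)).trans hs
    _ = Real.exp (s ^ 2 * (2 * ∑ k, l k ^ 2)) * ∏ k, (1 + (l k * u) ^ 2) ^ (-(1 / 4) : ℝ) := by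
        rw [Finset.prod_mul_distrib, ← Real.exp_sum]
        congr 2
        rw [Finset.mul_sum, Finset.mul_sum]
        congr 1 with k; ring
    _ ≤ _ := by
        gcongr
        exact prod_one_add_rpow_le l hδ hl u

/-- The common integrable majorant `1 / (1 + u²)` for polynomial times Gaussian decay, with one
constant for the whole strip; it comes from `y ^ (n + 1) ≤ (n + 1)! exp y`. -/
lemma exists_pow_mul_exp_le (n : ℕ) {c s₀ : ℝ} (hc : 0 < c) :
    ∃ K : ℝ, 0 ≤ K ∧ ∀ s u : ℝ, |s| ≤ s₀ →
      (1 + s ^ 2 + u ^ 2) ^ n * Real.exp (-(c * u ^ 2)) ≤ K / (1 + u ^ 2) := by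
  refine ⟨(n + 1).factorial / c ^ (n + 1) * Real.exp (c * (1 + s₀ ^ 2)), by positivity, ?_⟩
  intro s u hs
  have hs2 : s ^ 2 ≤ s₀ ^ 2 := sq_le_sq.2 (hs.trans (le_abs_self _))
  rw [le_div_iff₀ (by positivity)]
  have h := Real.pow_div_factorial_le_exp (c * (1 + s ^ 2 + u ^ 2)) (by positivity) (n + 1)
  rw [div_le_iff₀ (by positivity), mul_pow] at h
  have h1 : (1 + s ^ 2 + u ^ 2) ^ n * (1 + u ^ 2) ≤ (1 + s ^ 2 + u ^ 2) ^ (n + 1) := by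
    rw [pow_succ (1 + s ^ 2 + u ^ 2)]
    exact mul_le_mul_of_nonneg_left (by linarith [sq_nonneg s]) (by positivity)
  have h2 : (1 + s ^ 2 + u ^ 2) ^ (n + 1) ≤
      Real.exp (c * (1 + s ^ 2 + u ^ 2)) * (n + 1).factorial / c ^ (n + 1) := by
    rw [le_div_iff₀ (by positivity)]; linarith
  have h3 : Real.exp (c * (1 + s ^ 2 + u ^ 2)) ≤ Real.exp (c * (1 + s₀ ^ 2)) * Real.exp (c * u ^ 2) := by
    rw [← Real.exp_add]; refine Real.exp_le_exp.2 ?_; nlinarith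
  calc (1 + s ^ 2 + u ^ 2) ^ n * Real.exp (-(c * u ^ 2)) * (1 + u ^ 2)
      = ((1 + s ^ 2 + u ^ 2) ^ n * (1 + u ^ 2)) * Real.exp (-(c * u ^ 2)) := by ring
    _ ≤ (Real.exp (c * (1 + s₀ ^ 2)) * Real.exp (c * u ^ 2)) * (n + 1).factorial / c ^ (n + 1)
        * Real.exp (-(c * u ^ 2)) := by
        refine mul_le_mul_of_nonneg_right (h1.trans (h2.trans ?_)) (Real.exp_nonneg _)
        exact div_le_div_of_nonneg_right (mul_le_mul_of_nonneg_right h3 (by positivity)) (by positivity)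
    _ = _ := by
        rw [Real.exp_neg]
        field_simp

lemma norm_sq_add_mul_I (s u : ℝ) : ‖(s : ℂ) + u * Complex.I‖ ^ 2 = s ^ 2 + u ^ 2 := by
  rw [Complex.norm_add_mul_I, Real.sq_sqrt (by positivity)]

lemma norm_cexp_mul_sq (V s u : ℝ) :
    ‖Complex.exp (V * ((s : ℂ) + u * Complex.I) ^ 2 / 2)‖ = Real.exp (V * (s ^ 2 - u ^ 2) / 2) := by
  rw [Complex.norm_exp]
  congr 1
  have : (V * ((s : ℂ) + u * Complex.I) ^ 2 / 2) =
      ((V * (s ^ 2 - u ^ 2) / 2 : ℝ) : ℂ) + (V * s * u : ℝ) * Complex.I := by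
    push_cast; ring_nf; rw [Complex.I_sq]; ring
  rw [this, Complex.add_re, Complex.re_ofReal_mul, Complex.I_re, mul_zero, add_zero, Complex.ofReal_re]

/-- Powers of the norm of a complex number of bounded real part. -/
lemma norm_pow_le_pow (s u : ℝ) {k n : ℕ} (h : k ≤ 2 * n) :
    ‖(s : ℂ) + u * Complex.I‖ ^ k ≤ (1 + s ^ 2 + u ^ 2) ^ n := by
  have h1 : ‖(s : ℂ) + u * Complex.I‖ ≤ Real.sqrt (1 + s ^ 2 + u ^ 2) := by
    refine Real.le_sqrt_of_sq_le ?_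
    rw [norm_sq_add_mul_I]; linarith
  have h2 : 1 ≤ Real.sqrt (1 + s ^ 2 + u ^ 2) := Real.one_le_sqrt.2 (by nlinarith [sq_nonneg s, sq_nonneg u])
  calc _ ≤ Real.sqrt (1 + s ^ 2 + u ^ 2) ^ k := by gcongr
    _ ≤ Real.sqrt (1 + s ^ 2 + u ^ 2) ^ (2 * n) := pow_le_pow_right₀ h2 h
    _ = _ := by rw [pow_mul, Real.sq_sqrt (by positivity)]

/-- On a vertical line `Re z² = s² - u²`, so the Gaussian factor decays in `u` and the cubic
polynomial costs only a power of `1 + s² + u²`. -/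
lemma norm_edgeMGF_le {L κ c₀ c₁ κ₁ s₀ : ℝ} (hc₀ : 0 < c₀) (h0 : c₀ ≤ L) (h1 : L ≤ c₁) (hκ : |κ| ≤ κ₁)
    {s u : ℝ} (hs : |s| ≤ s₀) :
    ‖edgeMGF L κ (s + u * Complex.I)‖ ≤
      Real.exp (c₁ * s₀ ^ 2) * (1 + κ₁) * ((1 + s ^ 2 + u ^ 2) ^ 2 * Real.exp (-(c₀ / 4 * u ^ 2))) := by
  have hs2 : s ^ 2 ≤ s₀ ^ 2 := sq_le_sq.2 (hs.trans (le_abs_self _))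
  have hκ0 : 0 ≤ κ₁ := (abs_nonneg _).trans hκ
  rw [edgeMGF, norm_mul, norm_cexp_mul_sq]
  have e1 : Real.exp (L * (s ^ 2 - u ^ 2) / 2) ≤ Real.exp (c₁ * s₀ ^ 2) * Real.exp (-(c₀ / 4 * u ^ 2)) := by
    rw [← Real.exp_add]; refine Real.exp_le_exp.2 ?_
    have a1 : L * s ^ 2 ≤ c₁ * s₀ ^ 2 := mul_le_mul h1 hs2 (sq_nonneg _) (by linarith)
    have a2 : c₀ * u ^ 2 ≤ L * u ^ 2 := by gcongr
    have a3 : 0 ≤ c₁ * s₀ ^ 2 := mul_nonneg (by linarith) (sq_nonneg _)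
    have a4 : 0 ≤ c₀ * u ^ 2 := by positivity
    linarith
  have e2 : ‖1 + (κ : ℂ) * (s + u * Complex.I) ^ 3 / 6‖ ≤ (1 + κ₁) * (1 + s ^ 2 + u ^ 2) ^ 2 := by
    refine (norm_add_le _ _).trans ?_
    rw [norm_one, norm_div, norm_mul, norm_pow, Complex.norm_real, Real.norm_eq_abs]
    have b1 := norm_pow_le_pow s u (show 3 ≤ 2 * 2 by norm_num)
    have b2 : 1 ≤ (1 + s ^ 2 + u ^ 2) ^ 2 := one_le_pow₀ (by nlinarith [sq_nonneg s, sq_nonneg u])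
    have b3 : |κ| * ‖(s : ℂ) + u * Complex.I‖ ^ 3 ≤ κ₁ * (1 + s ^ 2 + u ^ 2) ^ 2 := by gcongr
    have b4 : ‖(6 : ℂ)‖ = 6 := by norm_num
    rw [b4, add_mul, one_mul]
    have b5 : |κ| * ‖(s : ℂ) + u * Complex.I‖ ^ 3 / 6 ≤ |κ| * ‖(s : ℂ) + u * Complex.I‖ ^ 3 :=
      div_le_self (by positivity) (by norm_num)
    linarith
  calc _ ≤ (Real.exp (c₁ * s₀ ^ 2) * Real.exp (-(c₀ / 4 * u ^ 2))) * ((1 + κ₁) * (1 + s ^ 2 + u ^ 2) ^ 2) := by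
        gcongr
    _ = _ := by ring

/-- The third cumulant is of order `δ`, since `|l_k|³ ≤ δ l_k²`. Hence its square, and its product
with another quantity of order `δ`, are of order `δ²`. -/
lemma abs_sum_cube_le {ι : Type*} [Fintype ι] (l : ι → ℝ) {δ : ℝ} (hl : ∀ k, |l k| ≤ δ) :
    |8 * ∑ k, l k ^ 3| ≤ 4 * δ * (2 * ∑ k, l k ^ 2) := by
  rw [abs_mul, abs_of_pos (by norm_num : (0 : ℝ) < 8)]
  have : |∑ k, l k ^ 3| ≤ ∑ k, δ * l k ^ 2 := by
    refine (Finset.abs_sum_le_sum_abs _ _).trans (Finset.sum_le_sum fun k _ => ?_)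
    rw [abs_pow, pow_succ, sq_abs, mul_comm]
    gcongr
    exact hl k
  rw [← Finset.mul_sum] at this
  linarith

/-- Taylor expansion of `chiMGF` near the real axis. -/
lemma norm_chiMGF_sub_edgeMGF_le {ι : Type*} [Fintype ι] (l : ι → ℝ) {δ c₀ c₁ s₀ : ℝ} (hc₀ : 0 < c₀)
    (hδ : 0 < δ) (hl : ∀ k, |l k| ≤ δ) (h0 : c₀ ≤ 2 * ∑ k, l k ^ 2) (h1 : 2 * ∑ k, l k ^ 2 ≤ c₁)
    {s u : ℝ} (hs : |s| ≤ s₀) (hz : δ * ‖(s : ℂ) + u * Complex.I‖ ≤ 1 / 8) :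
    ‖chiMGF l (s + u * Complex.I) -
      edgeMGF (2 * ∑ k, l k ^ 2) (8 * ∑ k, l k ^ 3) (s + u * Complex.I)‖ ≤
      δ ^ 2 * (Real.exp (c₁ * s₀ ^ 2) * (c₁ ^ 2 + 2 * c₁) *
        ((1 + s ^ 2 + u ^ 2) ^ 3 * Real.exp (-(c₀ / 4 * u ^ 2)))) := by
  set L := 2 * ∑ k, l k ^ 2 with hL
  set κ := 8 * ∑ k, l k ^ 3 with hκ
  set z : ℂ := (s : ℂ) + u * Complex.I with hzdef
  have hLpos : 0 < L := hc₀.trans_le h0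
  have hc1 : 0 < c₁ := hLpos.trans_le h1
  have hs2 : s ^ 2 ≤ s₀ ^ 2 := sq_le_sq.2 (hs.trans (le_abs_self _))
  obtain ⟨R, hR, hG⟩ := chiMGF_eq_exp l hl (z := z) (by linarith)
  rw [← hL] at hR hG
  rw [← hκ] at hG
  have hκb : |κ| ≤ 4 * δ * L := abs_sum_cube_le l hl
  -- Everything beyond the quadratic term of the exponent. It is of first order in `δ`, while `R`
  -- alone is of second order.
  set w : ℂ := κ * z ^ 3 / 6 + R with hw
  have hn0 : 0 ≤ ‖z‖ := norm_nonneg _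
  have hz2 : ‖z‖ ^ 2 = s ^ 2 + u ^ 2 := norm_sq_add_mul_I s u
  have hdz : δ * ‖z‖ ^ 1 ≤ 1 / 8 := by simpa using hz
  have hk3 : ‖(κ : ℂ) * z ^ 3 / 6‖ ≤ 2 / 3 * (δ * L * ‖z‖ ^ 3) := by
    rw [norm_div, norm_mul, norm_pow, Complex.norm_real, Real.norm_eq_abs]
    have : ‖(6 : ℂ)‖ = 6 := by norm_num
    rw [this]
    have : |κ| * ‖z‖ ^ 3 ≤ 4 * δ * L * ‖z‖ ^ 3 := by gcongr
    linarith
  have hRb : ‖R‖ ≤ 1 / 4 * (δ * L * ‖z‖ ^ 3) := by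
    refine hR.trans ?_
    have : δ * L * ‖z‖ ^ 3 * (δ * ‖z‖) ≤ δ * L * ‖z‖ ^ 3 * (1 / 8) := by gcongr
    nlinarith
  have hwb : ‖w‖ ≤ δ * L * ‖z‖ ^ 3 := by
    have hx : 0 ≤ δ * L * ‖z‖ ^ 3 := by positivity
    calc ‖w‖ ≤ _ := norm_add_le _ _
      _ ≤ 2 / 3 * (δ * L * ‖z‖ ^ 3) + 1 / 4 * (δ * L * ‖z‖ ^ 3) := add_le_add hk3 hRb
      _ ≤ _ := by linarith
  -- The restriction `δ‖z‖ ≤ 1/8` makes `exp ‖w‖` harmless: of the Gaussian decay `exp (-L u² / 2)`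
  -- it uses up only `exp (L u² / 8)`, and more than the rate `c₀ / 4` remains.
  have hwb2 : ‖w‖ ≤ L * ‖z‖ ^ 2 / 8 := by
    refine hwb.trans ?_
    have : L * ‖z‖ ^ 2 * (δ * ‖z‖) ≤ L * ‖z‖ ^ 2 * (1 / 8) := by gcongr
    nlinarith
  -- The cubic term is part of both sides; what remains is the quadratic Taylor remainder of `exp w`
  -- plus `R`, both of order `δ²`.
  have e1 : chiMGF l z - edgeMGF L κ z = Complex.exp (L * z ^ 2 / 2) *
      ((Complex.exp w - (1 + w)) + R) := by
    rw [hG, edgeMGF, add_assoc, Complex.exp_add, hw]; ring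
  have e2 : ‖Complex.exp w - (1 + w)‖ ≤ ‖w‖ ^ 2 * Real.exp ‖w‖ := by
    have := Complex.norm_exp_sub_sum_le_norm_mul_exp w 2
    simpa [Finset.sum_range_succ] using this
  have e3 : ‖(Complex.exp w - (1 + w)) + R‖ ≤
      δ ^ 2 * ((c₁ ^ 2 + 2 * c₁) * (1 + s ^ 2 + u ^ 2) ^ 3) * Real.exp (L * ‖z‖ ^ 2 / 8) := by
    have f1 : ‖w‖ ^ 2 * Real.exp ‖w‖ ≤ (δ ^ 2 * (L ^ 2 * ‖z‖ ^ 6)) * Real.exp (L * ‖z‖ ^ 2 / 8) := by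
      gcongr
      calc ‖w‖ ^ 2 ≤ (δ * L * ‖z‖ ^ 3) ^ 2 := by gcongr
        _ = _ := by ring
    have f2 : ‖R‖ ≤ δ ^ 2 * (2 * L * ‖z‖ ^ 4) * Real.exp (L * ‖z‖ ^ 2 / 8) := by
      refine hR.trans ?_
      rw [show 2 * δ ^ 2 * L * ‖z‖ ^ 4 = δ ^ 2 * (2 * L * ‖z‖ ^ 4) by ring]
      exact le_mul_of_one_le_right (by positivity) (Real.one_le_exp (by positivity))
    have g1 : ‖z‖ ^ 6 ≤ (1 + s ^ 2 + u ^ 2) ^ 3 := norm_pow_le_pow s u (by norm_num)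
    have g2 : ‖z‖ ^ 4 ≤ (1 + s ^ 2 + u ^ 2) ^ 3 := norm_pow_le_pow s u (by norm_num)
    calc _ ≤ ‖Complex.exp w - (1 + w)‖ + ‖R‖ := norm_add_le _ _
      _ ≤ (δ ^ 2 * (L ^ 2 * ‖z‖ ^ 6)) * Real.exp (L * ‖z‖ ^ 2 / 8) +
          δ ^ 2 * (2 * L * ‖z‖ ^ 4) * Real.exp (L * ‖z‖ ^ 2 / 8) := add_le_add (e2.trans f1) f2
      _ ≤ (δ ^ 2 * (c₁ ^ 2 * (1 + s ^ 2 + u ^ 2) ^ 3)) * Real.exp (L * ‖z‖ ^ 2 / 8) +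
          δ ^ 2 * (2 * c₁ * (1 + s ^ 2 + u ^ 2) ^ 3) * Real.exp (L * ‖z‖ ^ 2 / 8) := by gcongr
      _ = _ := by ring
  have e4 : Real.exp (L * (s ^ 2 - u ^ 2) / 2) * Real.exp (L * ‖z‖ ^ 2 / 8) ≤
      Real.exp (c₁ * s₀ ^ 2) * Real.exp (-(c₀ / 4 * u ^ 2)) := by
    rw [← Real.exp_add, ← Real.exp_add, hz2]; refine Real.exp_le_exp.2 ?_
    have a1 : L * s ^ 2 ≤ c₁ * s₀ ^ 2 := mul_le_mul h1 hs2 (sq_nonneg _) (by linarith)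
    have a2 : c₀ * u ^ 2 ≤ L * u ^ 2 := by gcongr
    have a3 : 0 ≤ L * s ^ 2 := by positivity
    have a4 : 0 ≤ c₀ * u ^ 2 := by positivity
    linarith
  rw [e1, norm_mul, norm_cexp_mul_sq]
  calc _ ≤ Real.exp (L * (s ^ 2 - u ^ 2) / 2) * (δ ^ 2 * ((c₁ ^ 2 + 2 * c₁) * (1 + s ^ 2 + u ^ 2) ^ 3) * Real.exp (L * ‖z‖ ^ 2 / 8)) := by gcongr
    _ = (δ ^ 2 * ((c₁ ^ 2 + 2 * c₁) * (1 + s ^ 2 + u ^ 2) ^ 3)) *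
        (Real.exp (L * (s ^ 2 - u ^ 2) / 2) * Real.exp (L * ‖z‖ ^ 2 / 8)) := by ring
    _ ≤ (δ ^ 2 * ((c₁ ^ 2 + 2 * c₁) * (1 + s ^ 2 + u ^ 2) ^ 3)) *
        (Real.exp (c₁ * s₀ ^ 2) * Real.exp (-(c₀ / 4 * u ^ 2))) := by gcongr
    _ = _ := by ring

end HY

/-! ### Decay far from the real axis and the uniform estimate on a strip. -/

namespace HY

/-- The exponent is at least 2, so half of it absorbs the factor `1 + u² ≤ y / δ²`. The base is at
least `1 + 1/256`, so the other half is at most `exp (-t)` with `t` of order `δ⁻²`; then `exp (-t) ≤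
2 / t²` is of order `δ⁴`, and the loss of `δ⁻²` leaves `δ²`. -/
lemma outer_rpow_le {c₀ δ L u : ℝ} (hc₀ : 0 < c₀) (hδ : 0 < δ) (hδ1 : δ ≤ 1) (hδc : 16 * δ ^ 2 ≤ c₀)
    (h0 : c₀ ≤ L) (hu : 1 / 16 ≤ δ * |u|) :
    (1 + (δ * u) ^ 2) ^ (-(L / (8 * δ ^ 2)) : ℝ) ≤
      δ ^ 2 * (512 / (c₀ * Real.log (1 + 1 / 256)) ^ 2) / (1 + u ^ 2) := by
  set y := 1 + (δ * u) ^ 2 with hy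
  have hL : 0 < L := hc₀.trans_le h0
  have hu2 : 1 / 256 ≤ (δ * u) ^ 2 := by
    rw [← sq_abs, abs_mul, abs_of_pos hδ]
    exact le_trans (by norm_num) (pow_le_pow_left₀ (by norm_num) hu 2)
  have hy1 : 1 + 1 / 256 ≤ y := by rw [hy]; linarith
  have hypos : 0 < y := by linarith
  have hlog : 0 < Real.log (1 + 1 / 256) := Real.log_pos (by norm_num)
  have hN : 2 ≤ L / (8 * δ ^ 2) := by rw [le_div_iff₀ (by positivity)]; linarith
  have h1 : 1 + u ^ 2 ≤ y / δ ^ 2 := by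
    rw [le_div_iff₀ (by positivity), hy]; nlinarith [pow_le_one₀ hδ.le hδ1 (n := 2)]
  have h2 : y * y ^ (-(L / (8 * δ ^ 2)) : ℝ) ≤ y ^ (-(L / (8 * δ ^ 2)) / 2 : ℝ) := by
    nth_rewrite 1 [← Real.rpow_one y]
    rw [← Real.rpow_add hypos]
    exact Real.rpow_le_rpow_of_exponent_le (by linarith) (by linarith)
  set t := c₀ / (16 * δ ^ 2) * Real.log (1 + 1 / 256) with ht
  have htpos : 0 < t := by positivity
  have h3 : y ^ (-(L / (8 * δ ^ 2)) / 2 : ℝ) ≤ Real.exp (-t) := by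
    rw [Real.rpow_def_of_pos hypos]
    refine Real.exp_le_exp.2 ?_
    have a1 : Real.log (1 + 1 / 256) ≤ Real.log y := Real.log_le_log (by norm_num) hy1
    have a2 : c₀ / (16 * δ ^ 2) ≤ L / (16 * δ ^ 2) := by gcongr
    have a3 : t ≤ L / (16 * δ ^ 2) * Real.log y := mul_le_mul a2 a1 hlog.le (by positivity)
    have a4 : L / (16 * δ ^ 2) * Real.log y = Real.log y * (L / (8 * δ ^ 2)) / 2 := by
      field_simp; ring
    linarith
  have h4 : Real.exp (-t) ≤ 2 / t ^ 2 := by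
    have := Real.pow_div_factorial_le_exp t htpos.le 2
    rw [Real.exp_neg, inv_le_comm₀ (Real.exp_pos _) (by positivity), inv_div]
    simpa using this
  rw [le_div_iff₀ (by positivity)]
  calc y ^ (-(L / (8 * δ ^ 2)) : ℝ) * (1 + u ^ 2)
      ≤ y ^ (-(L / (8 * δ ^ 2)) : ℝ) * (y / δ ^ 2) := by gcongr
    _ = y * y ^ (-(L / (8 * δ ^ 2)) : ℝ) / δ ^ 2 := by ring
    _ ≤ (2 / t ^ 2) / δ ^ 2 := by gcongr; exact h2.trans (h3.trans h4)
    _ = _ := by rw [ht]; field_simp; ring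

/-- Second-order expansion of the Laplace transform of a quadratic form in independent standard
normal variables, uniformly on a vertical strip. -/
theorem exists_norm_chiMGF_sub_le {c₀ : ℝ} (c₁ s₀ : ℝ) (hc₀ : 0 < c₀) :
    ∃ δ₀ K : ℝ, 0 < δ₀ ∧ 0 ≤ K ∧ ∀ (ι : Type) [Fintype ι] (l : ι → ℝ) (δ : ℝ), 0 < δ → δ ≤ δ₀ →
      (∀ k, |l k| ≤ δ) → c₀ ≤ 2 * ∑ k, l k ^ 2 → 2 * ∑ k, l k ^ 2 ≤ c₁ →
      ∀ s u : ℝ, |s| ≤ s₀ →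
        ‖chiMGF l (s + u * Complex.I) -
          edgeMGF (2 * ∑ k, l k ^ 2) (8 * ∑ k, l k ^ 3) (s + u * Complex.I)‖ ≤
            K * δ ^ 2 / (1 + u ^ 2) ∧
        ‖chiMGF l (s + u * Complex.I)‖ ≤ K / (1 + u ^ 2) := by
  obtain ⟨K3, hK3, hK3'⟩ := exists_pow_mul_exp_le 3 (c := c₀ / 4) (s₀ := s₀) (by positivity)
  set A := Real.exp (c₁ * s₀ ^ 2) with hA
  set K1 := A * (c₁ ^ 2 + 2 * |c₁|) * K3 with hK1
  set K2 := A * (512 / (c₀ * Real.log (1 + 1 / 256)) ^ 2) with hK2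
  set K4 := A * (1 + 4 * |c₁|) * K3 with hK4
  have hlog : 0 < Real.log (1 + 1 / 256) := Real.log_pos (by norm_num)
  have hK1p : 0 ≤ K1 := by positivity
  have hK2p : 0 ≤ K2 := by positivity
  have hK4p : 0 ≤ K4 := by positivity
  have hKp : 0 ≤ K1 + K2 + 256 * K4 := by positivity
  -- In the threshold for `δ`, the term with `s₀` keeps the real part negligible when `δ‖z‖ > 1/8`,
  -- and `√c₀ / 4` makes the decay exponent in `outer_rpow_le` at least 2.
  have key : ∀ (ι : Type) [Fintype ι] (l : ι → ℝ) (δ : ℝ), 0 < δ →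
      δ ≤ min (min 1 (1 / (16 * (|s₀| + 1)))) (Real.sqrt c₀ / 4) →
      (∀ k, |l k| ≤ δ) → c₀ ≤ 2 * ∑ k, l k ^ 2 → 2 * ∑ k, l k ^ 2 ≤ c₁ →
      ∀ s u : ℝ, |s| ≤ s₀ →
        ‖chiMGF l (s + u * Complex.I) -
          edgeMGF (2 * ∑ k, l k ^ 2) (8 * ∑ k, l k ^ 3) (s + u * Complex.I)‖ ≤
            (K1 + K2 + 256 * K4) * δ ^ 2 / (1 + u ^ 2) ∧
        ‖edgeMGF (2 * ∑ k, l k ^ 2) (8 * ∑ k, l k ^ 3) (s + u * Complex.I)‖ ≤ K4 / (1 + u ^ 2) := by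
    intro ι _ l δ hδ hδ0 hl h0 h1 s u hs
    have hδ1 : δ ≤ 1 := hδ0.trans ((min_le_left _ _).trans (min_le_left _ _))
    have hδs : δ * (|s₀| + 1) ≤ 1 / 16 := by
      have : δ ≤ 1 / (16 * (|s₀| + 1)) := hδ0.trans ((min_le_left _ _).trans (min_le_right _ _))
      rw [le_div_iff₀ (by positivity)] at this; linarith
    have hδc : 16 * δ ^ 2 ≤ c₀ := by
      have : 4 * δ ≤ Real.sqrt c₀ := by linarith [hδ0.trans (min_le_right _ _)]
      have := Real.le_sqrt' (by positivity) |>.1 this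
      nlinarith
    have hc1 : 0 < c₁ := hc₀.trans_le (h0.trans h1)
    have hc1a : |c₁| = c₁ := abs_of_pos hc1
    have hδss : δ * |s| ≤ 1 / 16 := by
      have : δ * |s| ≤ δ * (|s₀| + 1) := by gcongr; linarith [le_abs_self s₀]
      linarith
    have hsum : 0 < 2 * ∑ k, l k ^ 2 := hc₀.trans_le h0
    have hκ : |8 * ∑ k, l k ^ 3| ≤ 4 * |c₁| := by
      refine (abs_sum_cube_le l hl).trans ?_
      rw [hc1a]; nlinarith
    have hpow : (1 + s ^ 2 + u ^ 2) ^ 2 ≤ (1 + s ^ 2 + u ^ 2) ^ 3 :=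
      pow_le_pow_right₀ (by nlinarith [sq_nonneg s, sq_nonneg u]) (by norm_num)
    have hedge : ‖edgeMGF (2 * ∑ k, l k ^ 2) (8 * ∑ k, l k ^ 3) (s + u * Complex.I)‖ ≤
        K4 / (1 + u ^ 2) := by
      refine (norm_edgeMGF_le hc₀ h0 h1 hκ hs).trans ?_
      rw [hK4, mul_div_assoc]
      refine mul_le_mul_of_nonneg_left (le_trans ?_ (hK3' s u hs)) (by positivity)
      gcongr
    refine ⟨?_, hedge⟩
    rcases le_or_gt (δ * ‖(s : ℂ) + u * Complex.I‖) (1 / 8) with hz | hz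
    · refine (norm_chiMGF_sub_edgeMGF_le l hc₀ hδ hl h0 h1 hs hz).trans ?_
      calc _ ≤ δ ^ 2 * (A * (c₁ ^ 2 + 2 * c₁) * (K3 / (1 + u ^ 2))) := by
            have := hK3' s u hs
            gcongr
        _ = K1 * δ ^ 2 / (1 + u ^ 2) := by rw [hK1, hc1a]; ring
        _ ≤ _ := by
            gcongr
            nlinarith
    -- Far region: since `δ|s| ≤ 1/16`, the imaginary part must be large. Both transforms are then
    -- separately of order `δ²`, and no cancellation is needed.
    · have hu : 1 / 16 ≤ δ * |u| := by
        have : ‖(s : ℂ) + u * Complex.I‖ ≤ |s| + |u| := by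
          refine (norm_add_le _ _).trans (le_of_eq ?_)
          simp
        have := mul_le_mul_of_nonneg_left this hδ.le
        linarith
      have hG := norm_chiMGF_le l hδ hl (s := s) (by linarith) u
      have hs2 : s ^ 2 ≤ s₀ ^ 2 := sq_le_sq.2 (hs.trans (le_abs_self _))
      have hexp : Real.exp (s ^ 2 * (2 * ∑ k, l k ^ 2)) ≤ A := by
        refine Real.exp_le_exp.2 ?_
        rw [mul_comm]
        exact mul_le_mul h1 hs2 (sq_nonneg _) hc1.le
      have hG2 : ‖chiMGF l (s + u * Complex.I)‖ ≤ K2 * δ ^ 2 / (1 + u ^ 2) := by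
        refine hG.trans ?_
        refine (mul_le_mul hexp (outer_rpow_le hc₀ hδ hδ1 hδc h0 hu) (by positivity)
          (by positivity)).trans (le_of_eq ?_)
        rw [hK2]; ring
      have hE : ‖edgeMGF (2 * ∑ k, l k ^ 2) (8 * ∑ k, l k ^ 3) (s + u * Complex.I)‖ ≤
          256 * K4 * δ ^ 2 / (1 + u ^ 2) := by
        refine (norm_edgeMGF_le hc₀ h0 h1 hκ hs).trans ?_
        -- A factor that is at least 1 in the far region; inserting it trades one more power of `1 +
        -- s² + u²` for the gain `δ²`.
        have hu2 : 1 ≤ 256 * δ ^ 2 * (1 + s ^ 2 + u ^ 2) := by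
          have := pow_le_pow_left₀ (by norm_num) hu 2
          rw [mul_pow, sq_abs] at this
          linarith [sq_nonneg δ, mul_nonneg (sq_nonneg δ) (sq_nonneg s)]
        calc _ ≤ A * (1 + 4 * |c₁|) * ((1 + s ^ 2 + u ^ 2) ^ 2 * Real.exp (-(c₀ / 4 * u ^ 2))) *
              (256 * δ ^ 2 * (1 + s ^ 2 + u ^ 2)) := le_mul_of_one_le_right (by positivity) hu2
          _ = A * (1 + 4 * |c₁|) * (256 * δ ^ 2) *
              ((1 + s ^ 2 + u ^ 2) ^ 3 * Real.exp (-(c₀ / 4 * u ^ 2))) := by ring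
          _ ≤ A * (1 + 4 * |c₁|) * (256 * δ ^ 2) * (K3 / (1 + u ^ 2)) := by
              have := hK3' s u hs
              gcongr
          _ = _ := by rw [hK4]; ring
      calc _ ≤ K2 * δ ^ 2 / (1 + u ^ 2) + 256 * K4 * δ ^ 2 / (1 + u ^ 2) :=
            (norm_sub_le _ _).trans (add_le_add hG2 hE)
        _ = (K2 + 256 * K4) * δ ^ 2 / (1 + u ^ 2) := by ring
        _ ≤ _ := by gcongr; linarith
  refine ⟨min (min 1 (1 / (16 * (|s₀| + 1)))) (Real.sqrt c₀ / 4), K1 + K2 + 256 * K4 + K4, ?_,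
    by positivity, ?_⟩
  · have := Real.sqrt_pos.2 hc₀
    positivity
  intro ι _ l δ hδ hδ0 hl h0 h1 s u hs
  obtain ⟨h2, h3⟩ := key ι l δ hδ hδ0 hl h0 h1 s u hs
  have hδ1 : δ ^ 2 ≤ 1 := pow_le_one₀ hδ.le (hδ0.trans ((min_le_left _ _).trans (min_le_left _ _)))
  refine ⟨h2.trans (div_le_div_of_nonneg_right (mul_le_mul_of_nonneg_right (by linarith)
    (sq_nonneg _)) (by positivity)), ?_⟩
  calc _ ≤ (K1 + K2 + 256 * K4) * δ ^ 2 / (1 + u ^ 2) + K4 / (1 + u ^ 2) := by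
        refine (norm_le_norm_sub_add _ _).trans (add_le_add h2 h3)
    _ = ((K1 + K2 + 256 * K4) * δ ^ 2 + K4) / (1 + u ^ 2) := by ring
    _ ≤ _ := div_le_div_of_nonneg_right
        (add_le_add (mul_le_of_le_one_right hKp hδ1) le_rfl) (by positivity)

end HY

/-! ### Hermite corrections of the normal density and their Laplace transforms. -/

namespace HY

lemma phi_eq {V : ℝ} (hV : 0 < V) (x : ℝ) :
    phi V x = (Real.sqrt (2 * Real.pi * V))⁻¹ * Real.exp (-x ^ 2 / (2 * V)) := by
  simp [phi, gaussianPDFReal, Real.coe_toNNReal V hV.le]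

lemma phi_pos {V : ℝ} (hV : 0 < V) (x : ℝ) : 0 < phi V x := by
  rw [phi_eq hV]; positivity

lemma hasDerivAt_phi {V : ℝ} (hV : 0 < V) (x : ℝ) : HasDerivAt (phi V) (-(x / V) * phi V x) x := by
  rw [funext (phi_eq hV)]
  have h : HasDerivAt (fun x : ℝ => -x ^ 2 / (2 * V)) (-(x / V)) x := by
    have := ((hasDerivAt_id x).pow 2).neg.div_const (2 * V)
    refine this.congr_deriv ?_
    simp; field_simp
  refine (h.exp.const_mul _).congr_deriv ?_
  ring

/-- Only the form polynomial times Gaussian is used: it gives smoothness and exponential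
integrability, and no explicit Hermite coefficients are needed. -/
lemma exists_polynomial_iteratedDeriv_phi {V : ℝ} (hV : 0 < V) (r : ℕ) :
    ∃ p : Polynomial ℝ, iteratedDeriv r (phi V) = fun x => p.eval x * phi V x := by
  induction r with
  | zero => exact ⟨1, by simp [iteratedDeriv_zero]⟩
  | succ r ih =>
    obtain ⟨p, hp⟩ := ih
    refine ⟨p.derivative - Polynomial.C V⁻¹ * Polynomial.X * p, ?_⟩
    rw [iteratedDeriv_succ, hp]
    ext x
    refine (((p.hasDerivAt x).mul (hasDerivAt_phi hV x)).congr_deriv ?_).deriv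
    simp
    ring

lemma hasDerivAt_iteratedDeriv_phi {V : ℝ} (hV : 0 < V) (r : ℕ) (x : ℝ) :
    HasDerivAt (iteratedDeriv r (phi V)) (iteratedDeriv (r + 1) (phi V) x) x := by
  obtain ⟨p, hp⟩ := exists_polynomial_iteratedDeriv_phi hV r
  rw [iteratedDeriv_succ]
  refine DifferentiableAt.hasDerivAt ?_
  rw [hp]
  exact ((p.hasDerivAt x).mul (hasDerivAt_phi hV x)).differentiableAt

lemma integrable_exp_mul_iteratedDeriv_phi {V : ℝ} (hV : 0 < V) (r : ℕ) (t : ℝ) :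
    Integrable fun x => Real.exp (t * x) * iteratedDeriv r (phi V) x := by
  obtain ⟨p, hp⟩ := exists_polynomial_iteratedDeriv_phi hV r
  have hV' : V.toNNReal ≠ 0 := by simpa using hV
  have hk : ∀ k : ℕ, Integrable fun x => x ^ k * Real.exp (t * x) * phi V x := by
    intro k
    have h := integrable_pow_mul_exp_of_mem_interior_integrableExpSet
      (X := id) (μ := gaussianReal 0 V.toNNReal) (v := t)
      (by rw [integrableExpSet_id_gaussianReal]; simp) k
    rw [gaussianReal_of_var_ne_zero _ hV', integrable_withDensity_iff (measurable_gaussianPDF _ _)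
      (ae_of_all _ fun x => gaussianPDF_lt_top)] at h
    simpa [toReal_gaussianPDF, phi] using h
  have : (fun x => Real.exp (t * x) * iteratedDeriv r (phi V) x) =
      fun x => ∑ k ∈ p.support, p.coeff k * (x ^ k * Real.exp (t * x) * phi V x) := by
    ext x
    simp only [hp]
    rw [Polynomial.eval_eq_sum, Polynomial.sum]
    simp only [Finset.mul_sum, Finset.sum_mul]
    congr 1 with k
    ring
  rw [this]
  exact integrable_finsetSum _ fun k _ => (hk k).const_mul _

lemma continuous_iteratedDeriv_phi {V : ℝ} (hV : 0 < V) (r : ℕ) :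
    Continuous (iteratedDeriv r (phi V)) :=
  continuous_iff_continuousAt.2 fun x => (hasDerivAt_iteratedDeriv_phi hV r x).continuousAt

lemma integrable_cexp_mul {q : ℝ → ℝ} (hq : AEStronglyMeasurable q) {z : ℂ}
    (h : Integrable fun x => Real.exp (z.re * x) * q x) :
    Integrable fun x : ℝ => Complex.exp (z * x) * q x := by
  refine h.norm.mono' ?_ (ae_of_all _ fun x => ?_)
  · exact (Continuous.aestronglyMeasurable (by fun_prop)).mul
      (Complex.continuous_ofReal.comp_aestronglyMeasurable hq)
  · rw [norm_mul, Complex.norm_exp, Complex.norm_real, norm_mul, Real.norm_of_nonneg (Real.exp_nonneg _)]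
    simp

/-- Integration by parts: each derivative of the density becomes a factor `-z`, starting from the
complex moment generating function of the normal law. -/
lemma integral_cexp_mul_iteratedDeriv_phi {V : ℝ} (hV : 0 < V) (r : ℕ) (z : ℂ) :
    ∫ x : ℝ, Complex.exp (z * x) * (iteratedDeriv r (phi V) x : ℝ) =
      (-z) ^ r * Complex.exp (V * z ^ 2 / 2) := by
  induction r with
  | zero =>
    have hV' : V.toNNReal ≠ 0 := by simpa using hV
    have h := complexMGF_id_gaussianReal (μ := 0) (v := V.toNNReal) z
    rw [complexMGF, integral_gaussianReal_eq_integral_smul hV'] at h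
    simp only [Real.coe_toNNReal V hV.le, Complex.ofReal_zero, mul_zero, zero_add] at h
    rw [pow_zero, one_mul, ← h]
    congr 1 with x
    simp [iteratedDeriv_zero, phi, mul_comm]
  | succ r ih =>
    have hi : ∀ r, Integrable fun x : ℝ => Complex.exp (z * x) * (iteratedDeriv r (phi V) x : ℝ) :=
      fun r => integrable_cexp_mul (continuous_iteratedDeriv_phi hV r).aestronglyMeasurable
        (integrable_exp_mul_iteratedDeriv_phi hV r z.re)
    have h0 := integral_eq_zero_of_hasDerivAt_of_integrable
      (f := fun x : ℝ => Complex.exp (z * x) * (iteratedDeriv r (phi V) x : ℝ))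
      (f' := fun x : ℝ => z * (Complex.exp (z * x) * (iteratedDeriv r (phi V) x : ℝ)) +
        Complex.exp (z * x) * (iteratedDeriv (r + 1) (phi V) x : ℝ)) ?_
      (((hi r).const_mul z).add (hi (r + 1))) (hi r)
    · rw [integral_add ((hi r).const_mul z) (hi (r + 1)), integral_const_mul, ih] at h0
      rw [eq_neg_of_add_eq_zero_right h0, pow_succ]
      ring
    · intro x
      have h1 : HasDerivAt (fun x : ℝ => Complex.exp (z * x)) (Complex.exp (z * x) * z) x := by
        have h2 : HasDerivAt (fun x : ℝ => z * (x : ℂ)) (z * 1) x :=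
          (Complex.ofRealCLM.hasDerivAt (x := x)).const_mul z
        rw [mul_one] at h2
        exact h2.cexp
      refine (h1.mul (hasDerivAt_iteratedDeriv_phi hV r x).ofReal_comp).congr_deriv ?_
      ring

lemma phi_mul_hermite {V : ℝ} (hV : 0 < V) (r : ℕ) (x : ℝ) :
    phi V x * hermite r V x = (-1) ^ r * iteratedDeriv r (phi V) x := by
  have := (phi_pos hV x).ne'
  rw [hermite]
  field_simp

/-- The two-sided Laplace transform of `psiTildeDensity`, with third cumulant `κ`. -/
noncomputable def edgeTildeMGF (c L κ : ℝ) (z : ℂ) : ℂ :=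
  Complex.exp (c * z ^ 2 / 2) * (1 + (L - c) * z ^ 2 / 2 + κ * z ^ 3 / 6)

/-- Multiplying a Hermite polynomial by the density gives back a derivative of the density; the sign
of the correction is `(-1)³`. In this form the Laplace transform can be read off. -/
lemma psiDensity_eq {L : ℝ} (hL : 0 < L) (b L₃ x : ℝ) : psiDensity b L L₃ x =
    iteratedDeriv 0 (phi L) x + (-(b ^ (1 / 2 : ℝ) * L₃ / 6)) * iteratedDeriv 3 (phi L) x := by
  have := phi_mul_hermite hL 3 x
  rw [psiDensity, mul_add, mul_left_comm, this, iteratedDeriv_zero]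
  ring

lemma psiTildeDensity_eq {c : ℝ} (hc : 0 < c) (b L L₃ x : ℝ) : psiTildeDensity b c L L₃ x =
    iteratedDeriv 0 (phi c) x + ((L - c) / 2) * iteratedDeriv 2 (phi c) x +
      (-(b ^ (1 / 2 : ℝ) * L₃ / 6)) * iteratedDeriv 3 (phi c) x := by
  have h3 := phi_mul_hermite hc 3 x
  have h2 := phi_mul_hermite hc 2 x
  rw [psiTildeDensity, iteratedDeriv_zero]
  linear_combination (1 / 2 * (L - c)) * h2 + (b ^ (1 / 2 : ℝ) / 6 * L₃) * h3

lemma continuous_psiDensity {L : ℝ} (hL : 0 < L) (b L₃ : ℝ) : Continuous (psiDensity b L L₃) := by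
  rw [funext (psiDensity_eq hL b L₃)]
  have := continuous_iteratedDeriv_phi hL
  exact ((this 0)).add ((this 3).const_mul _)

lemma continuous_psiTildeDensity {c : ℝ} (hc : 0 < c) (b L L₃ : ℝ) :
    Continuous (psiTildeDensity b c L L₃) := by
  rw [funext (psiTildeDensity_eq hc b L L₃)]
  have := continuous_iteratedDeriv_phi hc
  exact ((this 0).add ((this 2).const_mul _)).add ((this 3).const_mul _)

lemma integrable_exp_mul_psiDensity {L : ℝ} (hL : 0 < L) (b L₃ t : ℝ) :
    Integrable fun x => Real.exp (t * x) * psiDensity b L L₃ x := by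
  have h := fun r => integrable_exp_mul_iteratedDeriv_phi hL r t
  refine ((h 0).add ((h 3).const_mul (-(b ^ (1 / 2 : ℝ) * L₃ / 6)))).congr (ae_of_all _ fun x => ?_)
  simp only [Pi.add_apply, psiDensity_eq hL b L₃]
  ring

lemma integrable_exp_mul_psiTildeDensity {c : ℝ} (hc : 0 < c) (b L L₃ t : ℝ) :
    Integrable fun x => Real.exp (t * x) * psiTildeDensity b c L L₃ x := by
  have h := fun r => integrable_exp_mul_iteratedDeriv_phi hc r t
  refine (((h 0).add ((h 2).const_mul ((L - c) / 2))).add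
    ((h 3).const_mul (-(b ^ (1 / 2 : ℝ) * L₃ / 6)))).congr (ae_of_all _ fun x => ?_)
  simp only [Pi.add_apply, psiTildeDensity_eq hc b L L₃]
  ring

lemma integral_cexp_mul_psiDensity {L : ℝ} (hL : 0 < L) (b L₃ : ℝ) (z : ℂ) :
    ∫ x : ℝ, Complex.exp (z * x) * (psiDensity b L L₃ x : ℝ) =
      edgeMGF L (b ^ (1 / 2 : ℝ) * L₃) z := by
  have hi := fun r => integrable_cexp_mul (z := z)
    (continuous_iteratedDeriv_phi hL r).aestronglyMeasurable
    (integrable_exp_mul_iteratedDeriv_phi hL r z.re)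
  have e : (fun x : ℝ => Complex.exp (z * x) * (psiDensity b L L₃ x : ℝ)) = fun x : ℝ =>
      Complex.exp (z * x) * (iteratedDeriv 0 (phi L) x : ℝ) + ((-(b ^ (1 / 2 : ℝ) * L₃ / 6) : ℝ) : ℂ) *
        (Complex.exp (z * x) * (iteratedDeriv 3 (phi L) x : ℝ)) := by
    ext x
    rw [psiDensity_eq hL]
    push_cast
    ring
  rw [e, integral_add (hi 0) ((hi 3).const_mul _), integral_const_mul,
    integral_cexp_mul_iteratedDeriv_phi hL, integral_cexp_mul_iteratedDeriv_phi hL, edgeMGF]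
  push_cast
  ring

lemma integral_cexp_mul_psiTildeDensity {c : ℝ} (hc : 0 < c) (b L L₃ : ℝ) (z : ℂ) :
    ∫ x : ℝ, Complex.exp (z * x) * (psiTildeDensity b c L L₃ x : ℝ) =
      edgeTildeMGF c L (b ^ (1 / 2 : ℝ) * L₃) z := by
  have hi := fun r => integrable_cexp_mul (z := z)
    (continuous_iteratedDeriv_phi hc r).aestronglyMeasurable
    (integrable_exp_mul_iteratedDeriv_phi hc r z.re)
  have e : (fun x : ℝ => Complex.exp (z * x) * (psiTildeDensity b c L L₃ x : ℝ)) = fun x : ℝ =>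
      (Complex.exp (z * x) * (iteratedDeriv 0 (phi c) x : ℝ) + (((L - c) / 2 : ℝ) : ℂ) *
        (Complex.exp (z * x) * (iteratedDeriv 2 (phi c) x : ℝ))) +
        ((-(b ^ (1 / 2 : ℝ) * L₃ / 6) : ℝ) : ℂ) *
        (Complex.exp (z * x) * (iteratedDeriv 3 (phi c) x : ℝ)) := by
    ext x
    rw [psiTildeDensity_eq hc]
    push_cast
    ring
  have hi02 : Integrable fun x : ℝ => Complex.exp (z * x) * (iteratedDeriv 0 (phi c) x : ℝ) +
      (((L - c) / 2 : ℝ) : ℂ) * (Complex.exp (z * x) * (iteratedDeriv 2 (phi c) x : ℝ)) :=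
    (hi 0).add ((hi 2).const_mul _)
  rw [e, integral_add hi02 ((hi 3).const_mul _), integral_add (hi 0) ((hi 2).const_mul _), integral_const_mul, integral_const_mul,
    integral_cexp_mul_iteratedDeriv_phi hc, integral_cexp_mul_iteratedDeriv_phi hc,
    integral_cexp_mul_iteratedDeriv_phi hc, edgeTildeMGF]
  push_cast
  ring

lemma norm_edgeTildeMGF_le {c L κ D κ₁ s₀ : ℝ} (hc : 0 < c) (hD : |L - c| ≤ D) (hκ : |κ| ≤ κ₁)
    {s u : ℝ} (hs : |s| ≤ s₀) :
    ‖edgeTildeMGF c L κ (s + u * Complex.I)‖ ≤ Real.exp (c * s₀ ^ 2) * (1 + D + κ₁) *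
      ((1 + s ^ 2 + u ^ 2) ^ 2 * Real.exp (-(c / 4 * u ^ 2))) := by
  have hs2 : s ^ 2 ≤ s₀ ^ 2 := sq_le_sq.2 (hs.trans (le_abs_self _))
  have hκ0 : 0 ≤ κ₁ := (abs_nonneg _).trans hκ
  have hD0 : 0 ≤ D := (abs_nonneg _).trans hD
  rw [edgeTildeMGF, norm_mul, norm_cexp_mul_sq]
  have e1 : Real.exp (c * (s ^ 2 - u ^ 2) / 2) ≤ Real.exp (c * s₀ ^ 2) * Real.exp (-(c / 4 * u ^ 2)) := by
    rw [← Real.exp_add]; refine Real.exp_le_exp.2 ?_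
    have a1 : c * s ^ 2 ≤ c * s₀ ^ 2 := by gcongr
    have a3 : 0 ≤ c * s₀ ^ 2 := by positivity
    have a4 : 0 ≤ c * u ^ 2 := by positivity
    linarith
  have b1 := norm_pow_le_pow s u (show 3 ≤ 2 * 2 by norm_num)
  have b2 := norm_pow_le_pow s u (show 2 ≤ 2 * 2 by norm_num)
  have b3 : 1 ≤ (1 + s ^ 2 + u ^ 2) ^ 2 := one_le_pow₀ (by nlinarith [sq_nonneg s, sq_nonneg u])
  set y := (1 + s ^ 2 + u ^ 2) ^ 2 with hy
  have e2 : ‖1 + ((L : ℂ) - c) * (s + u * Complex.I) ^ 2 / 2 + (κ : ℂ) * (s + u * Complex.I) ^ 3 / 6‖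
      ≤ (1 + D + κ₁) * y := by
    refine (norm_add₃_le).trans ?_
    rw [norm_one, norm_div, norm_mul, norm_pow, norm_div, norm_mul, norm_pow, ← Complex.ofReal_sub,
      Complex.norm_real, Complex.norm_real, Real.norm_eq_abs, Real.norm_eq_abs]
    have c1 : |L - c| * ‖(s : ℂ) + u * Complex.I‖ ^ 2 ≤ D * y := by gcongr
    have c2 : |κ| * ‖(s : ℂ) + u * Complex.I‖ ^ 3 ≤ κ₁ * y := by gcongr
    have n2 : ‖(2 : ℂ)‖ = 2 := by norm_num
    have n6 : ‖(6 : ℂ)‖ = 6 := by norm_num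
    rw [n2, n6]
    have d1 : 0 ≤ |L - c| * ‖(s : ℂ) + u * Complex.I‖ ^ 2 := by positivity
    have d2 : 0 ≤ |κ| * ‖(s : ℂ) + u * Complex.I‖ ^ 3 := by positivity
    linarith
  calc _ ≤ (Real.exp (c * s₀ ^ 2) * Real.exp (-(c / 4 * u ^ 2))) * ((1 + D + κ₁) * y) := by
        gcongr
    _ = _ := by ring

/-- With `w = (L - c) z² / 2` the difference is `exp (c z² / 2)` times `(exp w - 1 - w) + (κ z³ /
6)(exp w - 1)`. The bound `|L - c| ≤ c/4` gives `‖w‖ ≤ c‖z‖² / 8`, so `exp ‖w‖` is absorbed by the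
Gaussian decay. -/
lemma norm_edgeMGF_sub_edgeTildeMGF_le {c L κ s₀ : ℝ} (hc : 0 < c) (hL : |L - c| ≤ c / 4)
    {s u : ℝ} (hs : |s| ≤ s₀) :
    ‖edgeMGF L κ (s + u * Complex.I) - edgeTildeMGF c L κ (s + u * Complex.I)‖ ≤
      ((L - c) ^ 2 + |κ| * |L - c|) * (Real.exp (c * s₀ ^ 2) *
        ((1 + s ^ 2 + u ^ 2) ^ 3 * Real.exp (-(c / 4 * u ^ 2)))) := by
  have hs2 : s ^ 2 ≤ s₀ ^ 2 := sq_le_sq.2 (hs.trans (le_abs_self _))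
  set z : ℂ := (s : ℂ) + u * Complex.I with hz
  set w : ℂ := ((L - c : ℝ) : ℂ) * z ^ 2 / 2 with hw
  have hz2 : ‖z‖ ^ 2 = s ^ 2 + u ^ 2 := norm_sq_add_mul_I s u
  have hwn : ‖w‖ = |L - c| * ‖z‖ ^ 2 / 2 := by
    rw [hw, norm_div, norm_mul, norm_pow, Complex.norm_real, Real.norm_eq_abs]
    norm_num
  have e : edgeMGF L κ z - edgeTildeMGF c L κ z = Complex.exp (c * z ^ 2 / 2) *
      ((Complex.exp w - (1 + w)) + κ * z ^ 3 / 6 * (Complex.exp w - 1)) := by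
    have : (L : ℂ) * z ^ 2 / 2 = c * z ^ 2 / 2 + w := by rw [hw]; push_cast; ring
    rw [edgeMGF, edgeTildeMGF, this, Complex.exp_add, hw]; push_cast; ring
  have h2 : ‖Complex.exp w - (1 + w)‖ ≤ ‖w‖ ^ 2 * Real.exp ‖w‖ := by
    have := Complex.norm_exp_sub_sum_le_norm_mul_exp w 2
    simpa [Finset.sum_range_succ] using this
  have h1 : ‖Complex.exp w - 1‖ ≤ ‖w‖ * Real.exp ‖w‖ := by
    have := Complex.norm_exp_sub_sum_le_norm_mul_exp w 1
    simpa [Finset.sum_range_succ] using this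
  have g1 : ‖z‖ ^ 4 ≤ (1 + s ^ 2 + u ^ 2) ^ 3 := norm_pow_le_pow s u (by norm_num)
  have g2 : ‖z‖ ^ 5 ≤ (1 + s ^ 2 + u ^ 2) ^ 3 := norm_pow_le_pow s u (by norm_num)
  set y := (1 + s ^ 2 + u ^ 2) ^ 3 with hy
  have h3 : ‖(Complex.exp w - (1 + w)) + κ * z ^ 3 / 6 * (Complex.exp w - 1)‖ ≤
      ((L - c) ^ 2 + |κ| * |L - c|) * y * Real.exp ‖w‖ := by
    have n6 : ‖(6 : ℂ)‖ = 6 := by norm_num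
    have k1 : ‖w‖ ^ 2 ≤ (L - c) ^ 2 * y := by
      rw [hwn, div_pow, mul_pow, sq_abs, ← pow_mul]
      have : (L - c) ^ 2 * ‖z‖ ^ (2 * 2) ≤ (L - c) ^ 2 * y := by gcongr
      exact (div_le_self (by positivity) (by norm_num)).trans this
    have k2 : |κ| * ‖z‖ ^ 3 / 6 * ‖w‖ ≤ |κ| * |L - c| * y := by
      rw [hwn]
      have : |κ| * |L - c| * ‖z‖ ^ 5 ≤ |κ| * |L - c| * y := by gcongr
      have : 0 ≤ |κ| * |L - c| * ‖z‖ ^ 5 := by positivity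
      calc _ = |κ| * |L - c| * ‖z‖ ^ 5 / 12 := by ring
        _ ≤ _ := by linarith
    calc _ ≤ ‖w‖ ^ 2 * Real.exp ‖w‖ + |κ| * ‖z‖ ^ 3 / 6 * (‖w‖ * Real.exp ‖w‖) := by
          refine (norm_add_le _ _).trans (add_le_add h2 ?_)
          rw [norm_mul, norm_div, norm_mul, norm_pow, Complex.norm_real, Real.norm_eq_abs, n6]
          gcongr
      _ = (‖w‖ ^ 2 + |κ| * ‖z‖ ^ 3 / 6 * ‖w‖) * Real.exp ‖w‖ := by ring
      _ ≤ ((L - c) ^ 2 * y + |κ| * |L - c| * y) * Real.exp ‖w‖ := by gcongr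
      _ = _ := by ring
  have h4 : Real.exp (c * (s ^ 2 - u ^ 2) / 2) * Real.exp ‖w‖ ≤
      Real.exp (c * s₀ ^ 2) * Real.exp (-(c / 4 * u ^ 2)) := by
    rw [← Real.exp_add, ← Real.exp_add, hwn, hz2]
    refine Real.exp_le_exp.2 ?_
    have a0 : |L - c| * (s ^ 2 + u ^ 2) ≤ c / 4 * (s ^ 2 + u ^ 2) := by gcongr
    have a1 : c * s ^ 2 ≤ c * s₀ ^ 2 := by gcongr
    have a3 : 0 ≤ c * s ^ 2 := by positivity
    have a4 : 0 ≤ c * u ^ 2 := by positivity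
    linarith
  rw [e, norm_mul, norm_cexp_mul_sq]
  calc _ ≤ Real.exp (c * (s ^ 2 - u ^ 2) / 2) *
        (((L - c) ^ 2 + |κ| * |L - c|) * y * Real.exp ‖w‖) := by gcongr
    _ = ((L - c) ^ 2 + |κ| * |L - c|) * y * (Real.exp (c * (s ^ 2 - u ^ 2) / 2) * Real.exp ‖w‖) := by
        ring
    _ ≤ ((L - c) ^ 2 + |κ| * |L - c|) * y * (Real.exp (c * s₀ ^ 2) * Real.exp (-(c / 4 * u ^ 2))) := by
        gcongr
    _ = _ := by ring

end HY

/-! ### Exponential bounds for densities and the law of a weighted chi-square sum. -/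

namespace HY

lemma integrable_exp_neg_mul_abs {s : ℝ} (hs : 0 < s) :
    Integrable fun x : ℝ => Real.exp (-(s * |x|)) := by
  refine (integrable_inv_one_add_sq.const_mul (1 + 2 / s ^ 2)).mono'
    (Continuous.aestronglyMeasurable (by fun_prop)) (ae_of_all _ fun x => ?_)
  rw [Real.norm_of_nonneg (Real.exp_nonneg _), Real.exp_neg, ← div_eq_mul_inv,
    inv_le_comm₀ (Real.exp_pos _) (by positivity), inv_div, div_le_iff₀ (by positivity)]
  have h1 := Real.pow_div_factorial_le_exp (s * |x|) (by positivity) 2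
  have h2 : 1 ≤ Real.exp (s * |x|) := Real.one_le_exp (by positivity)
  rw [mul_pow, sq_abs] at h1
  have h3 : x ^ 2 ≤ Real.exp (s * |x|) * (2 / s ^ 2) := by
    rw [← mul_div_assoc, le_div_iff₀ (by positivity)]
    norm_num at h1
    linarith
  linarith

lemma exp_abs_le_add {s x : ℝ} (hs : 0 ≤ s) :
    Real.exp (s / 2 * |x|) ≤ Real.exp (s * x) + Real.exp (-s * x) := by
  rcases abs_cases x with ⟨h, h'⟩ | ⟨h, h'⟩
  · rw [h]
    have : Real.exp (s / 2 * x) ≤ Real.exp (s * x) := Real.exp_le_exp.2 (by nlinarith)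
    linarith [Real.exp_pos (-s * x)]
  · rw [h]
    have : Real.exp (s / 2 * -x) ≤ Real.exp (-s * x) := Real.exp_le_exp.2 (by nlinarith)
    linarith [Real.exp_pos (s * x)]

/-- The line of real part `s` handles `x ≥ 0` and the line of real part `-s` handles `x < 0`. -/
lemma abs_le_exp_abs_of_laplace_bound {q : ℝ → ℝ} (hq : Continuous q) {s K : ℝ} (hs : 0 ≤ s)
    (hint : ∀ t : ℝ, |t| ≤ s → Integrable fun x => Real.exp (t * x) * q x)
    (hb : ∀ t u : ℝ, |t| ≤ s → ‖∫ x : ℝ, Complex.exp ((t + u * Complex.I) * x) * q x‖ ≤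
      K / (1 + u ^ 2)) (x : ℝ) :
    |q x| ≤ K / 2 * Real.exp (-(s * |x|)) := by
  have h1 : |s| ≤ s := (abs_of_nonneg hs).le
  have h2 : |-s| ≤ s := by rwa [abs_neg]
  rcases abs_cases x with ⟨h, h'⟩ | ⟨h, h'⟩
  · rw [h]
    exact abs_le_exp_of_laplace_bound hq (hint s h1) (fun u => hb s u h1) x
  · rw [h, ← neg_mul_comm]
    exact abs_le_exp_of_laplace_bound hq (hint (-s) h2) (fun u => hb (-s) u h2) x

/-- The test function may grow at rate `s / 2` because the density decays at rate `s`; the integral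
at the end is a constant that depends on `s` only. -/
lemma integrable_mul_of_exp_bound {f q : ℝ → ℝ} (hf : Measurable f) (hq : Continuous q) {s A K : ℝ}
    (hs : 0 < s) (hA : 0 ≤ A) (hfb : ∀ x, |f x| ≤ A * Real.exp (s / 2 * |x|))
    (hqb : ∀ x, |q x| ≤ K * Real.exp (-(s * |x|))) :
    Integrable (fun x => f x * q x) ∧
      |∫ x, f x * q x| ≤ A * K * ∫ x : ℝ, Real.exp (-(s / 2 * |x|)) := by
  have hb : ∀ x, ‖f x * q x‖ ≤ A * K * Real.exp (-(s / 2 * |x|)) := fun x => by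
    rw [norm_mul, Real.norm_eq_abs, Real.norm_eq_abs]
    calc _ ≤ (A * Real.exp (s / 2 * |x|)) * (K * Real.exp (-(s * |x|))) :=
          mul_le_mul (hfb x) (hqb x) (abs_nonneg _) (by positivity)
      _ = A * K * (Real.exp (s / 2 * |x|) * Real.exp (-(s * |x|))) := by ring
      _ = _ := by rw [← Real.exp_add]; ring_nf
  have hI := (integrable_exp_neg_mul_abs (half_pos hs)).const_mul (A * K)
  refine ⟨hI.mono' (hf.mul hq.measurable).aestronglyMeasurable (ae_of_all _ hb), ?_⟩
  rw [← integral_const_mul, ← Real.norm_eq_abs]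
  exact norm_integral_le_of_norm_le hI (ae_of_all _ hb)

/-- The integrand against the normal density is a complex Gaussian with parameter `1/2 - w`, whose
real part is positive exactly under the hypothesis. -/
lemma integral_chiFactor {w : ℂ} (hw : w.re < 1 / 2) :
    Integrable (fun x : ℝ => Complex.exp (w * (x ^ 2 - 1))) (gaussianReal 0 1) ∧
    ∫ x : ℝ, Complex.exp (w * (x ^ 2 - 1)) ∂(gaussianReal 0 1) = chiFactor w := by
  have hb : 0 < (1 / 2 - w).re := by simpa using hw
  have e : ∀ x : ℝ, gaussianPDFReal 0 1 x • Complex.exp (w * (x ^ 2 - 1)) =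
      ((Real.sqrt (2 * Real.pi))⁻¹ : ℝ) * Complex.exp (-w) * Complex.exp (-(1 / 2 - w) * x ^ 2) := by
    intro x
    rw [gaussianPDFReal, Complex.real_smul, Complex.ofReal_mul]
    push_cast
    rw [mul_one, mul_assoc _ (Complex.exp _) (Complex.exp _),
      mul_assoc _ (Complex.exp _) (Complex.exp _), ← Complex.exp_add, ← Complex.exp_add]
    congr 2
    ring
  constructor
  · rw [gaussianReal_of_var_ne_zero _ one_ne_zero,
      integrable_withDensity_iff_integrable_smul' (measurable_gaussianPDF _ _)
        (ae_of_all _ fun x => gaussianPDF_lt_top)]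
    simp_rw [toReal_gaussianPDF, e]
    exact (integrable_cexp_neg_mul_sq hb).const_mul _
  · rw [integral_gaussianReal_eq_integral_smul one_ne_zero]
    simp_rw [e]
    have hre : 0 < (1 - 2 * w).re := by
      have : (1 - 2 * w).re = 1 - 2 * w.re := by simp
      rw [this]; linarith
    have hne : (1 - 2 * w) ≠ 0 := fun h => by rw [h] at hre; simp at hre
    have hpi : (0 : ℝ) < 2 * Real.pi := by positivity
    have h1 : (Real.pi : ℂ) / (1 / 2 - w) = ((2 * Real.pi : ℝ) : ℂ) * (1 - 2 * w)⁻¹ := by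
      have : (1 / 2 - w) = (1 - 2 * w) / 2 := by ring
      rw [this]; push_cast; field_simp
    rw [integral_const_mul, integral_gaussian_complex hb, h1,
      Complex.cpow_def_of_ne_zero (mul_ne_zero (by exact_mod_cast hpi.ne') (inv_ne_zero hne)),
      Complex.log_ofReal_mul hpi (inv_ne_zero hne), Complex.log_inv]
    · have h2 : ((Real.sqrt (2 * Real.pi))⁻¹ : ℝ) = Real.exp (-(Real.log (2 * Real.pi) / 2)) := by
        rw [Real.exp_neg, ← Real.log_sqrt hpi.le, Real.exp_log (Real.sqrt_pos.2 hpi)]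
      rw [h2, Complex.ofReal_exp, ← Complex.exp_add, ← Complex.exp_add, chiFactor]
      congr 1
      push_cast
      ring
    -- The principal logarithm of the inverse is the negative of the logarithm unless the argument
    -- is `π`, which is excluded since `1 - 2w` has positive real part.
    · intro h
      rw [Complex.arg_eq_pi_iff] at h
      linarith [h.1]

/-- The law of `∑ₖ lₖ (ξₖ² - 1)` for independent standard normal variables `ξₖ`. -/
noncomputable def chiLaw {ι : Type*} [Fintype ι] (l : ι → ℝ) : Measure ℝ :=
  (Measure.pi fun _ : ι => gaussianReal 0 1).map fun ξ => ∑ k, l k * (ξ k ^ 2 - 1)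

instance {ι : Type*} [Fintype ι] (l : ι → ℝ) : IsProbabilityMeasure (chiLaw l) :=
  Measure.isProbabilityMeasure_map (Measurable.aemeasurable (by fun_prop))

lemma integral_cexp_chiLaw {ι : Type*} [Fintype ι] (l : ι → ℝ) {z : ℂ}
    (hz : ∀ k, l k * z.re < 1 / 2) :
    Integrable (fun x : ℝ => Complex.exp (z * x)) (chiLaw l) ∧
      ∫ x : ℝ, Complex.exp (z * x) ∂(chiLaw l) = chiMGF l z := by
  have hm : Measurable fun ξ : ι → ℝ => ∑ k, l k * (ξ k ^ 2 - 1) := by fun_prop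
  have e : ∀ ξ : ι → ℝ, Complex.exp (z * ((∑ k, l k * (ξ k ^ 2 - 1) : ℝ) : ℂ)) =
      ∏ k, Complex.exp ((l k * z) * ((ξ k : ℂ) ^ 2 - 1)) := fun ξ => by
    rw [← Complex.exp_sum]
    push_cast
    rw [Finset.mul_sum]
    congr 1
    refine Finset.sum_congr rfl fun k _ => ?_
    ring
  have hk : ∀ k, ((l k : ℂ) * z).re < 1 / 2 := fun k => by
    rw [Complex.re_ofReal_mul]; exact hz k
  constructor
  · rw [chiLaw, integrable_map_measure (Continuous.aestronglyMeasurable (by fun_prop)) hm.aemeasurable]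
    simp only [Function.comp_def, e]
    exact Integrable.fintype_prod
      (f := fun k (x : ℝ) => Complex.exp ((l k * z) * ((x : ℂ) ^ 2 - 1)))
      fun k => (integral_chiFactor (hk k)).1
  · rw [chiLaw, integral_map hm.aemeasurable (Continuous.aestronglyMeasurable (by fun_prop))]
    simp only [e]
    rw [integral_fintype_prod_eq_prod (fun k (x : ℝ) => Complex.exp ((l k * z) * ((x : ℂ) ^ 2 - 1))),
      chiMGF]
    exact Finset.prod_congr rfl fun k _ => (integral_chiFactor (hk k)).2

lemma mul_lt_half_of_abs_le {x t δ : ℝ} (hx : |x| ≤ δ) (ht : δ * |t| ≤ 1 / 4) : x * t < 1 / 2 := by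
  have h1 : x * t ≤ |x| * |t| := by rw [← abs_mul]; exact le_abs_self _
  have h2 : |x| * |t| ≤ δ * |t| := by gcongr
  linarith

lemma integrable_exp_chiLaw {ι : Type*} [Fintype ι] (l : ι → ℝ) {δ t : ℝ}
    (hl : ∀ k, |l k| ≤ δ) (ht : δ * |t| ≤ 1 / 4) :
    Integrable (fun x : ℝ => Real.exp (t * x)) (chiLaw l) := by
  have h := (integral_cexp_chiLaw l (z := (t : ℂ)) fun k => by
    rw [Complex.ofReal_re]; exact mul_lt_half_of_abs_le (hl k) ht).1.norm
  refine h.congr (ae_of_all _ fun x => ?_)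
  simp only
  rw [← Complex.ofReal_mul, Complex.norm_exp_ofReal]

lemma integral_exp_chiLaw_le {ι : Type*} [Fintype ι] (l : ι → ℝ) {δ t : ℝ} (hδ : 0 < δ)
    (hl : ∀ k, |l k| ≤ δ) (ht : δ * |t| ≤ 1 / 4) :
    ∫ x : ℝ, Real.exp (t * x) ∂(chiLaw l) ≤ Real.exp (t ^ 2 * (2 * ∑ k, l k ^ 2)) := by
  have h := (integral_cexp_chiLaw l (z := (t : ℂ)) fun k => by
    rw [Complex.ofReal_re]; exact mul_lt_half_of_abs_le (hl k) ht).2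
  have h2 := norm_chiMGF_le l hδ hl ht 0
  simp only [Complex.ofReal_zero, zero_mul, add_zero, mul_zero, ne_eq, OfNat.ofNat_ne_zero,
    not_false_eq_true, zero_pow, Real.one_rpow, mul_one] at h2
  rw [← h] at h2
  have e : ∫ x : ℝ, Complex.exp (t * x) ∂(chiLaw l) = ((∫ x : ℝ, Real.exp (t * x) ∂(chiLaw l) : ℝ) : ℂ) := by
    rw [← integral_complex_ofReal]
    congr 1 with x
    push_cast; rfl
  rw [e, Complex.norm_real, Real.norm_of_nonneg (integral_nonneg fun x => (Real.exp_pos _).le)] at h2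
  exact h2

/-- Exponential moments at `± s` give a bound without any smallness of `δ` and without a lower bound
for the variance. It settles integrability, and the expansion itself when `δ` is not small. -/
lemma chiLaw_crude_bound {ι : Type*} [Fintype ι] (l : ι → ℝ) {δ s c₁ A : ℝ} (hδ : 0 < δ) (hs : 0 ≤ s)
    (hl : ∀ k, |l k| ≤ δ) (hsδ : δ * s ≤ 1 / 4) (h1 : 2 * ∑ k, l k ^ 2 ≤ c₁) {f : ℝ → ℝ}
    (hf : Measurable f) (hA : 0 ≤ A) (hfb : ∀ x, |f x| ≤ A * Real.exp (s / 2 * |x|)) :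
    Integrable f (chiLaw l) ∧ |∫ x, f x ∂(chiLaw l)| ≤ A * (2 * Real.exp (s ^ 2 * c₁)) := by
  have t1 : δ * |s| ≤ 1 / 4 := by rwa [abs_of_nonneg hs]
  have t2 : δ * |-s| ≤ 1 / 4 := by rwa [abs_neg, abs_of_nonneg hs]
  have i1 := integrable_exp_chiLaw l hl t1
  have i2 := integrable_exp_chiLaw l hl t2
  have hI := (i1.add i2).const_mul A
  have hb : ∀ x, ‖f x‖ ≤ A * (Real.exp (s * x) + Real.exp (-s * x)) := fun x =>
    (hfb x).trans (mul_le_mul_of_nonneg_left (exp_abs_le_add hs) hA)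
  refine ⟨hI.mono' hf.aestronglyMeasurable (ae_of_all _ hb), ?_⟩
  rw [← Real.norm_eq_abs]
  refine (norm_integral_le_of_norm_le hI (ae_of_all _ hb)).trans ?_
  rw [integral_const_mul]
  refine mul_le_mul_of_nonneg_left ?_ hA
  have e := integral_add i1 i2
  simp only [Pi.add_apply]
  rw [e, two_mul]
  have h : ∀ t, t ^ 2 = s ^ 2 → t ^ 2 * (2 * ∑ k, l k ^ 2) ≤ s ^ 2 * c₁ := fun t ht => by
    rw [ht]; gcongr
  exact add_le_add
    ((integral_exp_chiLaw_le l hδ hl t1).trans (Real.exp_le_exp.2 (h s rfl)))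
    ((integral_exp_chiLaw_le l hδ hl t2).trans (Real.exp_le_exp.2 (h (-s) (neg_sq s))))

lemma exists_abs_psiDensity_le {c₀ : ℝ} (c₁ κ₁ : ℝ) {s : ℝ} (hc₀ : 0 < c₀) (hs : 0 ≤ s) :
    ∃ K : ℝ, ∀ L b L₃ : ℝ, c₀ ≤ L → L ≤ c₁ → |b ^ (1 / 2 : ℝ) * L₃| ≤ κ₁ →
      ∀ x, |psiDensity b L L₃ x| ≤ K * Real.exp (-(s * |x|)) := by
  obtain ⟨K, hK, hK'⟩ := exists_pow_mul_exp_le 2 (c := c₀ / 4) (s₀ := s) (by positivity)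
  refine ⟨Real.exp (c₁ * s ^ 2) * (1 + κ₁) * K / 2, ?_⟩
  intro L b L₃ h0 h1 hκ x
  have hL : 0 < L := hc₀.trans_le h0
  have hκ0 : 0 ≤ κ₁ := (abs_nonneg _).trans hκ
  refine abs_le_exp_abs_of_laplace_bound (continuous_psiDensity hL b L₃) hs
    (fun t _ => integrable_exp_mul_psiDensity hL b L₃ t) (fun t u ht => ?_) x
  rw [integral_cexp_mul_psiDensity hL, mul_div_assoc]
  exact (norm_edgeMGF_le hc₀ h0 h1 hκ ht).trans
    (mul_le_mul_of_nonneg_left (hK' t u ht) (by positivity))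

lemma exists_abs_psiTildeDensity_le {c : ℝ} (D κ₁ : ℝ) {s : ℝ} (hc : 0 < c) (hs : 0 ≤ s) :
    ∃ K : ℝ, ∀ L b L₃ : ℝ, |L - c| ≤ D → |b ^ (1 / 2 : ℝ) * L₃| ≤ κ₁ →
      ∀ x, |psiTildeDensity b c L L₃ x| ≤ K * Real.exp (-(s * |x|)) := by
  obtain ⟨K, hK, hK'⟩ := exists_pow_mul_exp_le 2 (c := c / 4) (s₀ := s) (by positivity)
  refine ⟨Real.exp (c * s ^ 2) * (1 + D + κ₁) * K / 2, ?_⟩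
  intro L b L₃ hD hκ x
  have hκ0 : 0 ≤ κ₁ := (abs_nonneg _).trans hκ
  have hD0 : 0 ≤ D := (abs_nonneg _).trans hD
  refine abs_le_exp_abs_of_laplace_bound (continuous_psiTildeDensity hc b L L₃) hs
    (fun t _ => integrable_exp_mul_psiTildeDensity hc b L L₃ t) (fun t u ht => ?_) x
  rw [integral_cexp_mul_psiTildeDensity hc, mul_div_assoc]
  exact (norm_edgeTildeMGF_le hc hD hκ ht).trans
    (mul_le_mul_of_nonneg_left (hK' t u ht) (by positivity))

/-- Inversion of the transform estimate `norm_edgeMGF_sub_edgeTildeMGF_le`. The gain is quadratic as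
soon as `L - c` and the third cumulant are both of order `δ`. -/
lemma exists_abs_psiDensity_sub_psiTildeDensity_le {c s : ℝ} (hc : 0 < c) (hs : 0 ≤ s) :
    ∃ K : ℝ, 0 ≤ K ∧ ∀ L b L₃ : ℝ, |L - c| ≤ c / 4 → ∀ x,
      |psiDensity b L L₃ x - psiTildeDensity b c L L₃ x| ≤
        ((L - c) ^ 2 + |b ^ (1 / 2 : ℝ) * L₃| * |L - c|) * K * Real.exp (-(s * |x|)) := by
  obtain ⟨K, hK, hK'⟩ := exists_pow_mul_exp_le 3 (c := c / 4) (s₀ := s) (by positivity)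
  refine ⟨Real.exp (c * s ^ 2) * K / 2, by positivity, ?_⟩
  intro L b L₃ hD x
  have hL : 0 < L := by have := (abs_le.1 hD).1; linarith
  have i1 := integrable_exp_mul_psiDensity hL b L₃
  have i2 := integrable_exp_mul_psiTildeDensity hc b L L₃
  have c1 := continuous_psiDensity hL b L₃
  have c2 := continuous_psiTildeDensity hc b L L₃
  have h := abs_le_exp_abs_of_laplace_bound (s := s)
    (K := ((L - c) ^ 2 + |b ^ (1 / 2 : ℝ) * L₃| * |L - c|) * (Real.exp (c * s ^ 2) * K))
    (c1.sub c2) hs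
    (fun t _ => ((i1 t).sub (i2 t)).congr (ae_of_all _ fun y => by
      simp only [Pi.sub_apply]; ring)) (fun t u ht => ?_) x
  · refine h.trans (le_of_eq ?_)
    ring
  · have j1 := integrable_cexp_mul (z := t + u * Complex.I) c1.aestronglyMeasurable (by simpa using i1 t)
    have j2 := integrable_cexp_mul (z := t + u * Complex.I) c2.aestronglyMeasurable (by simpa using i2 t)
    have e : (fun y : ℝ => Complex.exp ((t + u * Complex.I) * y) *
        (psiDensity b L L₃ y - psiTildeDensity b c L L₃ y : ℝ)) = fun y : ℝ =>
        Complex.exp ((t + u * Complex.I) * y) * (psiDensity b L L₃ y : ℝ) -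
        Complex.exp ((t + u * Complex.I) * y) * (psiTildeDensity b c L L₃ y : ℝ) := by
      ext y; push_cast; ring
    simp only [Pi.sub_apply]
    rw [e, integral_sub j1 j2, integral_cexp_mul_psiDensity hL, integral_cexp_mul_psiTildeDensity hc]
    refine (norm_edgeMGF_sub_edgeTildeMGF_le hc hD ht).trans ?_
    rw [mul_div_assoc, mul_div_assoc]
    have := hK' t u ht
    gcongr

end HY

/-! ### Expansion of the law of a quadratic form: from densities to test functions. -/

namespace HY

/-- The law of a quadratic form in independent normal variables has a continuous density, which is
close to the density of its second-order expansion. -/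
theorem exists_chiLaw_density {c₀ : ℝ} (c₁ : ℝ) {s : ℝ} (hc₀ : 0 < c₀) (hs : 0 ≤ s) :
    ∃ δ₀ K : ℝ, 0 < δ₀ ∧ 0 ≤ K ∧ ∀ (ι : Type) [Fintype ι] (l : ι → ℝ) (δ : ℝ), 0 < δ → δ ≤ δ₀ →
      δ * s ≤ 1 / 4 → (∀ k, |l k| ≤ δ) → c₀ ≤ 2 * ∑ k, l k ^ 2 → 2 * ∑ k, l k ^ 2 ≤ c₁ →
      ∀ b L₃ : ℝ, b ^ (1 / 2 : ℝ) * L₃ = 8 * ∑ k, l k ^ 3 →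
      ∃ p : ℝ → ℝ, Continuous p ∧ (∀ x, 0 ≤ p x) ∧
        chiLaw l = volume.withDensity (fun x => ENNReal.ofReal (p x)) ∧
        ∀ x, |p x - psiDensity b (2 * ∑ k, l k ^ 2) L₃ x| ≤ K * δ ^ 2 * Real.exp (-(s * |x|)) := by
  obtain ⟨δ₀, K, hδ₀, hK, h⟩ := exists_norm_chiMGF_sub_le c₁ s hc₀
  refine ⟨δ₀, K / 2, hδ₀, by positivity, ?_⟩
  intro ι _ l δ hδ hδ0 hδs hl h0 h1 b L₃ hκ
  have hL : 0 < 2 * ∑ k, l k ^ 2 := hc₀.trans_le h0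
  have hre : ∀ t u : ℝ, ((t : ℂ) + u * Complex.I).re = t := fun t u => by simp
  have hδt : ∀ t : ℝ, |t| ≤ s → δ * |t| ≤ 1 / 4 := fun t ht =>
    (mul_le_mul_of_nonneg_left ht hδ.le).trans hδs
  have hmgf : ∀ t u : ℝ, |t| ≤ s → ∫ x : ℝ, Complex.exp ((t + u * Complex.I) * x) ∂(chiLaw l) =
      chiMGF l (t + u * Complex.I) := fun t u ht =>
    (integral_cexp_chiLaw l fun k => by
      rw [hre]; exact mul_lt_half_of_abs_le (hl k) (hδt t ht)).2
  -- The characteristic function is `chiMGF` on the imaginary axis, and the second bound of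
  -- `exists_norm_chiMGF_sub_le` makes it integrable; this yields a continuous density.
  have hchar : Integrable (charFun (chiLaw l)) := by
    refine (integrable_inv_one_add_sq.const_mul K).mono' (measurable_charFun).aestronglyMeasurable
      (ae_of_all _ fun u => ?_)
    have h00 : |(0 : ℝ)| ≤ s := by simpa using hs
    have e : charFun (chiLaw l) u = chiMGF l ((0 : ℝ) + u * Complex.I) := by
      rw [← hmgf 0 u h00, charFun_apply_real]
      congr 1 with x
      congr 1
      push_cast
      ring
    rw [e, ← div_eq_mul_inv]
    exact (h ι l δ hδ hδ0 hl h0 h1 0 u h00).2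
  obtain ⟨p, hpc, hp0, hpi, hp⟩ := exists_density_of_integrable_charFun (chiLaw l) hchar
  refine ⟨p, hpc, hp0, hp, ?_⟩
  have hpm : Measurable fun x => ENNReal.ofReal (p x) := hpc.measurable.ennreal_ofReal
  have hpt : ∀ᵐ x : ℝ, ENNReal.ofReal (p x) < ⊤ := ae_of_all _ fun x => ENNReal.ofReal_lt_top
  have hip : ∀ t : ℝ, |t| ≤ s → Integrable fun x => Real.exp (t * x) * p x := fun t ht => by
    have := integrable_exp_chiLaw l hl (hδt t ht)
    rw [hp, integrable_withDensity_iff hpm hpt] at this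
    simpa [ENNReal.toReal_ofReal (hp0 _)] using this
  have cψ := continuous_psiDensity hL b L₃
  have iψ := integrable_exp_mul_psiDensity hL b L₃
  intro x
  -- The inversion is applied to the difference of densities, so the factor `δ²` of the transform
  -- bound is carried over to the pointwise bound.
  have hmain := abs_le_exp_abs_of_laplace_bound (s := s) (K := K * δ ^ 2) (hpc.sub cψ) hs
    (fun t ht => ((hip t ht).sub (iψ t)).congr (ae_of_all _ fun y => by
      simp only [Pi.sub_apply]; ring)) (fun t u ht => ?_) x
  · refine hmain.trans (le_of_eq ?_)
    ring
  · have j1 := integrable_cexp_mul (z := t + u * Complex.I) hpc.aestronglyMeasurable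
      (by simpa using hip t ht)
    have j2 := integrable_cexp_mul (z := t + u * Complex.I) cψ.aestronglyMeasurable
      (by simpa using iψ t)
    have e : (fun y : ℝ => Complex.exp ((t + u * Complex.I) * y) *
        (p y - psiDensity b (2 * ∑ k, l k ^ 2) L₃ y : ℝ)) = fun y : ℝ =>
        Complex.exp ((t + u * Complex.I) * y) * (p y : ℝ) -
        Complex.exp ((t + u * Complex.I) * y) * (psiDensity b (2 * ∑ k, l k ^ 2) L₃ y : ℝ) := by
      ext y; push_cast; ring
    have e2 : ∫ y : ℝ, Complex.exp ((t + u * Complex.I) * y) * (p y : ℝ) =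
        chiMGF l (t + u * Complex.I) := by
      rw [← hmgf t u ht, hp, integral_withDensity_eq_integral_toReal_smul hpm hpt]
      congr 1 with y
      rw [ENNReal.toReal_ofReal (hp0 y), Complex.real_smul, mul_comm]
    simp only [Pi.sub_apply]
    rw [e, integral_sub j1 j2, integral_cexp_mul_psiDensity hL, hκ, e2]
    exact (h ι l δ hδ hδ0 hl h0 h1 t u ht).1

/-- The pointwise density bound is integrated against `f`, whose exponential growth is half the
decay rate. The result is uniform in `f`, which enters through the constant `A` only. -/
theorem exists_chiLaw_expansion_of_le {c₀ : ℝ} (c₁ : ℝ) {s : ℝ} (hc₀ : 0 < c₀) (hs : 0 < s) :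
    ∃ δ₀ K : ℝ, 0 < δ₀ ∧ 0 ≤ K ∧ ∀ (ι : Type) [Fintype ι] (l : ι → ℝ) (δ : ℝ), 0 < δ → δ ≤ δ₀ →
      δ * s ≤ 1 / 4 → (∀ k, |l k| ≤ δ) → c₀ ≤ 2 * ∑ k, l k ^ 2 → 2 * ∑ k, l k ^ 2 ≤ c₁ →
      ∀ b L₃ : ℝ, b ^ (1 / 2 : ℝ) * L₃ = 8 * ∑ k, l k ^ 3 →
      ∀ (A : ℝ) (f : ℝ → ℝ), 0 ≤ A → Measurable f → (∀ x, |f x| ≤ A * Real.exp (s / 2 * |x|)) →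
        |∫ x, f x ∂(chiLaw l) - ∫ x, f x * psiDensity b (2 * ∑ k, l k ^ 2) L₃ x| ≤
          A * K * δ ^ 2 := by
  obtain ⟨δ₀, K, hδ₀, hK, h⟩ := exists_chiLaw_density c₁ hc₀ hs.le
  obtain ⟨K', hψ⟩ := exists_abs_psiDensity_le c₁ (4 * δ₀ * c₁) hc₀ hs.le
  have hJ : 0 ≤ ∫ x : ℝ, Real.exp (-(s / 2 * |x|)) := integral_nonneg fun x => (Real.exp_pos _).le
  refine ⟨δ₀, K * ∫ x : ℝ, Real.exp (-(s / 2 * |x|)), hδ₀, by positivity, ?_⟩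
  intro ι _ l δ hδ hδ0 hδs hl h0 h1 b L₃ hκ A f hA hf hfb
  have hL : 0 < 2 * ∑ k, l k ^ 2 := hc₀.trans_le h0
  obtain ⟨p, hpc, hp0, hp, hpψ⟩ := h ι l δ hδ hδ0 hδs hl h0 h1 b L₃ hκ
  have cψ := continuous_psiDensity hL b L₃
  have hκ' : |b ^ (1 / 2 : ℝ) * L₃| ≤ 4 * δ₀ * c₁ := by
    rw [hκ]
    refine (abs_sum_cube_le l hl).trans ?_
    gcongr
  obtain ⟨i1, b1⟩ := integrable_mul_of_exp_bound hf (hpc.sub cψ) hs hA hfb hpψ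
  obtain ⟨i2, -⟩ := integrable_mul_of_exp_bound hf cψ hs hA hfb (hψ _ b L₃ h0 h1 hκ')
  have e : ∫ x, f x ∂(chiLaw l) = ∫ x, f x * p x := by
    rw [hp, integral_withDensity_eq_integral_toReal_smul hpc.measurable.ennreal_ofReal
      (ae_of_all _ fun x => ENNReal.ofReal_lt_top)]
    congr 1 with y
    rw [ENNReal.toReal_ofReal (hp0 y), smul_eq_mul, mul_comm]
  have e2 : ∫ x, f x * p x = (∫ x, f x * (p - psiDensity b (2 * ∑ k, l k ^ 2) L₃) x) +
      ∫ x, f x * psiDensity b (2 * ∑ k, l k ^ 2) L₃ x := by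
    rw [← integral_add i1 i2]
    congr 1 with y
    simp only [Pi.sub_apply]; ring
  rw [e, e2, add_sub_cancel_right]
  refine b1.trans (le_of_eq ?_)
  ring

/-- Second-order expansion of the law of a quadratic form in independent normal variables. -/
theorem exists_chiLaw_expansion {c₀ δm s : ℝ} (c₁ : ℝ) (hc₀ : 0 < c₀) (hs : 0 < s)
    (hδm : δm * s ≤ 1 / 4) :
    ∃ K : ℝ, 0 ≤ K ∧ ∀ (ι : Type) [Fintype ι] (l : ι → ℝ) (δ : ℝ), 0 < δ → δ ≤ δm →
      (∀ k, |l k| ≤ δ) → c₀ ≤ 2 * ∑ k, l k ^ 2 → 2 * ∑ k, l k ^ 2 ≤ c₁ →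
      ∀ b L₃ : ℝ, b ^ (1 / 2 : ℝ) * L₃ = 8 * ∑ k, l k ^ 3 →
      ∀ (A : ℝ) (f : ℝ → ℝ), 0 ≤ A → Measurable f → (∀ x, |f x| ≤ A * Real.exp (s / 2 * |x|)) →
        Integrable f (chiLaw l) ∧
        |∫ x, f x ∂(chiLaw l) - ∫ x, f x * psiDensity b (2 * ∑ k, l k ^ 2) L₃ x| ≤
          A * K * δ ^ 2 := by
  obtain ⟨δ₀, K, hδ₀, hK, h⟩ := exists_chiLaw_expansion_of_le c₁ hc₀ hs
  obtain ⟨K', hψ⟩ := exists_abs_psiDensity_le c₁ (4 * δm * c₁) hc₀ hs.le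
  set J := ∫ x : ℝ, Real.exp (-(s / 2 * |x|)) with hJdef
  have hJ : 0 ≤ J := integral_nonneg fun x => (Real.exp_pos _).le
  set E := 2 * Real.exp (s ^ 2 * c₁) + |K'| * J with hE
  have hE0 : 0 ≤ E := by positivity
  refine ⟨K + E / δ₀ ^ 2, by positivity, ?_⟩
  intro ι _ l δ hδ hδ0 hl h0 h1 b L₃ hκ A f hA hf hfb
  have hL : 0 < 2 * ∑ k, l k ^ 2 := hc₀.trans_le h0
  have hδs : δ * s ≤ 1 / 4 := (mul_le_mul_of_nonneg_right hδ0 hs.le).trans hδm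
  obtain ⟨i1, b1⟩ := chiLaw_crude_bound l hδ hs.le hl hδs h1 hf hA hfb
  refine ⟨i1, ?_⟩
  -- For `δ > δ₀` both integrals are at most a constant times `A`, and inserting `1 ≤ δ² / δ₀²`
  -- brings this to the required form.
  rcases le_or_gt δ δ₀ with hle | hgt
  · refine (h ι l δ hδ hle hδs hl h0 h1 b L₃ hκ A f hA hf hfb).trans ?_
    have : 0 ≤ E / δ₀ ^ 2 := by positivity
    gcongr
    linarith
  · have hκ' : |b ^ (1 / 2 : ℝ) * L₃| ≤ 4 * δm * c₁ := by
      rw [hκ]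
      refine (abs_sum_cube_le l hl).trans ?_
      gcongr
      linarith
    obtain ⟨-, b2⟩ := integrable_mul_of_exp_bound hf (continuous_psiDensity hL b L₃) hs hA hfb
      (hψ _ b L₃ h0 h1 hκ')
    have b3 : A * K' * J ≤ A * |K'| * J := by gcongr; exact le_abs_self _
    have h4 : 1 ≤ δ ^ 2 / δ₀ ^ 2 := by rw [one_le_div (by positivity)]; gcongr
    calc _ ≤ A * (2 * Real.exp (s ^ 2 * c₁)) + A * |K'| * J :=
          (abs_sub _ _).trans (add_le_add b1 (b2.trans b3))
      _ = A * E * 1 := by rw [hE]; ring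
      _ ≤ A * E * (δ ^ 2 / δ₀ ^ 2) := by gcongr
      _ = A * (E / δ₀ ^ 2) * δ ^ 2 := by ring
      _ ≤ _ := by gcongr; linarith

/-- The same expansion around a fixed variance `c`. -/
theorem exists_chiLaw_expansion_fixed {c δm s : ℝ} (hc : 0 < c) (hs : 0 < s)
    (hδm : δm * s ≤ 1 / 4) :
    ∃ K : ℝ, 0 ≤ K ∧ ∀ (ι : Type) [Fintype ι] (l : ι → ℝ) (δ : ℝ), 0 < δ → δ ≤ δm →
      (∀ k, |l k| ≤ δ) → |2 * ∑ k, l k ^ 2 - c| ≤ δ →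
      ∀ b L₃ : ℝ, b ^ (1 / 2 : ℝ) * L₃ = 8 * ∑ k, l k ^ 3 →
      ∀ (A : ℝ) (f : ℝ → ℝ), 0 ≤ A → Measurable f → (∀ x, |f x| ≤ A * Real.exp (s / 2 * |x|)) →
        Integrable f (chiLaw l) ∧
        |∫ x, f x ∂(chiLaw l) - ∫ x, f x * psiTildeDensity b c (2 * ∑ k, l k ^ 2) L₃ x| ≤
          A * K * δ ^ 2 := by
  -- For `δ ≤ c / 4` the variance lies in `[3c/4, c + δm]`, which supplies the bounds required by
  -- the expansion around the true variance.
  obtain ⟨K₁, hK₁, h⟩ := exists_chiLaw_expansion (c₀ := 3 / 4 * c) (c + δm) (by positivity) hs hδm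
  obtain ⟨K₂, hψ⟩ := exists_abs_psiDensity_le (c₀ := 3 / 4 * c) (c + δm) (4 * δm * (c + δm))
    (by positivity) hs.le
  obtain ⟨K₃, hψt⟩ := exists_abs_psiTildeDensity_le δm (4 * δm * (c + δm)) hc hs.le
  obtain ⟨K₄, hK₄, hd⟩ := exists_abs_psiDensity_sub_psiTildeDensity_le hc hs.le
  set J := ∫ x : ℝ, Real.exp (-(s / 2 * |x|)) with hJdef
  have hJ : 0 ≤ J := integral_nonneg fun x => (Real.exp_pos _).le
  set E := 2 * Real.exp (s ^ 2 * (c + δm)) + |K₃| * J with hE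
  have hE0 : 0 ≤ E := by positivity
  set G := (1 + 4 * |c + δm|) * K₄ * J with hG
  have hG0 : 0 ≤ G := by positivity
  refine ⟨K₁ + G + E / (c / 4) ^ 2, by positivity, ?_⟩
  intro ι _ l δ hδ hδ0 hl hLc b L₃ hκ A f hA hf hfb
  have hδs : δ * s ≤ 1 / 4 := (mul_le_mul_of_nonneg_right hδ0 hs.le).trans hδm
  have hδm0 : 0 < δm := hδ.trans_le hδ0
  set L := 2 * ∑ k, l k ^ 2 with hLdef
  have hL1 : L ≤ c + δm := by have := (abs_le.1 hLc).2; linarith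
  have hL0 : 0 ≤ L := by positivity
  have hκ1 : |b ^ (1 / 2 : ℝ) * L₃| ≤ 4 * δ * (c + δm) := by
    rw [hκ]
    refine (abs_sum_cube_le l hl).trans ?_
    gcongr
  have hκ' : |b ^ (1 / 2 : ℝ) * L₃| ≤ 4 * δm * (c + δm) := hκ1.trans (by gcongr)
  obtain ⟨i1, b1⟩ := chiLaw_crude_bound l hδ hs.le hl hδs hL1 hf hA hfb
  refine ⟨i1, ?_⟩
  have ct := continuous_psiTildeDensity hc b L L₃
  obtain ⟨i3, b3⟩ := integrable_mul_of_exp_bound hf ct hs hA hfb (hψt L b L₃ (hLc.trans hδ0) hκ')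
  rcases le_or_gt δ (c / 4) with hle | hgt
  · have hLl : 3 / 4 * c ≤ L := by have := (abs_le.1 hLc).1; linarith
    have cψ := continuous_psiDensity (L := L) (by linarith) b L₃
    obtain ⟨-, b2⟩ := h ι l δ hδ hδ0 hl hLl hL1 b L₃ hκ A f hA hf hfb
    obtain ⟨i2, -⟩ := integrable_mul_of_exp_bound hf cψ hs hA hfb (hψ L b L₃ hLl hL1 hκ')
    obtain ⟨-, b4⟩ := integrable_mul_of_exp_bound hf (cψ.sub ct) hs hA hfb
      (hd L b L₃ (hLc.trans hle))
    have e : ∫ x, f x * (psiDensity b L L₃ - psiTildeDensity b c L L₃) x =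
        (∫ x, f x * psiDensity b L L₃ x) - ∫ x, f x * psiTildeDensity b c L L₃ x := by
      rw [← integral_sub i2 i3]
      congr 1 with y
      simp only [Pi.sub_apply]; ring
    rw [e] at b4
    -- Both `L - c` and the third cumulant are of order `δ`, so recentring the variance costs
    -- `O(δ²)`.
    have q1 : (L - c) ^ 2 + |b ^ (1 / 2 : ℝ) * L₃| * |L - c| ≤ (1 + 4 * |c + δm|) * δ ^ 2 := by
      have r1 : (L - c) ^ 2 ≤ δ ^ 2 := sq_le_sq' (abs_le.1 hLc).1 (abs_le.1 hLc).2
      have r2 : |b ^ (1 / 2 : ℝ) * L₃| * |L - c| ≤ 4 * δ * (c + δm) * δ :=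
        mul_le_mul hκ1 hLc (abs_nonneg _) (by positivity)
      have r3 : (c + δm) * δ ^ 2 ≤ |c + δm| * δ ^ 2 := by gcongr; exact le_abs_self _
      linarith
    have b5 : A * (((L - c) ^ 2 + |b ^ (1 / 2 : ℝ) * L₃| * |L - c|) * K₄) * J ≤
        A * (((1 + 4 * |c + δm|) * δ ^ 2) * K₄) * J := by gcongr
    have b6 : A * (((1 + 4 * |c + δm|) * δ ^ 2) * K₄) * J = A * G * δ ^ 2 := by rw [hG]; ring
    have b7 : 0 ≤ A * (E / (c / 4) ^ 2) * δ ^ 2 := by positivity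
    have b8 := abs_sub_le (∫ x, f x ∂(chiLaw l)) (∫ x, f x * psiDensity b L L₃ x)
      (∫ x, f x * psiTildeDensity b c L L₃ x)
    have b9 := (b4.trans b5).trans_eq b6
    calc _ ≤ A * K₁ * δ ^ 2 + A * G * δ ^ 2 := b8.trans (add_le_add b2 b9)
      _ ≤ A * K₁ * δ ^ 2 + A * G * δ ^ 2 + A * (E / (c / 4) ^ 2) * δ ^ 2 := by linarith
      _ = _ := by ring
  · have b4 : A * K₃ * J ≤ A * |K₃| * J := by gcongr; exact le_abs_self _
    have h4 : 1 ≤ δ ^ 2 / (c / 4) ^ 2 := by rw [one_le_div (by positivity)]; gcongr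
    calc _ ≤ A * (2 * Real.exp (s ^ 2 * (c + δm))) + A * |K₃| * J :=
          (abs_sub _ _).trans (add_le_add b1 (b3.trans b4))
      _ = A * E * 1 := by rw [hE]; ring
      _ ≤ A * E * (δ ^ 2 / (c / 4) ^ 2) := by gcongr
      _ = A * (E / (c / 4) ^ 2) * δ ^ 2 := by ring
      _ ≤ _ := by gcongr; linarith

end HY

/-! ### Diagonalisation of Gaussian quadratic forms. -/

namespace HY

open scoped Matrix MatrixOrder

lemma trace_pow_eq_sum_eigenvalues {ι : Type*} [Fintype ι] [DecidableEq ι] {A : Matrix ι ι ℝ}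
    (hA : A.IsHermitian) (k : ℕ) : (A ^ k).trace = ∑ i, hA.eigenvalues i ^ k := by
  have h : A ^ k = Unitary.conjStarAlgAut ℝ (Matrix ι ι ℝ) hA.eigenvectorUnitary
      (Matrix.diagonal (RCLike.ofReal ∘ hA.eigenvalues) ^ k) := by
    rw [map_pow, ← hA.spectral_theorem]
  rw [h, Unitary.conjStarAlgAut_apply, Matrix.trace_mul_comm, ← mul_assoc,
    Unitary.star_mul_self_of_mem (hA.eigenvectorUnitary).2, one_mul, Matrix.diagonal_pow,
    Matrix.trace_diagonal]
  rfl

/-- Read the eigenvalue equation at a coordinate of largest modulus. No symmetry of the matrix is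
needed, so this applies to the product `BΣ`. -/
lemma abs_le_of_mulVec_eq_smul {ι : Type*} [Fintype ι] {N : Matrix ι ι ℝ} {C μ : ℝ}
    (hC : ∀ i, ∑ j, |N i j| ≤ C) {w : ι → ℝ} (hw : w ≠ 0) (h : N *ᵥ w = μ • w) : |μ| ≤ C := by
  obtain ⟨j₀, hj₀⟩ := Function.ne_iff.1 hw
  have : Nonempty ι := ⟨j₀⟩
  obtain ⟨i, -, hi⟩ := Finset.exists_max_image Finset.univ (fun i => |w i|) ⟨j₀, Finset.mem_univ _⟩
  have hpos : 0 < |w i| := (abs_pos.2 hj₀).trans_le (hi j₀ (Finset.mem_univ _))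
  have hi' := congrFun h i
  simp only [Matrix.mulVec, dotProduct, Pi.smul_apply, smul_eq_mul] at hi'
  refine le_of_mul_le_mul_right ?_ hpos
  calc |μ| * |w i| = |∑ j, N i j * w j| := by rw [hi', abs_mul]
    _ ≤ ∑ j, |N i j| * |w i| := by
        refine (Finset.abs_sum_le_sum_abs _ _).trans (Finset.sum_le_sum fun j hj => ?_)
        rw [abs_mul]
        exact mul_le_mul_of_nonneg_left (hi j hj) (abs_nonneg _)
    _ = (∑ j, |N i j|) * |w i| := by rw [Finset.sum_mul]
    _ ≤ C * |w i| := by gcongr; exact hC i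

/-- A quadratic form in a centred Gaussian vector has the law of a weighted sum of squares of
independent standard normal variables. -/
theorem exists_map_quadForm_multivariateGaussian {ι : Type*} [Fintype ι] [DecidableEq ι]
    {S B : Matrix ι ι ℝ} (hS : S.PosSemidef) (hB : B.IsHermitian) :
    ∃ l : ι → ℝ,
      (multivariateGaussian 0 S).map (fun y => y.ofLp ⬝ᵥ B *ᵥ y.ofLp) =
        (Measure.pi fun _ : ι => gaussianReal 0 1).map (fun ξ => ∑ k, l k * ξ k ^ 2) ∧
      ∑ k, l k = (B * S).trace ∧ ∑ k, l k ^ 2 = ((B * S) ^ 2).trace ∧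
      ∑ k, l k ^ 3 = ((B * S) ^ 3).trace ∧
      ∀ C, (∀ i, ∑ j, |(B * S) i j| ≤ C) → ∀ k, |l k| ≤ C := by
  set R : Matrix ι ι ℝ := CFC.sqrt S with hR
  have hRR : R * R = S := CFC.sqrt_mul_sqrt_self S hS.nonneg
  have hRt : Rᵀ = R := by
    have : R.IsHermitian := (CFC.sqrt_nonneg S).isSelfAdjoint
    simpa [Matrix.IsHermitian, Matrix.conjTranspose_eq_transpose_of_trivial] using this
  have hBt : Bᵀ = B := by
    simpa [Matrix.IsHermitian, Matrix.conjTranspose_eq_transpose_of_trivial] using hB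
  have hA : (R * B * R).IsHermitian := by
    rw [Matrix.IsHermitian, Matrix.conjTranspose_eq_transpose_of_trivial, Matrix.transpose_mul,
      Matrix.transpose_mul, hRt, hBt, mul_assoc]
  refine ⟨hA.eigenvalues, ?_, ?_, ?_, ?_, ?_⟩
  -- The standard Gaussian vector is written in the eigenbasis of `R B R`, so its coordinates there
  -- are independent standard normals and the form becomes diagonal.
  · have hlin : ∀ ξ : ι → ℝ, (R * B * R) *ᵥ (∑ k, ξ k • hA.eigenvectorBasis k).ofLp =
        (∑ k, (ξ k * hA.eigenvalues k) • hA.eigenvectorBasis k).ofLp := fun ξ => by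
      rw [WithLp.ofLp_sum, WithLp.ofLp_sum, Matrix.mulVec_sum]
      refine Finset.sum_congr rfl fun k _ => ?_
      rw [WithLp.ofLp_smul, WithLp.ofLp_smul, Matrix.mulVec_smul, hA.mulVec_eigenvectorBasis, smul_smul]
    rw [multivariateGaussian, stdGaussian_eq_map_pi_orthonormalBasis hA.eigenvectorBasis,
      Measure.map_map (by fun_prop) (by fun_prop), Measure.map_map _ (by fun_prop)]
    · congr 1
      ext ξ
      simp only [Function.comp_apply, zero_add, Matrix.ofLp_toEuclideanCLM]
      have h1 : ∀ x : ι → ℝ, (R *ᵥ x) ⬝ᵥ B *ᵥ (R *ᵥ x) = x ⬝ᵥ (R * B * R) *ᵥ x := fun x => by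
        rw [← Matrix.mulVec_mulVec, ← Matrix.mulVec_mulVec, Matrix.dotProduct_mulVec x R,
          ← Matrix.mulVec_transpose, hRt]
      rw [h1, hlin]
      have h2 := hA.eigenvectorBasis.orthonormal.inner_sum ξ (fun k => ξ k * hA.eigenvalues k)
        Finset.univ
      rw [EuclideanSpace.inner_eq_star_dotProduct, dotProduct_comm] at h2
      simp only [star_trivial] at h2
      rw [h2]
      refine Finset.sum_congr rfl fun k _ => ?_
      simp only [conj_trivial]
      ring
    · exact Continuous.measurable (by fun_prop)
  · have := trace_pow_eq_sum_eigenvalues hA 1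
    simp only [pow_one] at this
    rw [← this, ← hRR, mul_assoc, Matrix.trace_mul_comm, mul_assoc]
  · rw [← trace_pow_eq_sum_eigenvalues hA 2, ← hRR, sq, sq]
    rw [show R * B * R * (R * B * R) = R * (B * R * R * B * R) by simp only [mul_assoc],
      Matrix.trace_mul_comm]
    simp only [mul_assoc]
  · rw [← trace_pow_eq_sum_eigenvalues hA 3, ← hRR, pow_succ, pow_succ (B * (R * R)), sq, sq]
    rw [show R * B * R * (R * B * R) * (R * B * R) = R * (B * R * R * B * R * R * B * R) by
      simp only [mul_assoc], Matrix.trace_mul_comm]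
    simp only [mul_assoc]
  · intro C hC k
    set e : ι → ℝ := (hA.eigenvectorBasis k).ofLp with he
    have hAe : (R * B * R) *ᵥ e = hA.eigenvalues k • e := hA.mulVec_eigenvectorBasis k
    have hne : e ≠ 0 := by
      intro h
      have h1 := hA.eigenvectorBasis.orthonormal.ne_zero k
      exact h1 (WithLp.ofLp_injective 2 (h.trans (WithLp.ofLp_zero 2).symm))
    -- The vector `B R e` is an eigenvector of `B S` for the same eigenvalue unless it vanishes, and
    -- then the eigenvalue is zero. This uses row sums of `B S` itself and does not require `S` to
    -- be invertible.
    by_cases hw : (B * R) *ᵥ e = 0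
    · have h0 : hA.eigenvalues k • e = 0 := by
        rw [← hAe, mul_assoc, ← Matrix.mulVec_mulVec, hw, Matrix.mulVec_zero]
      have : hA.eigenvalues k = 0 := (smul_eq_zero.1 h0).resolve_right hne
      rw [this, abs_zero]
      exact (Finset.sum_nonneg fun j _ => abs_nonneg _).trans (hC k)
    · refine abs_le_of_mulVec_eq_smul hC hw ?_
      rw [Matrix.mulVec_mulVec, ← hRR,
        show B * (R * R) * (B * R) = (B * R) * (R * B * R) by simp only [mul_assoc],
        ← Matrix.mulVec_mulVec, hAe, Matrix.mulVec_smul]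

end HY

/-! ### Closed walks in an acyclic bipartite graph. -/

namespace HY

/-- A bipartite graph with adjacency matrix `k` (with entries `0` and `1`) without cycles of length
`4` and `6`, and weights `C` carried by its edges. -/
structure IsForestWeight {α β : Type*} (k C : α → β → ℝ) : Prop where
  zero_or_one : ∀ i j, k i j = 0 ∨ k i j = 1
  weight_eq_zero : ∀ i j, k i j = 0 → C i j = 0
  no_four_cycle : ∀ i i' j j', i ≠ i' → k i j ≠ 0 → k i' j ≠ 0 → k i j' ≠ 0 → k i' j' ≠ 0 → j = j'
  no_six_cycle : ∀ i₁ i₂ i₃ j₁ j₂ j₃, i₁ ≠ i₂ → i₂ ≠ i₃ → i₁ ≠ i₃ → k i₁ j₁ ≠ 0 → k i₂ j₁ ≠ 0 →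
    k i₂ j₂ ≠ 0 → k i₃ j₂ ≠ 0 → k i₃ j₃ ≠ 0 → k i₁ j₃ ≠ 0 → j₁ = j₂ ∧ j₂ = j₃

/-- The entries of the matrix `k Cᵀ`. -/
def pathWeight {α β : Type*} [Fintype β] (k C : α → β → ℝ) (i i' : α) : ℝ := ∑ j, k i j * C i' j

namespace IsForestWeight

variable {α β : Type*} {k C : α → β → ℝ}

lemma mul_self (h : IsForestWeight k C) (i : α) (j : β) : k i j * C i j = C i j := by
  rcases h.zero_or_one i j with hk | hk
  · rw [h.weight_eq_zero i j hk, mul_zero]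
  · rw [hk, one_mul]

lemma eq_one (h : IsForestWeight k C) {i : α} {j : β} (hk : k i j ≠ 0) : k i j = 1 :=
  (h.zero_or_one i j).resolve_left hk

lemma adj_of_weight (h : IsForestWeight k C) {i : α} {j : β} (hC : C i j ≠ 0) : k i j ≠ 0 :=
  fun hk => hC (h.weight_eq_zero i j hk)

/-- The axioms treat the two vertex classes differently. A six-cycle with distinct columns but two
equal rows contains a four-cycle, so the only case that needs the six-cycle axiom is the one with
distinct rows. -/
lemma swap (h : IsForestWeight k C) : IsForestWeight (fun j i => k i j) (fun j i => C i j) where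
  zero_or_one j i := h.zero_or_one i j
  weight_eq_zero j i := h.weight_eq_zero i j
  no_four_cycle j j' i i' hj h1 h2 h3 h4 := by
    by_contra hi
    exact hj (h.no_four_cycle i i' j j' hi h1 h3 h2 h4)
  no_six_cycle j₁ j₂ j₃ i₁ i₂ i₃ h12 h23 h13 a1 a2 b1 b2 c1 c2 := by
    by_cases e12 : i₁ = i₂
    · subst e12
      by_cases e13 : i₁ = i₃
      · exact ⟨rfl, e13⟩
      · exact absurd (h.no_four_cycle i₁ i₃ j₁ j₃ e13 a1 c2 b2 c1) h13
    · by_cases e23 : i₂ = i₃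
      · subst e23
        exact absurd (h.no_four_cycle i₁ i₂ j₁ j₂ e12 a1 c2 a2 b1) h12
      · by_cases e13 : i₁ = i₃
        · subst e13
          exact absurd (h.no_four_cycle i₁ i₂ j₂ j₃ e12 a2 b1 c1 b2) h23
        · exact absurd (h.no_six_cycle i₁ i₂ i₃ j₂ j₃ j₁ e12 e23 e13 a2 b1 b2 c1 c2 a1).1 h23

variable [Fintype β]

lemma pathWeight_self (h : IsForestWeight k C) (i : α) : pathWeight k C i i = ∑ j, C i j :=
  Finset.sum_congr rfl fun j _ => h.mul_self i j

/-- Two distinct vertices of one class have at most one common neighbour, so the sum has a single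
term. -/
lemma pathWeight_eq (h : IsForestWeight k C) {i i' : α} (hi : i ≠ i') {j : β} (h1 : k i j ≠ 0)
    (h2 : k i' j ≠ 0) : pathWeight k C i i' = C i' j := by
  rw [pathWeight, Finset.sum_eq_single j, h.eq_one h1, one_mul]
  · intro j' _ hj'
    by_contra hne
    exact hj' (h.no_four_cycle i i' j' j hi (left_ne_zero_of_mul hne)
      (h.adj_of_weight (right_ne_zero_of_mul hne)) h1 h2)
  · exact fun hj => absurd (Finset.mem_univ j) hj

lemma exists_of_pathWeight_ne_zero (h : IsForestWeight k C) {i i' : α}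
    (hP : pathWeight k C i i' ≠ 0) : ∃ j, k i j ≠ 0 ∧ k i' j ≠ 0 := by
  obtain ⟨j, -, hj⟩ := Finset.exists_ne_zero_of_sum_ne_zero hP
  exact ⟨j, left_ne_zero_of_mul hj, h.adj_of_weight (right_ne_zero_of_mul hj)⟩

lemma pathWeight_mul_swap (h : IsForestWeight k C) {i i' : α} (hi : i ≠ i') :
    pathWeight k C i i' * pathWeight k C i' i = ∑ j, C i j * C i' j := by
  by_cases hex : ∃ j, k i j ≠ 0 ∧ k i' j ≠ 0
  · obtain ⟨j, h1, h2⟩ := hex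
    rw [h.pathWeight_eq hi h1 h2, h.pathWeight_eq hi.symm h2 h1, Finset.sum_eq_single j, mul_comm]
    · intro j' _ hj'
      by_contra hne
      exact hj' (h.no_four_cycle i i' j' j hi (h.adj_of_weight (left_ne_zero_of_mul hne))
        (h.adj_of_weight (right_ne_zero_of_mul hne)) h1 h2)
    · exact fun hj => absurd (Finset.mem_univ j) hj
  · have h0 : pathWeight k C i i' = 0 := by
      by_contra hne
      exact hex (h.exists_of_pathWeight_ne_zero hne)
    rw [h0, zero_mul, eq_comm]
    refine Finset.sum_eq_zero fun j _ => ?_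
    by_contra hne
    exact hex ⟨j, h.adj_of_weight (left_ne_zero_of_mul hne), h.adj_of_weight (right_ne_zero_of_mul hne)⟩

/-- A nonzero product needs a common neighbour for each of the three pairs. Without cycles these
neighbours coincide, so the closed walk goes through one single vertex of the other class. -/
lemma pathWeight_mul_mul (h : IsForestWeight k C) {i₁ i₂ i₃ : α} (h12 : i₁ ≠ i₂) (h23 : i₂ ≠ i₃)
    (h13 : i₁ ≠ i₃) : pathWeight k C i₁ i₂ * pathWeight k C i₂ i₃ * pathWeight k C i₃ i₁ =
      ∑ j, C i₁ j * C i₂ j * C i₃ j := by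
  by_cases hex : ∃ j, k i₁ j ≠ 0 ∧ k i₂ j ≠ 0 ∧ k i₃ j ≠ 0
  · obtain ⟨j, h1, h2, h3⟩ := hex
    rw [h.pathWeight_eq h12 h1 h2, h.pathWeight_eq h23 h2 h3, h.pathWeight_eq h13.symm h3 h1,
      Finset.sum_eq_single j]
    · ring
    · intro j' _ hj'
      by_contra hne
      have hne' := left_ne_zero_of_mul hne
      exact hj' (h.no_four_cycle i₁ i₂ j' j h12 (h.adj_of_weight (left_ne_zero_of_mul hne'))
        (h.adj_of_weight (right_ne_zero_of_mul hne')) h1 h2)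
    · exact fun hj => absurd (Finset.mem_univ j) hj
  · have h0 : pathWeight k C i₁ i₂ * pathWeight k C i₂ i₃ * pathWeight k C i₃ i₁ = 0 := by
      by_contra hne
      have hne' := left_ne_zero_of_mul hne
      obtain ⟨j₁, a1, a2⟩ := h.exists_of_pathWeight_ne_zero (left_ne_zero_of_mul hne')
      obtain ⟨j₂, b1, b2⟩ := h.exists_of_pathWeight_ne_zero (right_ne_zero_of_mul hne')
      obtain ⟨j₃, c1, c2⟩ := h.exists_of_pathWeight_ne_zero (right_ne_zero_of_mul hne)
      obtain ⟨e1, e2⟩ := h.no_six_cycle i₁ i₂ i₃ j₁ j₂ j₃ h12 h23 h13 a1 a2 b1 b2 c1 c2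
      subst e1
      exact hex ⟨j₁, a1, a2, b2⟩
    rw [h0, eq_comm]
    refine Finset.sum_eq_zero fun j _ => ?_
    by_contra hne
    have hne' := left_ne_zero_of_mul hne
    exact hex ⟨j, h.adj_of_weight (left_ne_zero_of_mul hne'),
      h.adj_of_weight (right_ne_zero_of_mul hne'), h.adj_of_weight (right_ne_zero_of_mul hne)⟩

variable [Fintype α]

/-- The trace of `(k Cᵀ)²`. -/
theorem sum_pathWeight_sq [DecidableEq α] (h : IsForestWeight k C) :
    ∑ i, ∑ i', pathWeight k C i i' * pathWeight k C i' i =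
      ∑ i, (∑ j, C i j) ^ 2 + ∑ j, (∑ i, C i j) ^ 2 - ∑ i, ∑ j, C i j ^ 2 := by
  -- The off-diagonal formula is extended to all pairs, with a correction on the diagonal; the
  -- unrestricted sum then factors into squares of column sums.
  have key : ∀ i i', pathWeight k C i i' * pathWeight k C i' i = ∑ j, C i j * C i' j +
      if i = i' then (∑ j, C i j) ^ 2 - ∑ j, C i j ^ 2 else 0 := by
    intro i i'
    split_ifs with hi
    · subst hi
      rw [h.pathWeight_self]
      simp_rw [← sq]
      ring
    · rw [h.pathWeight_mul_swap hi, add_zero]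
  simp_rw [key, Finset.sum_add_distrib, Finset.sum_ite_eq, Finset.mem_univ, if_true,
    Finset.sum_sub_distrib]
  have e : ∑ i, ∑ i', ∑ j, C i j * C i' j = ∑ j, (∑ i, C i j) ^ 2 := by
    calc _ = ∑ i, ∑ j, C i j * ∑ i', C i' j := by
          refine Finset.sum_congr rfl fun i _ => ?_
          rw [Finset.sum_comm]
          simp_rw [Finset.mul_sum]
      _ = _ := by
          rw [Finset.sum_comm]
          simp_rw [← Finset.sum_mul, sq]
  rw [e]
  ring

/-- The trace of `(k Cᵀ)³`. -/
theorem sum_pathWeight_cube [DecidableEq α] (h : IsForestWeight k C) :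
    ∑ i₁, ∑ i₂, ∑ i₃, pathWeight k C i₁ i₂ * pathWeight k C i₂ i₃ * pathWeight k C i₃ i₁ =
      ∑ i, (∑ j, C i j) ^ 3 + ∑ j, (∑ i, C i j) ^ 3 + 2 * ∑ i, ∑ j, C i j ^ 3 -
        3 * ∑ i, ∑ j, (C i j ^ 2 * (∑ j, C i j + ∑ i, C i j) - C i j * (∑ j, C i j) * ∑ i, C i j) := by
  set a : α → ℝ := fun i => ∑ j, C i j with ha
  set b : β → ℝ := fun j => ∑ i, C i j with hb
  -- The off-diagonal formula is again extended to all triples: `E` corrects it where two indices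
  -- agree. `F` repairs the case of three equal indices, where the correction `E` has been added
  -- three times.
  set E : α → α → ℝ := fun i i' => a i * ∑ j, C i j * C i' j - ∑ j, C i j ^ 2 * C i' j with hE
  set F : α → ℝ := fun i => a i ^ 3 + 2 * ∑ j, C i j ^ 3 - 3 * (a i * ∑ j, C i j ^ 2) with hF
  have key : ∀ i₁ i₂ i₃, pathWeight k C i₁ i₂ * pathWeight k C i₂ i₃ * pathWeight k C i₃ i₁ =
      ∑ j, C i₁ j * C i₂ j * C i₃ j + (if i₁ = i₂ then E i₁ i₃ else 0) +
        (if i₂ = i₃ then E i₂ i₁ else 0) + (if i₁ = i₃ then E i₁ i₂ else 0) +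
        (if i₁ = i₂ then if i₂ = i₃ then F i₁ else 0 else 0) := by
    intro i₁ i₂ i₃
    by_cases h12 : i₁ = i₂
    · subst h12
      by_cases h13 : i₁ = i₃
      · subst h13
        simp only [if_true, hE, hF, h.pathWeight_self]
        have e1 : ∑ j, C i₁ j * C i₁ j * C i₁ j = ∑ j, C i₁ j ^ 3 :=
          Finset.sum_congr rfl fun j _ => by ring
        have e2 : ∑ j, C i₁ j ^ 2 * C i₁ j = ∑ j, C i₁ j ^ 3 :=
          Finset.sum_congr rfl fun j _ => by ring
        have e3 : ∑ j, C i₁ j * C i₁ j = ∑ j, C i₁ j ^ 2 :=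
          Finset.sum_congr rfl fun j _ => by ring
        rw [e1, e2, e3]
        ring
      · simp only [if_true, if_neg h13, add_zero, hE, h.pathWeight_self]
        rw [mul_assoc, h.pathWeight_mul_swap h13]
        have e1 : ∑ j, C i₁ j * C i₁ j * C i₃ j = ∑ j, C i₁ j ^ 2 * C i₃ j :=
          Finset.sum_congr rfl fun j _ => by ring
        rw [e1]
        ring
    · by_cases h13 : i₁ = i₃
      · subst h13
        simp only [if_true, if_neg h12, if_neg (Ne.symm h12), add_zero, hE, h.pathWeight_self]
        rw [h.pathWeight_mul_swap h12]
        have e1 : ∑ j, C i₁ j * C i₂ j * C i₁ j = ∑ j, C i₁ j ^ 2 * C i₂ j :=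
          Finset.sum_congr rfl fun j _ => by ring
        rw [e1]
        ring
      · by_cases h23 : i₂ = i₃
        · subst h23
          simp only [if_true, if_neg h12, add_zero, hE, h.pathWeight_self]
          rw [mul_right_comm, h.pathWeight_mul_swap h12]
          have e1 : ∑ j, C i₁ j * C i₂ j * C i₂ j = ∑ j, C i₂ j ^ 2 * C i₁ j :=
            Finset.sum_congr rfl fun j _ => by ring
          have e2 : ∑ j, C i₁ j * C i₂ j = ∑ j, C i₂ j * C i₁ j :=
            Finset.sum_congr rfl fun j _ => by ring
          rw [e1, e2]
          ring
        · simp only [if_neg h12, if_neg h13, if_neg h23, add_zero]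
          exact h.pathWeight_mul_mul h12 h23 h13
  have s1 : ∑ i₁, ∑ i₂, ∑ i₃, ∑ j, C i₁ j * C i₂ j * C i₃ j = ∑ j, b j ^ 3 := by
    calc _ = ∑ i₁, ∑ i₂, ∑ j, C i₁ j * C i₂ j * b j := by
          refine Finset.sum_congr rfl fun i _ => Finset.sum_congr rfl fun i' _ => ?_
          rw [Finset.sum_comm]
          simp_rw [← Finset.mul_sum, hb]
      _ = ∑ i₁, ∑ j, C i₁ j * b j * b j := by
          refine Finset.sum_congr rfl fun i _ => ?_
          rw [Finset.sum_comm]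
          simp_rw [← Finset.sum_mul, ← Finset.mul_sum, hb]
      _ = _ := by
          rw [Finset.sum_comm]
          simp_rw [← Finset.sum_mul]
          refine Finset.sum_congr rfl fun j _ => ?_
          simp only [hb]; ring
  have s2 : ∑ i, ∑ i', E i i' = ∑ i, ∑ j, C i j * a i * b j - ∑ i, ∑ j, C i j ^ 2 * b j := by
    rw [← Finset.sum_sub_distrib]
    refine Finset.sum_congr rfl fun i _ => ?_
    simp only [hE]
    rw [Finset.sum_sub_distrib, ← Finset.mul_sum, Finset.sum_comm, Finset.sum_comm (γ := α),
      Finset.mul_sum]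
    congr 1
    · refine Finset.sum_congr rfl fun j _ => ?_
      rw [← Finset.mul_sum]; simp only [hb]; ring
    · refine Finset.sum_congr rfl fun j _ => ?_
      rw [← Finset.mul_sum]
  have s3 : ∑ i, F i = ∑ i, a i ^ 3 + 2 * ∑ i, ∑ j, C i j ^ 3 - 3 * ∑ i, ∑ j, C i j ^ 2 * a i := by
    simp only [hF, Finset.sum_sub_distrib, Finset.sum_add_distrib, ← Finset.mul_sum]
    congr 2
    refine Finset.sum_congr rfl fun i _ => ?_
    rw [← Finset.sum_mul, mul_comm]
  have s4 : ∑ i, ∑ j, (C i j ^ 2 * (a i + b j) - C i j * a i * b j) =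
      ∑ i, ∑ j, C i j ^ 2 * a i + ∑ i, ∑ j, C i j ^ 2 * b j - ∑ i, ∑ j, C i j * a i * b j := by
    simp_rw [mul_add, Finset.sum_sub_distrib, Finset.sum_add_distrib]
  have t1 : ∑ i₁, ∑ i₂, ∑ i₃, (if i₁ = i₂ then E i₁ i₃ else 0) = ∑ i, ∑ i', E i i' := by
    refine Finset.sum_congr rfl fun i _ => ?_
    rw [Finset.sum_comm]
    simp
  have t2 : ∑ i₁, ∑ i₂, ∑ i₃, (if i₂ = i₃ then E i₂ i₁ else 0) = ∑ i, ∑ i', E i i' := by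
    rw [Finset.sum_comm]
    simp
  have t3 : ∑ i₁, ∑ i₂, ∑ i₃, (if i₁ = i₃ then E i₁ i₂ else 0) = ∑ i, ∑ i', E i i' := by
    simp
  have t4 : ∑ i₁, ∑ i₂, ∑ i₃, (if i₁ = i₂ then if i₂ = i₃ then F i₁ else 0 else 0) = ∑ i, F i := by
    refine Finset.sum_congr rfl fun i _ => ?_
    rw [Finset.sum_comm]
    simp
  simp_rw [key, Finset.sum_add_distrib, t1, t2, t3, t4, s1, s2, s3]
  rw [s4]
  ring

/-- Row sums of `k Cᵀ k` along an edge. -/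
theorem sum_pathWeight_mul [DecidableEq α] (h : IsForestWeight k C) {i : α} {j : β} (hk : k i j ≠ 0) :
    ∑ i', pathWeight k C i i' * k i' j = ∑ j, C i j + ∑ i, C i j - C i j := by
  -- For `i' ≠ i` the only possible path goes through `j` itself. In the application the total is
  -- `v(I) + v(J) - v(I ∩ J) = v(I ∪ J)`.
  have key : ∀ i', pathWeight k C i i' * k i' j = C i' j +
      if i = i' then ∑ j, C i j - C i j else 0 := by
    intro i'
    split_ifs with hi
    · subst hi
      rw [h.pathWeight_self, h.eq_one hk]
      ring
    · rw [add_zero]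
      rcases h.zero_or_one i' j with h0 | h1
      · rw [h0, mul_zero, h.weight_eq_zero _ _ h0]
      · have hne : k i' j ≠ 0 := by rw [h1]; norm_num
        rw [h1, mul_one, h.pathWeight_eq hi hk hne]
  simp_rw [key, Finset.sum_add_distrib, Finset.sum_ite_eq, Finset.mem_univ, if_true]
  ring

end IsForestWeight

/-! ### Traces of powers of the coupling matrix times the covariance matrix. -/

open scoped Matrix

/-- The matrix of the quadratic form `(x, y) ↦ ∑ᵢⱼ kᵢⱼ xᵢ yⱼ`. -/
noncomputable def couplingMatrix {α β : Type*} (k : α → β → ℝ) : Matrix (α ⊕ β) (α ⊕ β) ℝ :=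
  Matrix.fromBlocks 0 ((1 / 2 : ℝ) • Matrix.of k) ((1 / 2 : ℝ) • (Matrix.of k)ᵀ) 0

/-- The covariance matrix with diagonal blocks `diag d`, `diag e` and off-diagonal block `C`. -/
def blockCovMatrix {α β : Type*} [DecidableEq α] [DecidableEq β] (d : α → ℝ) (e : β → ℝ)
    (C : α → β → ℝ) : Matrix (α ⊕ β) (α ⊕ β) ℝ :=
  Matrix.fromBlocks (Matrix.diagonal d) (Matrix.of C) (Matrix.of C)ᵀ (Matrix.diagonal e)

lemma trace_fromBlocks_eq {α β : Type*} [Fintype α] [Fintype β] (A : Matrix α α ℝ)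
    (B : Matrix α β ℝ) (B' : Matrix β α ℝ) (D : Matrix β β ℝ) :
    (Matrix.fromBlocks A B B' D).trace = A.trace + D.trace := by
  simp [Matrix.trace]

section Trace

variable {α β : Type*} [Fintype α] [Fintype β] [DecidableEq α] [DecidableEq β] (k C : α → β → ℝ)
  (d : α → ℝ) (e : β → ℝ)

lemma couplingMatrix_mul_blockCovMatrix : couplingMatrix k * blockCovMatrix d e C =
    (1 / 2 : ℝ) • Matrix.fromBlocks (Matrix.of (pathWeight k C)) (Matrix.of k * Matrix.diagonal e)
      ((Matrix.of k)ᵀ * Matrix.diagonal d)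
      (Matrix.of (pathWeight (fun j i => k i j) (fun j i => C i j))) := by
  have h1 : Matrix.of k * (Matrix.of C)ᵀ = Matrix.of (pathWeight k C) := by
    ext i i'; simp [Matrix.mul_apply, pathWeight]
  have h2 : (Matrix.of k)ᵀ * Matrix.of C =
      Matrix.of (pathWeight (fun j i => k i j) (fun j i => C i j)) := by
    ext i i'; simp [Matrix.mul_apply, pathWeight]
  rw [couplingMatrix, blockCovMatrix, Matrix.fromBlocks_multiply, Matrix.fromBlocks_smul]
  simp only [Matrix.zero_mul, zero_add, add_zero, Matrix.smul_mul, h1, h2]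

variable {k C}

theorem trace_coupling (h : IsForestWeight k C) :
    (couplingMatrix k * blockCovMatrix d e C).trace = ∑ i, ∑ j, C i j := by
  rw [couplingMatrix_mul_blockCovMatrix, Matrix.trace_smul, trace_fromBlocks_eq]
  simp only [Matrix.trace, Matrix.diag_apply, Matrix.of_apply, h.pathWeight_self,
    h.swap.pathWeight_self]
  rw [Finset.sum_comm (γ := α), smul_eq_mul]
  ring

theorem trace_coupling_sq (h : IsForestWeight k C) :
    ((couplingMatrix k * blockCovMatrix d e C) ^ 2).trace =
      1 / 2 * (∑ i, ∑ j, d i * e j * k i j + ∑ i, (∑ j, C i j) ^ 2 + ∑ j, (∑ i, C i j) ^ 2 -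
        ∑ i, ∑ j, C i j ^ 2) := by
  rw [couplingMatrix_mul_blockCovMatrix, smul_pow, Matrix.trace_smul, sq (Matrix.fromBlocks _ _ _ _),
    Matrix.fromBlocks_multiply, trace_fromBlocks_eq, Matrix.trace_add, Matrix.trace_add,
    Matrix.trace_mul_comm ((Matrix.of k)ᵀ * Matrix.diagonal d)]
  have h1 : (Matrix.of (pathWeight k C) * Matrix.of (pathWeight k C)).trace =
      ∑ i, ∑ i', pathWeight k C i i' * pathWeight k C i' i := by
    simp [Matrix.trace, Matrix.mul_apply]
  have h2 : (Matrix.of (pathWeight (fun j i => k i j) (fun j i => C i j)) *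
      Matrix.of (pathWeight (fun j i => k i j) (fun j i => C i j))).trace =
      ∑ i, ∑ i', pathWeight (fun j i => k i j) (fun j i => C i j) i i' *
        pathWeight (fun j i => k i j) (fun j i => C i j) i' i := by
    simp [Matrix.trace, Matrix.mul_apply]
  -- The overlap entries are 0 or 1, so their squares equal themselves.
  have h3 : (Matrix.of k * Matrix.diagonal e * ((Matrix.of k)ᵀ * Matrix.diagonal d)).trace =
      ∑ i, ∑ j, d i * e j * k i j := by
    rw [← Matrix.mul_assoc]
    simp only [Matrix.trace, Matrix.diag_apply, Matrix.mul_diagonal]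
    refine Finset.sum_congr rfl fun i _ => ?_
    rw [Matrix.mul_apply, Finset.sum_mul]
    refine Finset.sum_congr rfl fun j _ => ?_
    simp only [Matrix.mul_diagonal, Matrix.of_apply, Matrix.transpose_apply]
    rcases h.zero_or_one i j with hk | hk <;> rw [hk] <;> ring
  rw [h1, h2, h3, h.sum_pathWeight_sq, h.swap.sum_pathWeight_sq,
    Finset.sum_comm (f := fun (x : β) (y : α) => C y x ^ 2), smul_eq_mul]
  ring

theorem trace_coupling_cube (h : IsForestWeight k C) :
    ((couplingMatrix k * blockCovMatrix d e C) ^ 3).trace =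
      1 / 4 * (∑ i, (∑ j, C i j) ^ 3 + ∑ j, (∑ i, C i j) ^ 3 + 2 * ∑ i, ∑ j, C i j ^ 3 +
        3 * ∑ i, ∑ j, d i * e j * (∑ j, C i j + ∑ i, C i j - C i j) * k i j -
        3 * ∑ i, ∑ j, (C i j ^ 2 * (∑ j, C i j + ∑ i, C i j) -
          C i j * (∑ j, C i j) * ∑ i, C i j)) := by
  set P := Matrix.of (pathWeight k C) with hP
  set Q := Matrix.of (pathWeight (fun j i => k i j) (fun j i => C i j)) with hQ
  set X := Matrix.of k * Matrix.diagonal e with hX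
  set Y := (Matrix.of k)ᵀ * Matrix.diagonal d with hY
  -- Of the eight block products in the cube, two are cubes of the diagonal blocks and have equal
  -- trace. The other six reduce cyclically to `P X Y` or `Q Y X`, which also have equal trace; with
  -- the factor `(1/2)³` this gives the prefactors `1/4` and `3/4`.
  have h1 : (P * P * P).trace = ∑ i, (∑ j, C i j) ^ 3 + ∑ j, (∑ i, C i j) ^ 3 +
      2 * ∑ i, ∑ j, C i j ^ 3 - 3 * ∑ i, ∑ j, (C i j ^ 2 * (∑ j, C i j + ∑ i, C i j) -
          C i j * (∑ j, C i j) * ∑ i, C i j) := by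
    rw [← h.sum_pathWeight_cube]
    simp only [Matrix.trace, Matrix.diag_apply, Matrix.mul_apply, hP, Matrix.of_apply, Finset.sum_mul]
    exact Finset.sum_congr rfl fun i _ => Finset.sum_comm
  have h2 : (Q * Q * Q).trace = (P * P * P).trace := by
    have p : P = Matrix.of k * (Matrix.of C)ᵀ := by
      ext i i'; simp [hP, Matrix.mul_apply, pathWeight]
    have q : Q = (Matrix.of k)ᵀ * Matrix.of C := by
      ext i i'; simp [hQ, Matrix.mul_apply, pathWeight]
    rw [← Matrix.trace_transpose (Q * Q * Q), p, q]
    simp only [Matrix.transpose_mul, Matrix.transpose_transpose]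
    rw [show (Matrix.of C)ᵀ * Matrix.of k * ((Matrix.of C)ᵀ * Matrix.of k * ((Matrix.of C)ᵀ *
      Matrix.of k)) = (Matrix.of C)ᵀ * (Matrix.of k * (Matrix.of C)ᵀ * Matrix.of k * (Matrix.of C)ᵀ *
      Matrix.of k) by simp only [Matrix.mul_assoc], Matrix.trace_mul_comm]
    simp only [Matrix.mul_assoc]
  have h3 : (P * X * Y).trace = ∑ i, ∑ j, d i * e j * (∑ j, C i j + ∑ i, C i j - C i j) * k i j := by
    have : P * X * Y = P * Matrix.of k * Matrix.diagonal e * (Matrix.of k)ᵀ * Matrix.diagonal d := by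
      simp only [hX, hY, Matrix.mul_assoc]
    rw [this]
    simp only [Matrix.trace, Matrix.diag_apply, Matrix.mul_diagonal]
    refine Finset.sum_congr rfl fun i _ => ?_
    rw [Matrix.mul_apply, Finset.sum_mul]
    refine Finset.sum_congr rfl fun j _ => ?_
    rw [Matrix.mul_diagonal, Matrix.mul_apply]
    simp only [hP, Matrix.of_apply, Matrix.transpose_apply]
    by_cases hk : k i j = 0
    · rw [hk]; ring
    · rw [h.sum_pathWeight_mul hk]; ring
  have h4 : (Q * Y * X).trace = ∑ i, ∑ j, d i * e j * (∑ j, C i j + ∑ i, C i j - C i j) * k i j := by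
    have : Q * Y * X = Q * (Matrix.of k)ᵀ * Matrix.diagonal d * Matrix.of k * Matrix.diagonal e := by
      simp only [hX, hY, Matrix.mul_assoc]
    rw [this, Finset.sum_comm]
    simp only [Matrix.trace, Matrix.diag_apply, Matrix.mul_diagonal]
    refine Finset.sum_congr rfl fun j _ => ?_
    rw [Matrix.mul_apply, Finset.sum_mul]
    refine Finset.sum_congr rfl fun i _ => ?_
    rw [Matrix.mul_diagonal, Matrix.mul_apply]
    simp only [hQ, Matrix.of_apply, Matrix.transpose_apply]
    by_cases hk : k i j = 0
    · rw [hk]; ring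
    · rw [h.swap.sum_pathWeight_mul (i := j) (j := i) hk]; ring
  have h5 : (X * Y * P).trace = (P * X * Y).trace := by
    rw [Matrix.trace_mul_comm, ← Matrix.mul_assoc]
  have h6 : (Y * P * X).trace = (P * X * Y).trace := by
    rw [Matrix.mul_assoc, Matrix.trace_mul_comm, Matrix.mul_assoc]
  have h7 : (X * Q * Y).trace = (Q * Y * X).trace := by
    rw [Matrix.mul_assoc, Matrix.trace_mul_comm]
  have h8 : (Y * X * Q).trace = (Q * Y * X).trace := by
    rw [Matrix.trace_mul_comm, ← Matrix.mul_assoc]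
  rw [couplingMatrix_mul_blockCovMatrix, smul_pow, Matrix.trace_smul,
    pow_succ (Matrix.fromBlocks _ _ _ _), sq (Matrix.fromBlocks _ _ _ _),
    Matrix.fromBlocks_multiply, Matrix.fromBlocks_multiply, trace_fromBlocks_eq,
    Matrix.add_mul, Matrix.add_mul, Matrix.add_mul, Matrix.add_mul]
  simp only [Matrix.trace_add]
  rw [h5, h2, h8, h7, h6, h3, h4, h1, smul_eq_mul]
  ring

end Trace

end HY

/-! ### Overlap graph and row sums for two interval partitions. -/

namespace HY

/-- If adjacency respects two linear orders, any cycle of length four or six compares its vertices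
in both directions, and antisymmetry collapses it. -/
theorem IsForestWeight.of_monotone {α β : Type*} [LinearOrder α] [LinearOrder β] {k C : α → β → ℝ}
    (h01 : ∀ i j, k i j = 0 ∨ k i j = 1) (hC : ∀ i j, k i j = 0 → C i j = 0)
    (hmono : ∀ i i' j j', i < i' → k i j ≠ 0 → k i' j' ≠ 0 → j ≤ j') : IsForestWeight k C where
  zero_or_one := h01
  weight_eq_zero := hC
  no_four_cycle i i' j j' hi a1 a2 b1 b2 := by
    rcases lt_or_gt_of_ne hi with hlt | hlt
    · exact le_antisymm (hmono _ _ _ _ hlt a1 b2) (hmono _ _ _ _ hlt b1 a2)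
    · exact le_antisymm (hmono _ _ _ _ hlt a2 b1) (hmono _ _ _ _ hlt b2 a1)
  no_six_cycle i₁ i₂ i₃ j₁ j₂ j₃ h12 h23 h13 a1 a2 b1 b2 c1 c2 := by
    rcases lt_or_gt_of_ne h12 with h12 | h12 <;> rcases lt_or_gt_of_ne h23 with h23 | h23 <;>
      rcases lt_or_gt_of_ne h13 with h13 | h13 <;>
      have e1 := fun j j' => hmono _ _ j j' h12 <;> have e2 := fun j j' => hmono _ _ j j' h23 <;>
      have e3 := fun j j' => hmono _ _ j j' h13 <;> constructor <;> apply le_antisymm <;> grind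

namespace TimePartition

variable {T : ℝ≥0} (p q : TimePartition T)

lemma pt_monotone : Monotone p.pt := by
  refine monotone_nat_of_le_succ fun n => ?_
  rcases lt_or_ge n p.N with h | h
  · exact (p.strict n h).le
  · rw [p.last n h, p.last (n + 1) (by omega)]

lemma pt_le (i : ℕ) : p.pt i ≤ T :=
  (p.pt_monotone (le_max_left _ _)).trans_eq (p.last (max i p.N) (le_max_right _ _))

lemma cell_subset (i : ℕ) : p.cell i ⊆ Set.Ioc (0 : ℝ) T := fun _ ht =>
  ⟨(p.pt i).coe_nonneg.trans_lt ht.1, ht.2.trans (NNReal.coe_le_coe.2 (p.pt_le _))⟩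

lemma measurableSet_cell (i : ℕ) : MeasurableSet (p.cell i) := measurableSet_Ioc

lemma pairwise_disjoint_cell : Pairwise (Function.onFun Disjoint p.cell) := by
  have : Monotone fun i => (p.pt i : ℝ) := fun i j h => NNReal.coe_le_coe.2 (p.pt_monotone h)
  exact this.pairwise_disjoint_on_Ioc_succ

lemma iUnion_cell : ⋃ i : Fin p.N, p.cell i = Set.Ioc (0 : ℝ) T := by
  refine Set.Subset.antisymm (Set.iUnion_subset fun i => p.cell_subset i) fun t ht => ?_
  -- The cell containing `t` ends at the first partition point that is at least `t`. Its index is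
  -- positive because `pt 0 = 0 < t`, and at most `N` because `pt N = T`.
  have hex : ∃ n, t ≤ p.pt n := ⟨p.N, by rw [p.last p.N le_rfl]; exact ht.2⟩
  have hn := Nat.find_spec hex
  have hmin := fun m => Nat.find_min hex (m := m)
  set n := Nat.find hex
  have hn0 : n ≠ 0 := by
    intro h
    rw [h, p.first] at hn
    exact absurd ht.1 (not_lt.2 hn)
  have hlt : n - 1 < p.N := by
    by_contra hge
    have := hmin p.N (by omega)
    rw [p.last p.N le_rfl] at this
    exact this ht.2
  refine Set.mem_iUnion.2 ⟨⟨n - 1, hlt⟩, not_le.1 (hmin (n - 1) (by omega)), ?_⟩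
  simpa [Nat.sub_add_cancel (Nat.one_le_iff_ne_zero.2 hn0)] using hn

lemma sum_setIntegral_inter_cell {A : Set ℝ} (hA : MeasurableSet A) (hAT : A ⊆ Set.Ioc (0 : ℝ) T)
    {g : ℝ → ℝ} (hg : IntegrableOn g A) : ∑ i : Fin p.N, ∫ t in A ∩ p.cell i, g t = ∫ t in A, g t := by
  rw [← integral_iUnion_fintype (s := fun i : Fin p.N => A ∩ p.cell i) (fun i => hA.inter (p.measurableSet_cell i))
    (fun i j hij => (p.pairwise_disjoint_cell (Fin.val_ne_of_ne hij)).mono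
      Set.inter_subset_right Set.inter_subset_right)
    (fun i => hg.mono_set Set.inter_subset_left), ← Set.inter_iUnion, p.iUnion_cell,
    Set.inter_eq_left.2 hAT]

lemma length_le_mesh {i : ℕ} (hi : i < p.N) : (p.pt (i + 1) : ℝ) - p.pt i ≤ p.mesh := by
  have : p.pt (i + 1) - p.pt i ≤ p.mesh :=
    Finset.le_sup (f := fun i => p.pt (i + 1) - p.pt i) (Finset.mem_range.2 hi)
  rw [← NNReal.coe_sub (p.pt_monotone (Nat.le_succ i))]
  exact_mod_cast this

lemma inter_nonempty_iff {i j : ℕ} (hi : i < p.N) (hj : j < q.N) :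
    (p.cell i ∩ q.cell j).Nonempty ↔ p.pt i < q.pt (j + 1) ∧ q.pt j < p.pt (i + 1) := by
  have h1 := p.strict i hi
  have h2 := q.strict j hj
  rw [cell, cell, Set.Ioc_inter_Ioc, Set.nonempty_Ioc]
  simp only [sup_lt_iff, lt_inf_iff, NNReal.coe_lt_coe]
  tauto

end TimePartition

lemma overlap_eq_zero_or_one (I J : Set ℝ) : overlap I J = 0 ∨ overlap I J = 1 := by
  unfold overlap
  split_ifs <;> simp

lemma overlap_ne_zero_iff (I J : Set ℝ) : overlap I J ≠ 0 ↔ (I ∩ J).Nonempty := by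
  unfold overlap
  split_ifs with h <;> simp [h]

lemma overlap_comm (I J : Set ℝ) : overlap I J = overlap J I := by
  unfold overlap
  rw [Set.inter_comm]

namespace TimePartition

variable {T : ℝ≥0} (p q : TimePartition T)

/-- Cells are ordered along the time axis: if `I` precedes `I'`, a cell meeting `I'` cannot lie
before a cell meeting `I`, since then it would end before `I'` begins. -/
theorem isForestWeight (g : ℝ → ℝ) :
    IsForestWeight (fun (i : Fin p.N) (j : Fin q.N) => overlap (p.cell i) (q.cell j))
      (fun i j => ∫ t in p.cell i ∩ q.cell j, g t) := by
  refine .of_monotone (fun i j => overlap_eq_zero_or_one _ _) (fun i j h => ?_) ?_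
  · have : ¬ (p.cell i ∩ q.cell j).Nonempty := fun hne => (overlap_ne_zero_iff _ _).2 hne h
    rw [Set.not_nonempty_iff_eq_empty.1 this, setIntegral_empty]
  · intro i i' j j' hi h1 h2
    rw [overlap_ne_zero_iff, inter_nonempty_iff _ _ i.2 j.2] at h1
    rw [overlap_ne_zero_iff, inter_nonempty_iff _ _ i'.2 j'.2] at h2
    by_contra hlt
    have e1 : p.pt (i + 1) ≤ p.pt i' := p.pt_monotone (Nat.succ_le_of_lt hi)
    have e2 : q.pt (j' + 1) ≤ q.pt j := q.pt_monotone (Nat.succ_le_of_lt (not_le.1 hlt))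
    exact absurd (h1.2.trans_le (e1.trans (h2.1.le.trans e2))) (lt_irrefl _)

/-- The cells of `q` that meet a given cell of `p` have total length at most three meshes. -/
lemma sum_overlap_mul_length_le {r : ℝ} (hp : p.mesh ≤ r) (hq : q.mesh ≤ r) {i : ℕ} (hi : i < p.N) :
    ∑ j : Fin q.N, overlap (p.cell i) (q.cell j) * volume.real (q.cell j) ≤ 3 * r := by
  classical
  set F : Finset (Fin q.N) := {j | (p.cell i ∩ q.cell j).Nonempty}
  have h1 : ∑ j : Fin q.N, overlap (p.cell i) (q.cell j) * volume.real (q.cell j) =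
      ∑ j ∈ F, volume.real (q.cell j) := by
    rw [Finset.sum_filter]
    refine Finset.sum_congr rfl fun j _ => ?_
    unfold overlap
    split_ifs <;> simp
  rw [h1, ← measureReal_biUnion_finset (f := fun j : Fin q.N => q.cell j)
    (fun j _ j' _ hj => q.pairwise_disjoint_cell (Fin.val_ne_of_ne hj))
    (fun j _ => q.measurableSet_cell j) (fun j _ => measure_Ioc_lt_top.ne)]
  -- A cell that meets the given one stays within distance `r` of it, so the union lies in an
  -- interval of length at most `r + r + r`.
  have hsub : ⋃ j ∈ F, q.cell j ⊆ Set.Ioc ((p.pt i : ℝ) - r) (p.pt (i + 1) + r) := by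
    refine Set.iUnion₂_subset fun j hj t ht => ?_
    have hj' := (inter_nonempty_iff p q hi j.2).1 (Finset.mem_filter.1 hj).2
    have hl := q.length_le_mesh j.2
    have a1 : (p.pt i : ℝ) < q.pt (j + 1) := hj'.1
    have a2 : (q.pt j : ℝ) < p.pt (i + 1) := hj'.2
    have b1 : (q.pt j : ℝ) < t := ht.1
    have b2 : t ≤ q.pt (j + 1) := ht.2
    constructor <;> linarith
  refine (measureReal_mono hsub measure_Ioc_lt_top.ne).trans ?_
  have hl := p.length_le_mesh hi
  have hr : (0 : ℝ) ≤ r := p.mesh.coe_nonneg.trans hp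
  rw [Real.volume_real_Ioc]
  refine max_le ?_ (by linarith)
  linarith

lemma abs_setIntegral_le {g : ℝ → ℝ} {c : ℝ} (hg : ∀ t ∈ Set.Ioc (0 : ℝ) T, |g t| ≤ c) {A : Set ℝ}
    (hA : A ⊆ Set.Ioc (0 : ℝ) T) : |∫ t in A, g t| ≤ c * volume.real A :=
  norm_setIntegral_le_of_norm_le_const (μ := volume) (f := g)
    ((measure_mono hA).trans_lt measure_Ioc_lt_top) fun t ht => hg t (hA ht)

/-- Row sums of the product of the coupling matrix and the covariance matrix of the increments. -/
lemma sum_row_le {g h : ℝ → ℝ} {c r : ℝ} (hg : ∀ t ∈ Set.Ioc (0 : ℝ) T, |g t| ≤ c)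
    (hh : ∀ t ∈ Set.Ioc (0 : ℝ) T, |h t| ≤ c) (hc : 0 ≤ c) (hp : p.mesh ≤ r) (hq : q.mesh ≤ r)
    (i : Fin p.N) :
    ∑ i' : Fin p.N, |pathWeight (fun (i : Fin p.N) (j : Fin q.N) => overlap (p.cell i) (q.cell j))
        (fun i j => ∫ t in p.cell i ∩ q.cell j, g t) i i'| +
      ∑ j : Fin q.N, |overlap (p.cell i) (q.cell j) * ∫ t in q.cell j, h t| ≤ 6 * c * r := by
  have hk : ∀ j : Fin q.N, 0 ≤ overlap (p.cell i) (q.cell j) := fun j => by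
    rcases overlap_eq_zero_or_one (p.cell i) (q.cell j) with h | h <;> rw [h]
    exact zero_le_one
  have hS := sum_overlap_mul_length_le p q hp hq i.2
  have h1 : ∀ j : Fin q.N, ∑ i' : Fin p.N, |∫ t in p.cell i' ∩ q.cell j, g t| ≤
      c * volume.real (q.cell j) := by
    intro j
    calc _ ≤ ∑ i' : Fin p.N, c * volume.real (p.cell i' ∩ q.cell j) :=
          Finset.sum_le_sum fun i' _ => abs_setIntegral_le hg
            (Set.inter_subset_left.trans (p.cell_subset i'))
      _ = c * ∑ i' : Fin p.N, ∫ t in q.cell j ∩ p.cell i', (1 : ℝ) := by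
          rw [Finset.mul_sum]
          refine Finset.sum_congr rfl fun i' _ => ?_
          rw [Set.inter_comm, setIntegral_const, smul_eq_mul, mul_one]
      _ = _ := by
          rw [p.sum_setIntegral_inter_cell (q.measurableSet_cell j) (q.cell_subset j)
            (integrableOn_const measure_Ioc_lt_top.ne), setIntegral_const, smul_eq_mul, mul_one]
  -- Sum over `I'` first: the pieces `I' ∩ J` partition `J`, so they contribute at most `c` times
  -- the length of `J`. Only the cells `J` meeting the given cell remain.
  have h2 : ∑ i' : Fin p.N, |pathWeight (fun (i : Fin p.N) (j : Fin q.N) =>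
      overlap (p.cell i) (q.cell j)) (fun i j => ∫ t in p.cell i ∩ q.cell j, g t) i i'| ≤
      c * (3 * r) := by
    calc _ ≤ ∑ i' : Fin p.N, ∑ j : Fin q.N, overlap (p.cell i) (q.cell j) *
          |∫ t in p.cell i' ∩ q.cell j, g t| := by
          refine Finset.sum_le_sum fun i' _ => (Finset.abs_sum_le_sum_abs _ _).trans ?_
          refine Finset.sum_le_sum fun j _ => ?_
          rw [abs_mul, abs_of_nonneg (hk j)]
      _ = ∑ j : Fin q.N, overlap (p.cell i) (q.cell j) *
          ∑ i' : Fin p.N, |∫ t in p.cell i' ∩ q.cell j, g t| := by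
          rw [Finset.sum_comm]
          simp_rw [Finset.mul_sum]
      _ ≤ ∑ j : Fin q.N, overlap (p.cell i) (q.cell j) * (c * volume.real (q.cell j)) :=
          Finset.sum_le_sum fun j _ => mul_le_mul_of_nonneg_left (h1 j) (hk j)
      _ = c * ∑ j : Fin q.N, overlap (p.cell i) (q.cell j) * volume.real (q.cell j) := by
          rw [Finset.mul_sum]
          exact Finset.sum_congr rfl fun j _ => by ring
      _ ≤ _ := mul_le_mul_of_nonneg_left hS hc
  have h3 : ∑ j : Fin q.N, |overlap (p.cell i) (q.cell j) * ∫ t in q.cell j, h t| ≤ c * (3 * r) := by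
    calc _ ≤ ∑ j : Fin q.N, c * (overlap (p.cell i) (q.cell j) * volume.real (q.cell j)) := by
          refine Finset.sum_le_sum fun j _ => ?_
          rw [abs_mul, abs_of_nonneg (hk j), mul_left_comm]
          exact mul_le_mul_of_nonneg_left (abs_setIntegral_le hh (q.cell_subset j)) (hk j)
      _ = c * ∑ j : Fin q.N, overlap (p.cell i) (q.cell j) * volume.real (q.cell j) := by
          rw [Finset.mul_sum]
      _ ≤ _ := mul_le_mul_of_nonneg_left hS hc
  linarith

end TimePartition

section Scheme

variable {T : ℝ≥0} (ρ : ℝ → ℝ) (σ : Fin 2 → ℝ → ℝ) (S : Scheme T)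

/-- The overlap indicators of a sampling scheme. -/
noncomputable def overlapEntry (i : Fin (S 0).N) (j : Fin (S 1).N) : ℝ :=
  overlap ((S 0).cell i) ((S 1).cell j)

/-- The covariances of the increments of the two components. -/
noncomputable def crossEntry (i : Fin (S 0).N) (j : Fin (S 1).N) : ℝ :=
  v ρ σ ((S 0).cell i ∩ (S 1).cell j)

/-- The matrix of the Hayashi-Yoshida quadratic form. -/
noncomputable def hyMatrix : Matrix (Fin (S 0).N ⊕ Fin (S 1).N) (Fin (S 0).N ⊕ Fin (S 1).N) ℝ :=
  couplingMatrix (overlapEntry S)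

/-- The covariance matrix of the sampled increments. -/
noncomputable def incCov : Matrix (Fin (S 0).N ⊕ Fin (S 1).N) (Fin (S 0).N ⊕ Fin (S 1).N) ℝ :=
  blockCovMatrix (fun i => vv σ 0 ((S 0).cell i)) (fun j => vv σ 1 ((S 1).cell j))
    (crossEntry ρ σ S)

lemma isForestWeight_scheme : IsForestWeight (overlapEntry S) (crossEntry ρ σ S) :=
  (S 0).isForestWeight (S 1) _

variable {ρ σ}

lemma sum_crossEntry_right (hv : IntegrableOn (fun t => ρ t * σ 0 t * σ 1 t) (Set.Ioc (0 : ℝ) T))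
    (i : Fin (S 0).N) : ∑ j, crossEntry ρ σ S i j = v ρ σ ((S 0).cell i) :=
  (S 1).sum_setIntegral_inter_cell ((S 0).measurableSet_cell i) ((S 0).cell_subset i)
    (hv.mono_set ((S 0).cell_subset i))

lemma sum_crossEntry_left (hv : IntegrableOn (fun t => ρ t * σ 0 t * σ 1 t) (Set.Ioc (0 : ℝ) T))
    (j : Fin (S 1).N) : ∑ i, crossEntry ρ σ S i j = v ρ σ ((S 1).cell j) := by
  rw [v, ← (S 0).sum_setIntegral_inter_cell ((S 1).measurableSet_cell j) ((S 1).cell_subset j)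
    (hv.mono_set ((S 1).cell_subset j))]
  refine Finset.sum_congr rfl fun i _ => ?_
  rw [crossEntry, v, Set.inter_comm]

lemma pairSum_eq (g : ℕ → ℕ → ℝ) : pairSum S g = ∑ i : Fin (S 0).N, ∑ j : Fin (S 1).N, g i j := by
  rw [pairSum, Finset.sum_range]
  exact Finset.sum_congr rfl fun i _ => Finset.sum_range _

/-- Translates the edge sum `v(I) + v(J) - v(I ∩ J)` of the third trace into the form used in `mu3`.
-/
lemma v_union (hv : IntegrableOn (fun t => ρ t * σ 0 t * σ 1 t) (Set.Ioc (0 : ℝ) T))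
    {I J : Set ℝ} (hI : I ⊆ Set.Ioc (0 : ℝ) T) (hJ : J ⊆ Set.Ioc (0 : ℝ) T)
    (hJm : MeasurableSet J) : v ρ σ (I ∪ J) = v ρ σ I + v ρ σ J - v ρ σ (I ∩ J) := by
  have h1 : v ρ σ (I ∪ J) = v ρ σ (I \ J) + v ρ σ J := by
    rw [← Set.sdiff_union_self]
    exact setIntegral_union Set.disjoint_sdiff_left hJm
      (hv.mono_set (Set.sdiff_subset.trans hI)) (hv.mono_set hJ)
  have h2 : v ρ σ (I ∩ J) + v ρ σ (I \ J) = v ρ σ I :=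
    integral_inter_add_sdiff hJm (hv.mono_set hI)
  linarith

theorem trace_hyMatrix (hv : IntegrableOn (fun t => ρ t * σ 0 t * σ 1 t) (Set.Ioc (0 : ℝ) T)) :
    (hyMatrix S * incCov ρ σ S).trace = theta T ρ σ := by
  rw [hyMatrix, incCov, trace_coupling _ _ (isForestWeight_scheme ρ σ S)]
  simp_rw [sum_crossEntry_right S hv]
  have := (S 0).sum_setIntegral_inter_cell measurableSet_Ioc subset_rfl hv
  rw [theta, v, ← this]
  refine Finset.sum_congr rfl fun i _ => ?_
  rw [Set.inter_eq_right.2 ((S 0).cell_subset i), v]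

theorem trace_hyMatrix_sq (hv : IntegrableOn (fun t => ρ t * σ 0 t * σ 1 t) (Set.Ioc (0 : ℝ) T)) :
    ((hyMatrix S * incCov ρ σ S) ^ 2).trace = mu2 ρ σ S := by
  rw [hyMatrix, incCov, trace_coupling_sq _ _ (isForestWeight_scheme ρ σ S), mu2]
  simp_rw [sum_crossEntry_right S hv, sum_crossEntry_left S hv, pairSum_eq, Finset.sum_range]
  rfl

theorem trace_hyMatrix_cube (hv : IntegrableOn (fun t => ρ t * σ 0 t * σ 1 t) (Set.Ioc (0 : ℝ) T)) :
    ((hyMatrix S * incCov ρ σ S) ^ 3).trace = mu3 ρ σ S := by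
  rw [hyMatrix, incCov, trace_coupling_cube _ _ (isForestWeight_scheme ρ σ S), mu3]
  simp_rw [sum_crossEntry_right S hv, sum_crossEntry_left S hv, pairSum_eq, Finset.sum_range,
    fun (i : Fin (S 0).N) (j : Fin (S 1).N) => v_union hv ((S 0).cell_subset i)
      ((S 1).cell_subset j) ((S 1).measurableSet_cell j)]
  rfl

theorem sum_abs_hyMatrix_mul_incCov_le {c : ℝ} (hc : 0 ≤ c)
    (hv : ∀ t ∈ Set.Ioc (0 : ℝ) T, |ρ t * σ 0 t * σ 1 t| ≤ c)
    (hσ : ∀ i, ∀ t ∈ Set.Ioc (0 : ℝ) T, |σ i t ^ 2| ≤ c) (x : Fin (S 0).N ⊕ Fin (S 1).N) :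
    ∑ y, |(hyMatrix S * incCov ρ σ S) x y| ≤ 3 * c * maxLag S := by
  have m0 : ((S 0).mesh : ℝ) ≤ maxLag S := le_max_left _ _
  have m1 : ((S 1).mesh : ℝ) ≤ maxLag S := le_max_right _ _
  have hhalf : |(1 / 2 : ℝ)| = 1 / 2 := abs_of_pos (by norm_num)
  rw [hyMatrix, incCov, couplingMatrix_mul_blockCovMatrix, Fintype.sum_sum_type]
  rcases x with i | j
  · simp only [Matrix.smul_apply, Matrix.fromBlocks_apply₁₁, Matrix.fromBlocks_apply₁₂, smul_eq_mul,
      abs_mul (1 / 2 : ℝ), hhalf, ← Finset.mul_sum, Matrix.of_apply, Matrix.mul_diagonal]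
    have := (S 0).sum_row_le (S 1) hv (hσ 1) hc m0 m1 i
    rw [← mul_add]
    refine (mul_le_mul_of_nonneg_left this (by norm_num)).trans_eq (by ring)
  -- The rows of the second component are the same estimate with the two partitions exchanged.
  · simp only [Matrix.smul_apply, Matrix.fromBlocks_apply₂₁, Matrix.fromBlocks_apply₂₂, smul_eq_mul,
      abs_mul (1 / 2 : ℝ), hhalf, ← Finset.mul_sum, Matrix.of_apply, Matrix.mul_diagonal]
    have := (S 1).sum_row_le (S 0) hv (hσ 0) hc m1 m0 j
    rw [← mul_add, add_comm]
    refine (mul_le_mul_of_nonneg_left (le_of_eq_of_le ?_ this) (by norm_num)).trans_eq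
      (b := 1 / 2 * (6 * c * maxLag S)) (by ring)
    congr 1
    · refine Finset.sum_congr rfl fun j' _ => ?_
      congr 1
      refine Finset.sum_congr rfl fun i _ => ?_
      simp only [crossEntry, v, overlapEntry, Set.inter_comm, overlap_comm]
    · refine Finset.sum_congr rfl fun i _ => ?_
      rw [Matrix.transpose_apply, Matrix.of_apply, overlapEntry, overlap_comm]
      rfl

end Scheme

end HY

/-! ### Covariances of the driving process and the isometry for step functions. -/

namespace HY

/-- The infinitesimal covariance of two correlated Brownian motions. -/
noncomputable def corrKernel (ρ : ℝ → ℝ) (i j : Fin 2) (s : ℝ) : ℝ := if i = j then 1 else ρ s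

/-- The energy density of a pair of integrands. -/
noncomputable def corrForm (ρ : ℝ → ℝ) (F : Fin 2 → ℝ → ℝ) (s : ℝ) : ℝ :=
  ∑ i, ∑ j, corrKernel ρ i j s * (F i s * F j s)

/-- The pair of step functions with the coordinates `c`. -/
noncomputable def stepPair (c : Fin 2 × ℝ≥0 →₀ ℝ) : Fin 2 → ℝ → ℝ :=
  Finsupp.linearCombination ℝ
    (fun k : Fin 2 × ℝ≥0 => (Pi.single k.1 ((Set.Ioc (0 : ℝ) k.2).indicator 1) : Fin 2 → ℝ → ℝ)) c

/-- The elementary integral with the coordinates `c`. -/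
noncomputable def stepSum {Ω : Type*} (B : Fin 2 → ℝ≥0 → Ω → ℝ) (c : Fin 2 × ℝ≥0 →₀ ℝ) : Ω → ℝ :=
  Finsupp.linearCombination ℝ (fun k : Fin 2 × ℝ≥0 => B k.1 k.2) c

lemma stepPair_apply (c : Fin 2 × ℝ≥0 →₀ ℝ) (i : Fin 2) (s : ℝ) :
    stepPair c i s = ∑ k ∈ c.support, c k *
      if k.1 = i then (Set.Ioc (0 : ℝ) k.2).indicator (1 : ℝ → ℝ) s else 0 := by
  rw [stepPair, Finsupp.linearCombination_apply, Finsupp.sum, Finset.sum_apply, Finset.sum_apply]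
  refine Finset.sum_congr rfl fun k _ => ?_
  rw [Pi.smul_apply, Pi.smul_apply, smul_eq_mul, Pi.single_apply]
  split_ifs with h1 h2 h2
  · rfl
  · exact absurd h1.symm h2
  · exact absurd h2.symm h1
  · rfl

lemma stepSum_apply {Ω : Type*} (B : Fin 2 → ℝ≥0 → Ω → ℝ) (c : Fin 2 × ℝ≥0 →₀ ℝ) (ω : Ω) :
    stepSum B c ω = ∑ k ∈ c.support, c k * B k.1 k.2 ω := by
  rw [stepSum, Finsupp.linearCombination_apply, Finsupp.sum, Finset.sum_apply]
  rfl

lemma memLp_stepPair (c : Fin 2 × ℝ≥0 →₀ ℝ) (i : Fin 2) :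
    MemLp (stepPair c i) 2 (volume.restrict (Set.Ioi (0 : ℝ))) := by
  have : stepPair c i = fun s => ∑ k ∈ c.support, c k *
      if k.1 = i then (Set.Ioc (0 : ℝ) k.2).indicator (1 : ℝ → ℝ) s else 0 :=
    funext fun s => stepPair_apply c i s
  rw [this]
  refine memLp_finsetSum _ fun k _ => MemLp.const_mul ?_ _
  split_ifs
  · exact memLp_indicator_const 2 measurableSet_Ioc (1 : ℝ)
      (Or.inr ((Measure.restrict_apply_le _ _).trans_lt measure_Ioc_lt_top).ne)
  · exact MemLp.zero'

lemma abs_corrKernel_le {ρ : ℝ → ℝ} (hρ : ∀ t, 0 ≤ t → ρ t ∈ Set.Icc (-1 : ℝ) 1) (i j : Fin 2)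
    {s : ℝ} (hs : 0 ≤ s) : |corrKernel ρ i j s| ≤ 1 := by
  unfold corrKernel
  split_ifs
  · simp
  · exact abs_le.2 (hρ s hs)

lemma measurable_corrKernel {ρ : ℝ → ℝ} (hρ : Measurable ρ) (i j : Fin 2) :
    Measurable (corrKernel ρ i j) := by
  unfold corrKernel
  split_ifs
  · exact measurable_const
  · exact hρ

namespace IsCorrelatedBM

variable {Ω : Type*} [MeasurableSpace Ω] {P : Measure Ω} {ρ : ℝ → ℝ}
  {B : Fin 2 → ℝ≥0 → Ω → ℝ}

lemma gaussian_uncurry (hB : IsCorrelatedBM P ρ B) :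
    IsGaussianProcess (fun k : Fin 2 × ℝ≥0 => B k.1 k.2) P :=
  hB.gaussian.of_isGaussianProcess fun k => ⟨{k.2},
    (ContinuousLinearMap.proj (R := ℝ) (φ := fun _ : Fin 2 => ℝ) k.1).comp
      (ContinuousLinearMap.proj (R := ℝ) (φ := fun _ : ({k.2} : Finset ℝ≥0) => Fin 2 → ℝ)
        ⟨k.2, Finset.mem_singleton_self _⟩), fun _ => rfl⟩

lemma hasGaussianLaw_stepSum (hB : IsCorrelatedBM P ρ B) (c : Fin 2 × ℝ≥0 →₀ ℝ) :
    HasGaussianLaw (stepSum B c) P := by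
  have := (hB.gaussian_uncurry.smul c).hasGaussianLaw_fun_sum (I := c.support)
  rwa [show stepSum B c = _ from funext (stepSum_apply B c)]

lemma memLp (hB : IsCorrelatedBM P ρ B) (i : Fin 2) (t : ℝ≥0) : MemLp (B i t) 2 P :=
  (hB.gaussian_uncurry.hasGaussianLaw_eval (i, t)).memLp_two

lemma integrable (hB : IsCorrelatedBM P ρ B) (i : Fin 2) (t : ℝ≥0) : Integrable (B i t) P :=
  (hB.gaussian_uncurry.hasGaussianLaw_eval (i, t)).integrable

/-- The second moment at time zero vanishes. This makes `B_s` almost surely an increment, as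
independence of increments requires. -/
lemma eval_zero (hB : IsCorrelatedBM P ρ B) (i : Fin 2) : B i 0 =ᵐ[P] 0 := by
  have h := hB.cov i i 0
  rw [if_pos rfl, NNReal.coe_zero, integral_eq_zero_iff_of_nonneg (fun ω => mul_self_nonneg _)
    ((hB.memLp i 0).integrable_mul (hB.memLp i 0))] at h
  filter_upwards [h] with ω hω
  exact mul_self_eq_zero.1 hω

/-- The hypotheses give covariances at equal times only. For different times the later value is
split at the earlier time, and the remaining increment is independent and centred. -/
lemma integral_mul (hB : IsCorrelatedBM P ρ B) (i j : Fin 2) (s t : ℝ≥0) :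
    ∫ ω, B i s ω * B j t ω ∂P = ∫ u in Set.Ioc (0 : ℝ) (min s t), corrKernel ρ i j u := by
  have diag : ∀ i j (t : ℝ≥0), ∫ ω, B i t ω * B j t ω ∂P =
      ∫ u in Set.Ioc (0 : ℝ) t, corrKernel ρ i j u := by
    intro i j t
    rw [hB.cov]
    unfold corrKernel
    split_ifs <;> simp
  have key : ∀ i j {s t : ℝ≥0}, s ≤ t →
      ∫ ω, B i s ω * B j t ω ∂P = ∫ u in Set.Ioc (0 : ℝ) s, corrKernel ρ i j u := by
    intro i j s t hst
    have hind := (hB.indep.indepFun_sub_sub (zero_le (a := s)) hst).comp (measurable_pi_apply i)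
      (measurable_pi_apply j)
    have h0 : ∫ ω, B i s ω * (B j t ω - B j s ω) ∂P = 0 := by
      have e1 : (fun ω => B i s ω * (B j t ω - B j s ω)) =ᵐ[P]
          fun ω => (B i s ω - B i 0 ω) * (B j t ω - B j s ω) := by
        filter_upwards [hB.eval_zero i] with ω hω
        rw [hω]
        simp
      rw [integral_congr_ae e1]
      have := hind.integral_fun_mul_eq_mul_integral
        ((hB.memLp i s).sub (hB.memLp i 0)).aestronglyMeasurable
        ((hB.memLp j t).sub (hB.memLp j s)).aestronglyMeasurable
      refine this.trans ?_
      have e2 : ∫ ω, B j t ω - B j s ω ∂P = 0 := by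
        rw [integral_sub (hB.integrable j t) (hB.integrable j s),
          hB.centred, hB.centred, sub_zero]
      exact (congrArg _ e2).trans (mul_zero _)
    rw [← diag i j s]
    have e3 : ∫ ω, B i s ω * (B j t ω - B j s ω) ∂P =
        ∫ ω, B i s ω * B j t ω ∂P - ∫ ω, B i s ω * B j s ω ∂P := by
      simp_rw [mul_sub]
      exact integral_sub ((hB.memLp i s).integrable_mul (hB.memLp j t))
        ((hB.memLp i s).integrable_mul (hB.memLp j s))
    linarith
  rcases le_total s t with h | h
  · rw [key i j h, min_eq_left (NNReal.coe_le_coe.2 h)]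
  · rw [min_eq_right (NNReal.coe_le_coe.2 h)]
    simp_rw [mul_comm (B i s _)]
    rw [key j i h]
    unfold corrKernel
    simp_rw [eq_comm]

lemma integral_stepSum (hB : IsCorrelatedBM P ρ B) (c : Fin 2 × ℝ≥0 →₀ ℝ) :
    ∫ ω, stepSum B c ω ∂P = 0 := by
  simp_rw [stepSum_apply]
  rw [integral_finsetSum _ fun k _ => (hB.integrable k.1 k.2).const_mul _]
  simp [integral_const_mul, hB.centred]

/-- Itô isometry for deterministic step functions: by bilinearity it reduces to the covariance of
two evaluations, where the product of the indicators of `(0, s]` and `(0, t]` is that of `(0, min s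
t]`. -/
lemma integral_stepSum_sq (hB : IsCorrelatedBM P ρ B) (hρm : Measurable ρ)
    (hρ : ∀ t, 0 ≤ t → ρ t ∈ Set.Icc (-1 : ℝ) 1) (c : Fin 2 × ℝ≥0 →₀ ℝ) :
    ∫ ω, stepSum B c ω ^ 2 ∂P = ∫ s in Set.Ioi (0 : ℝ), corrForm ρ (stepPair c) s := by
  have hL : ∀ ω, stepSum B c ω ^ 2 = ∑ k ∈ c.support, ∑ l ∈ c.support,
      c k * c l * (B k.1 k.2 ω * B l.1 l.2 ω) := by
    intro ω
    rw [stepSum_apply, sq, Finset.sum_mul_sum]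
    exact Finset.sum_congr rfl fun k _ => Finset.sum_congr rfl fun l _ => by ring
  have hR : ∀ s, corrForm ρ (stepPair c) s = ∑ k ∈ c.support, ∑ l ∈ c.support,
      c k * c l * (Set.Ioc (0 : ℝ) (min k.2 l.2)).indicator (corrKernel ρ k.1 l.1) s := by
    intro s
    have e : ∀ k l : Fin 2 × ℝ≥0, c k * c l *
        (Set.Ioc (0 : ℝ) (min k.2 l.2)).indicator (corrKernel ρ k.1 l.1) s =
        ∑ i, ∑ j, corrKernel ρ i j s *
          ((c k * if k.1 = i then (Set.Ioc (0 : ℝ) k.2).indicator (1 : ℝ → ℝ) s else 0) *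
            (c l * if l.1 = j then (Set.Ioc (0 : ℝ) l.2).indicator (1 : ℝ → ℝ) s else 0)) := by
      intro k l
      rw [Finset.sum_eq_single k.1 (fun i _ hi => by simp [hi.symm]) (by simp),
        Finset.sum_eq_single l.1 (fun i _ hi => by simp [hi.symm]) (by simp), if_pos rfl, if_pos rfl]
      simp only [Set.indicator_apply, Set.mem_Ioc, le_min_iff, Pi.one_apply]
      by_cases h1 : 0 < s <;> by_cases h2 : s ≤ k.2 <;> by_cases h3 : s ≤ l.2 <;>
        simp [h1, h2, h3] <;> ring
    unfold corrForm
    simp_rw [e, stepPair_apply, Finset.sum_mul_sum, Finset.mul_sum]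
    symm
    calc _ = ∑ k ∈ c.support, ∑ i, ∑ l ∈ c.support, ∑ j, _ :=
          Finset.sum_congr rfl fun _ _ => Finset.sum_comm
      _ = ∑ i, ∑ k ∈ c.support, ∑ l ∈ c.support, ∑ j, _ := Finset.sum_comm
      _ = ∑ i, ∑ k ∈ c.support, ∑ j, ∑ l ∈ c.support, _ :=
          Finset.sum_congr rfl fun _ _ => Finset.sum_congr rfl fun _ _ => Finset.sum_comm
      _ = _ := Finset.sum_congr rfl fun _ _ => Finset.sum_comm
  have hint : ∀ k l : Fin 2 × ℝ≥0, Integrable (fun s => c k * c l *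
      (Set.Ioc (0 : ℝ) (min k.2 l.2)).indicator (corrKernel ρ k.1 l.1) s)
      (volume.restrict (Set.Ioi (0 : ℝ))) := by
    intro k l
    refine Integrable.const_mul ((integrable_indicator_iff measurableSet_Ioc).2 ?_) _
    refine Measure.integrableOn_of_bounded (M := 1) ?_
      (measurable_corrKernel hρm _ _).aestronglyMeasurable ?_
    · exact ((Measure.restrict_apply_le _ _).trans_lt measure_Ioc_lt_top).ne
    · filter_upwards [ae_restrict_mem measurableSet_Ioc] with s hs
      exact abs_corrKernel_le hρ _ _ hs.1.le
  simp_rw [hL, hR]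
  rw [integral_finsetSum _ fun k _ => integrable_finsetSum _ fun l _ =>
      ((hB.memLp k.1 k.2).integrable_mul (hB.memLp l.1 l.2)).const_mul _,
    integral_finsetSum _ fun k _ => integrable_finsetSum _ fun l _ => hint k l]
  refine Finset.sum_congr rfl fun k _ => ?_
  rw [integral_finsetSum _ fun l _ =>
      ((hB.memLp k.1 k.2).integrable_mul (hB.memLp l.1 l.2)).const_mul _,
    integral_finsetSum _ fun l _ => hint k l]
  refine Finset.sum_congr rfl fun l _ => ?_
  rw [integral_const_mul, integral_const_mul, hB.integral_mul,
    setIntegral_indicator measurableSet_Ioc, Set.inter_eq_right.2 (fun s hs => hs.1)]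

end IsCorrelatedBM

end HY

/-! ### Gaussian integrals of pairs of deterministic functions. -/

namespace HY

/-- Continuity of a bounded bilinear form on `L²`: expand `φψ - gh` around the limits and apply
Hölder's inequality to each of the three products. -/
lemma tendsto_integral_mul_mul_of_tendsto_eLpNorm {α : Type*} [MeasurableSpace α] {μ : Measure α}
    {K g h : α → ℝ} {φ ψ : ℕ → α → ℝ} (hK : AEStronglyMeasurable K μ) (hK1 : ∀ᵐ x ∂μ, |K x| ≤ 1)
    (hg : MemLp g 2 μ) (hh : MemLp h 2 μ) (hφ : ∀ k, MemLp (φ k) 2 μ) (hψ : ∀ k, MemLp (ψ k) 2 μ)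
    (hφg : Tendsto (fun k => eLpNorm (φ k - g) 2 μ) atTop (𝓝 0))
    (hψh : Tendsto (fun k => eLpNorm (ψ k - h) 2 μ) atTop (𝓝 0)) :
    (∀ k, Integrable (fun x => K x * (φ k x * ψ k x)) μ) ∧
      Integrable (fun x => K x * (g x * h x)) μ ∧
      Tendsto (fun k => ∫ x, K x * (φ k x * ψ k x) ∂μ) atTop (𝓝 (∫ x, K x * (g x * h x) ∂μ)) := by
  have hint : ∀ {u w : α → ℝ}, MemLp u 2 μ → MemLp w 2 μ →
      Integrable (fun x => K x * (u x * w x)) μ := fun hu hw =>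
    (hu.integrable_mul hw).bdd_mul hK hK1
  refine ⟨fun k => hint (hφ k) (hψ k), hint hg hh,
    tendsto_integral_of_L1' _ (hint hg hh).aestronglyMeasurable
      (Eventually.of_forall fun k => hint (hφ k) (hψ k)) ?_⟩
  have hmul : ∀ {u w : α → ℝ}, MemLp u 2 μ → MemLp w 2 μ →
      eLpNorm (u * w) 1 μ ≤ eLpNorm u 2 μ * eLpNorm w 2 μ := fun {u w} hu hw => by
    rw [← smul_eq_mul u w]
    exact eLpNorm_smul_le_mul_eLpNorm hw.1 hu.1
  have hbound : ∀ k, eLpNorm ((fun x => K x * (φ k x * ψ k x)) - fun x => K x * (g x * h x)) 1 μ ≤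
      eLpNorm (φ k - g) 2 μ * eLpNorm (ψ k - h) 2 μ + eLpNorm (φ k - g) 2 μ * eLpNorm h 2 μ +
        eLpNorm g 2 μ * eLpNorm (ψ k - h) 2 μ := by
    intro k
    have d1 := (hφ k).sub hg
    have d2 := (hψ k).sub hh
    calc _ ≤ eLpNorm ((φ k - g) * (ψ k - h) + (φ k - g) * h + g * (ψ k - h)) 1 μ := by
          refine eLpNorm_mono_ae ?_
          filter_upwards [hK1] with x hx
          simp only [Pi.sub_apply, Pi.add_apply, Pi.mul_apply, Real.norm_eq_abs]
          rw [show K x * (φ k x * ψ k x) - K x * (g x * h x) = K x * ((φ k x - g x) * (ψ k x - h x) +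
            (φ k x - g x) * h x + g x * (ψ k x - h x)) by ring, abs_mul]
          exact mul_le_of_le_one_left (abs_nonneg _) hx
      _ ≤ eLpNorm ((φ k - g) * (ψ k - h)) 1 μ + eLpNorm ((φ k - g) * h) 1 μ +
          eLpNorm (g * (ψ k - h)) 1 μ :=
          (eLpNorm_add_le ((d1.1.mul d2.1).add (d1.1.mul hh.1)) (hg.1.mul d2.1) le_rfl).trans
            (by gcongr; exact eLpNorm_add_le (d1.1.mul d2.1) (d1.1.mul hh.1) le_rfl)
      _ ≤ _ := add_le_add (add_le_add (hmul d1 d2) (hmul d1 hh)) (hmul hg d2)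
  refine tendsto_of_tendsto_of_tendsto_of_le_of_le tendsto_const_nhds ?_ (fun _ => zero_le) hbound
  have t1 := ENNReal.Tendsto.mul hφg (Or.inr ENNReal.zero_ne_top) hψh (Or.inr ENNReal.zero_ne_top)
  have t2 := ENNReal.Tendsto.mul_const (b := eLpNorm h 2 μ) hφg (Or.inr hh.2.ne)
  have t3 := ENNReal.Tendsto.const_mul (a := eLpNorm g 2 μ) hψh (Or.inr hg.2.ne)
  simpa using (t1.add t2).add t3

/-- `Y` is the Gaussian variable `∫₀^∞ F₀ dB₀ + ∫₀^∞ F₁ dB₁`. -/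
structure IsGaussianIntegral {Ω : Type*} [MeasurableSpace Ω] (P : Measure Ω)
    (B : Fin 2 → ℝ≥0 → Ω → ℝ) (F : Fin 2 → ℝ → ℝ) (Y : Ω → ℝ) : Prop where
  memLp : ∀ i, MemLp (F i) 2 (volume.restrict (Set.Ioi (0 : ℝ)))
  aesm : AEStronglyMeasurable Y P
  approx : ∃ c : ℕ → Fin 2 × ℝ≥0 →₀ ℝ,
    (∀ i, Tendsto (fun k => eLpNorm (stepPair (c k) i - F i) 2 (volume.restrict (Set.Ioi (0 : ℝ))))
      atTop (𝓝 0)) ∧ Tendsto (fun k => eLpNorm (stepSum B (c k) - Y) 2 P) atTop (𝓝 0)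

lemma stepSum_add {Ω : Type*} (B : Fin 2 → ℝ≥0 → Ω → ℝ) (c d : Fin 2 × ℝ≥0 →₀ ℝ) :
    stepSum B (c + d) = stepSum B c + stepSum B d := map_add _ _ _

lemma stepSum_smul {Ω : Type*} (B : Fin 2 → ℝ≥0 → Ω → ℝ) (a : ℝ) (c : Fin 2 × ℝ≥0 →₀ ℝ) :
    stepSum B (a • c) = a • stepSum B c := map_smul _ _ _

lemma stepPair_add (c d : Fin 2 × ℝ≥0 →₀ ℝ) : stepPair (c + d) = stepPair c + stepPair d :=
  map_add _ _ _

lemma stepPair_smul (a : ℝ) (c : Fin 2 × ℝ≥0 →₀ ℝ) : stepPair (a • c) = a • stepPair c :=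
  map_smul _ _ _

/-- The coordinates of a step function in the `i`-th component. -/
noncomputable def StepFn.coords (φ : StepFn) (i : Fin 2) : Fin 2 × ℝ≥0 →₀ ℝ :=
  ∑ k, φ.c k • (Finsupp.single (i, φ.r k) 1 - Finsupp.single (i, φ.l k) 1)

lemma StepFn.stepSum_coords {Ω : Type*} (B : Fin 2 → ℝ≥0 → Ω → ℝ) (φ : StepFn) (i : Fin 2) :
    stepSum B (φ.coords i) = φ.integral (B i) := by
  unfold stepSum coords
  rw [map_sum]
  ext ω
  simp [StepFn.integral]

lemma StepFn.stepPair_coords (φ : StepFn) (i : Fin 2) :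
    stepPair (φ.coords i) = Pi.single i φ.eval := by
  unfold stepPair coords
  rw [map_sum]
  -- An interval is a difference of intervals starting at 0; this uses `l k ≤ r k`.
  have h : ∀ k, (Set.Ioc (0 : ℝ) (φ.r k)).indicator (1 : ℝ → ℝ) - (Set.Ioc (0 : ℝ) (φ.l k)).indicator 1
      = (Set.Ioc (φ.l k : ℝ) (φ.r k)).indicator 1 := by
    intro k
    ext s
    have h1 : (φ.l k : ℝ) ≤ φ.r k := φ.l_le_r k
    have h2 : (0 : ℝ) ≤ φ.l k := (φ.l k).coe_nonneg
    simp only [Pi.sub_apply, Set.indicator_apply, Set.mem_Ioc, Pi.one_apply]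
    by_cases e1 : s ≤ φ.l k
    · simp [e1, e1.trans h1, not_lt.2 e1]
    · simp [e1, not_le.1 e1, h2.trans_lt (not_le.1 e1)]
  simp only [map_smul, map_sub, Finsupp.linearCombination_single, one_smul, ← Pi.single_sub, h,
    ← Pi.single_smul]
  refine (map_sum (AddMonoidHom.single (fun _ : Fin 2 => ℝ → ℝ) i) _ _).symm.trans ?_
  refine congrArg (Pi.single i) (funext fun s => ?_)
  rw [Finset.sum_apply, StepFn.eval]
  refine Finset.sum_congr rfl fun k _ => ?_
  simp [Set.indicator_apply]

namespace IsGaussianIntegral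

variable {Ω : Type*} [MeasurableSpace Ω] {P : Measure Ω} {ρ : ℝ → ℝ}
  {B : Fin 2 → ℝ≥0 → Ω → ℝ} {F G : Fin 2 → ℝ → ℝ} {Y Z : Ω → ℝ}

lemma of_isWienerIntegral {g : ℝ → ℝ} {i : Fin 2} (h : IsWienerIntegral P (B i) g Y)
    (hg : MemLp g 2 (volume.restrict (Set.Ioi (0 : ℝ)))) (hY : AEStronglyMeasurable Y P) :
    IsGaussianIntegral P B (Pi.single i g) Y := by
  obtain ⟨φ, h1, h2⟩ := h
  refine ⟨fun j => ?_, hY, fun k => (φ k).coords i, fun j => ?_, ?_⟩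
  · rcases eq_or_ne j i with rfl | hj
    · rwa [Pi.single_eq_same]
    · rw [Pi.single_eq_of_ne hj]; exact MemLp.zero
  · simp_rw [StepFn.stepPair_coords]
    rcases eq_or_ne j i with rfl | hj
    · simp_rw [Pi.single_eq_same]
      exact h1
    · simp_rw [Pi.single_eq_of_ne hj, sub_zero, eLpNorm_zero]
      exact tendsto_const_nhds
  · simp_rw [StepFn.stepSum_coords]
    exact h2

lemma smul (a : ℝ) (h : IsGaussianIntegral P B F Y) : IsGaussianIntegral P B (a • F) (a • Y) := by
  obtain ⟨c, h1, h2⟩ := h.approx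
  refine ⟨fun i => (h.memLp i).const_smul a, h.aesm.const_smul a, fun k => a • c k, fun i => ?_, ?_⟩
  · simp_rw [stepPair_smul, Pi.smul_apply, ← smul_sub, eLpNorm_const_smul]
    simpa using ENNReal.Tendsto.const_mul (a := ‖a‖ₑ) (h1 i) (Or.inr enorm_ne_top)
  · simp_rw [stepSum_smul, ← smul_sub, eLpNorm_const_smul]
    simpa using ENNReal.Tendsto.const_mul (a := ‖a‖ₑ) h2 (Or.inr enorm_ne_top)

lemma add (hB : IsCorrelatedBM P ρ B) (h : IsGaussianIntegral P B F Y)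
    (h' : IsGaussianIntegral P B G Z) : IsGaussianIntegral P B (F + G) (Y + Z) := by
  obtain ⟨c, h1, h2⟩ := h.approx
  obtain ⟨d, h1', h2'⟩ := h'.approx
  refine ⟨fun i => (h.memLp i).add (h'.memLp i), h.aesm.add h'.aesm, fun k => c k + d k,
    fun i => ?_, ?_⟩
  · refine tendsto_of_tendsto_of_tendsto_of_le_of_le tendsto_const_nhds
      (by simpa using (h1 i).add (h1' i)) (fun _ => zero_le) fun k => ?_
    rw [stepPair_add, Pi.add_apply, Pi.add_apply, add_sub_add_comm]
    exact eLpNorm_add_le ((memLp_stepPair _ i).sub (h.memLp i)).1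
      ((memLp_stepPair _ i).sub (h'.memLp i)).1 one_le_two
  · refine tendsto_of_tendsto_of_tendsto_of_le_of_le tendsto_const_nhds
      (by simpa using h2.add h2') (fun _ => zero_le) fun k => ?_
    rw [stepSum_add, add_sub_add_comm]
    exact eLpNorm_add_le ((hB.hasGaussianLaw_stepSum _).memLp_two.1.sub h.aesm)
      ((hB.hasGaussianLaw_stepSum _).memLp_two.1.sub h'.aesm) one_le_two

lemma zero : IsGaussianIntegral P B 0 0 := by
  refine ⟨fun i => MemLp.zero, aestronglyMeasurable_zero, fun _ => 0, fun i => ?_, ?_⟩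
  · simp [stepPair]
  · simp [stepSum]

lemma sub (hB : IsCorrelatedBM P ρ B) (h : IsGaussianIntegral P B F Y)
    (h' : IsGaussianIntegral P B G Z) : IsGaussianIntegral P B (F - G) (Y - Z) := by
  simpa [sub_eq_add_neg] using h.add hB (h'.smul (-1))

lemma sum (hB : IsCorrelatedBM P ρ B) {ι : Type*} (s : Finset ι) {F : ι → Fin 2 → ℝ → ℝ}
    {Y : ι → Ω → ℝ} (h : ∀ i ∈ s, IsGaussianIntegral P B (F i) (Y i)) :
    IsGaussianIntegral P B (∑ i ∈ s, F i) (∑ i ∈ s, Y i) := by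
  classical
  induction s using Finset.induction_on with
  | empty => simpa using zero
  | insert a s ha ih =>
    rw [Finset.sum_insert ha, Finset.sum_insert ha]
    exact (h a (Finset.mem_insert_self _ _)).add hB
      (ih fun i hi => h i (Finset.mem_insert_of_mem hi))

lemma tendsto_integral_corrForm (hρm : Measurable ρ)
    (hρ : ∀ t, 0 ≤ t → ρ t ∈ Set.Icc (-1 : ℝ) 1) (hF : ∀ i, MemLp (F i) 2 (volume.restrict (Set.Ioi (0 : ℝ))))
    {c : ℕ → Fin 2 × ℝ≥0 →₀ ℝ} (hc : ∀ i, Tendsto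
      (fun k => eLpNorm (stepPair (c k) i - F i) 2 (volume.restrict (Set.Ioi (0 : ℝ)))) atTop (𝓝 0)) :
    Tendsto (fun k => ∫ s in Set.Ioi (0 : ℝ), corrForm ρ (stepPair (c k)) s) atTop
      (𝓝 (∫ s in Set.Ioi (0 : ℝ), corrForm ρ F s)) := by
  have H := fun i j => tendsto_integral_mul_mul_of_tendsto_eLpNorm
    (measurable_corrKernel hρm i j).aestronglyMeasurable
    ((ae_restrict_mem measurableSet_Ioi).mono fun s (hs : 0 < s) => abs_corrKernel_le hρ i j hs.le)
    (hF i) (hF j) (fun k => memLp_stepPair (c k) i) (fun k => memLp_stepPair (c k) j) (hc i) (hc j)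
  have e1 : ∀ k, ∫ s in Set.Ioi (0 : ℝ), corrForm ρ (stepPair (c k)) s = ∑ i, ∑ j,
      ∫ s in Set.Ioi (0 : ℝ), corrKernel ρ i j s * (stepPair (c k) i s * stepPair (c k) j s) := by
    intro k
    unfold corrForm
    rw [integral_finsetSum _ fun i _ => integrable_finsetSum _ fun j _ => (H i j).1 k]
    exact Finset.sum_congr rfl fun i _ => integral_finsetSum _ fun j _ => (H i j).1 k
  have e2 : ∫ s in Set.Ioi (0 : ℝ), corrForm ρ F s = ∑ i, ∑ j,
      ∫ s in Set.Ioi (0 : ℝ), corrKernel ρ i j s * (F i s * F j s) := by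
    unfold corrForm
    rw [integral_finsetSum _ fun i _ => integrable_finsetSum _ fun j _ => (H i j).2.1]
    exact Finset.sum_congr rfl fun i _ => integral_finsetSum _ fun j _ => (H i j).2.1
  simp_rw [e1, e2]
  exact tendsto_finsetSum _ fun i _ => tendsto_finsetSum _ fun j _ => (H i j).2.2

/-- The characteristic function of a Gaussian integral. -/
theorem integral_cexp (hB : IsCorrelatedBM P ρ B) (hρm : Measurable ρ)
    (hρ : ∀ t, 0 ≤ t → ρ t ∈ Set.Icc (-1 : ℝ) 1) (h : IsGaussianIntegral P B F Y) :
    ∫ ω, Complex.exp (Y ω * Complex.I) ∂P =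
      Complex.exp (-((∫ s in Set.Ioi (0 : ℝ), corrForm ρ F s : ℝ) : ℂ) / 2) := by
  have : IsProbabilityMeasure P := hB.gaussian.isProbabilityMeasure
  obtain ⟨c, h1, h2⟩ := h.approx
  -- Elementary integrals are Gaussian, centred, and have variance given by the isometry; their
  -- characteristic function is taken at 1.
  have hstep : ∀ k, ∫ ω, Complex.exp (stepSum B (c k) ω * Complex.I) ∂P =
      Complex.exp (-((∫ s in Set.Ioi (0 : ℝ), corrForm ρ (stepPair (c k)) s : ℝ) : ℂ) / 2) := by
    intro k
    have hG := hB.hasGaussianLaw_stepSum (c k)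
    have e := congrArg (fun μ => charFun μ (1 : ℝ)) hG.map_eq_gaussianReal
    simp only [charFun_gaussianReal] at e
    rw [charFun_apply_real, integral_map hG.aemeasurable (by fun_prop)] at e
    rw [variance_of_integral_eq_zero hG.aemeasurable (hB.integral_stepSum _),
      hB.integral_stepSum, hB.integral_stepSum_sq hρm hρ] at e
    have hnn : 0 ≤ ∫ s in Set.Ioi (0 : ℝ), corrForm ρ (stepPair (c k)) s := by
      rw [← hB.integral_stepSum_sq hρm hρ]
      exact integral_nonneg fun ω => sq_nonneg _
    simp only [Real.coe_toNNReal _ hnn] at e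
    simpa [neg_div] using e
  have hmeas : ∀ {W : Ω → ℝ}, AEStronglyMeasurable W P →
      AEStronglyMeasurable (fun ω => Complex.exp (W ω * Complex.I)) P := fun hW =>
    (by fun_prop : Continuous fun x : ℝ => Complex.exp (x * Complex.I)).comp_aestronglyMeasurable hW
  have hlim1 : Tendsto (fun k => ∫ ω, Complex.exp (stepSum B (c k) ω * Complex.I) ∂P) atTop
      (𝓝 (∫ ω, Complex.exp (Y ω * Complex.I) ∂P)) := by
    refine tendsto_integral_of_L1' _ (hmeas h.aesm) (Eventually.of_forall fun k => ?_) ?_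
    · refine Integrable.of_bound (hmeas (hB.hasGaussianLaw_stepSum (c k)).memLp_two.1) 1
        (Eventually.of_forall fun ω => ?_)
      rw [Complex.norm_exp_ofReal_mul_I]
    · refine tendsto_of_tendsto_of_tendsto_of_le_of_le tendsto_const_nhds h2 (fun _ => zero_le)
        fun k => ?_
      have hm := (hB.hasGaussianLaw_stepSum (c k)).memLp_two.1.sub h.aesm
      refine le_trans ?_ (eLpNorm_le_eLpNorm_of_exponent_le one_le_two hm)
      refine eLpNorm_mono fun ω => ?_
      -- The map `x ↦ exp (i x)` is 1-Lipschitz, so `L²` convergence of the variables gives `L¹`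
      -- convergence of the exponentials.
      have e : Complex.exp (stepSum B (c k) ω * Complex.I) - Complex.exp (Y ω * Complex.I) =
          Complex.exp (Y ω * Complex.I) *
            (Complex.exp (Complex.I * ((stepSum B (c k) ω - Y ω : ℝ) : ℂ)) - 1) := by
        rw [mul_sub, ← Complex.exp_add, mul_one]
        congr 2
        push_cast
        ring
      rw [Pi.sub_apply, e, norm_mul, Complex.norm_exp_ofReal_mul_I, one_mul]
      exact Real.norm_exp_I_mul_ofReal_sub_one_le
  have hlim2 := tendsto_integral_corrForm hρm hρ h.memLp h1
  have hlim3 : Tendsto (fun k => Complex.exp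
      (-((∫ s in Set.Ioi (0 : ℝ), corrForm ρ (stepPair (c k)) s : ℝ) : ℂ) / 2)) atTop
      (𝓝 (Complex.exp (-((∫ s in Set.Ioi (0 : ℝ), corrForm ρ F s : ℝ) : ℂ) / 2))) :=
    ((by fun_prop : Continuous fun x : ℝ => Complex.exp (-(x : ℂ) / 2)).tendsto _).comp hlim2
  simp_rw [hstep] at hlim1
  exact tendsto_nhds_unique hlim1 hlim3

end IsGaussianIntegral

end HY

/-! ### The Gaussian law of the sampled increments and of the normalized error. -/

namespace HY

open scoped Matrix RealInnerProductSpace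

/-- The kernel matrix has eigenvalues `1 + ρ` and `1 - ρ` on the sum and the difference of the
components, and `|ρ| ≤ 1`. -/
lemma corrForm_nonneg {ρ : ℝ → ℝ} (hρ : ∀ t, 0 ≤ t → ρ t ∈ Set.Icc (-1 : ℝ) 1)
    (F : Fin 2 → ℝ → ℝ) {s : ℝ} (hs : 0 ≤ s) : 0 ≤ corrForm ρ F s := by
  obtain ⟨h1, h2⟩ := hρ s hs
  have : corrForm ρ F s = (1 + ρ s) / 2 * (F 0 s + F 1 s) ^ 2 + (1 - ρ s) / 2 * (F 0 s - F 1 s) ^ 2 := by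
    simp [corrForm, corrKernel, Fin.sum_univ_two]
    ring
  rw [this]
  have h3 : 0 ≤ (1 + ρ s) / 2 := by linarith
  have h4 : 0 ≤ (1 - ρ s) / 2 := by linarith
  positivity

lemma corrForm_sum {ι : Type*} [Fintype ι] (ρ : ℝ → ℝ) (σ : Fin 2 → ℝ → ℝ) (a : ι → ℝ) (k : ι → Fin 2)
    (A : ι → Set ℝ) (s : ℝ) :
    corrForm ρ (∑ m, a m • (Pi.single (k m) ((A m).indicator (σ (k m))) : Fin 2 → ℝ → ℝ)) s =
      ∑ m, ∑ m', a m * a m' * (A m ∩ A m').indicator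
        (fun s => corrKernel ρ (k m) (k m') s * (σ (k m) s * σ (k m') s)) s := by
  have h0 : ∀ i, (∑ m, a m • (Pi.single (k m) ((A m).indicator (σ (k m))) : Fin 2 → ℝ → ℝ)) i s =
      ∑ m, a m * if k m = i then (A m).indicator (σ (k m)) s else 0 := by
    intro i
    rw [Finset.sum_apply, Finset.sum_apply]
    refine Finset.sum_congr rfl fun m _ => ?_
    rw [Pi.smul_apply, Pi.smul_apply, smul_eq_mul]
    split_ifs with h
    · subst h; rw [Pi.single_eq_same]
    · rw [Pi.single_eq_of_ne (Ne.symm h), Pi.zero_apply]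
  have e : ∀ m m', a m * a m' * (A m ∩ A m').indicator
        (fun s => corrKernel ρ (k m) (k m') s * (σ (k m) s * σ (k m') s)) s =
      ∑ i, ∑ j, corrKernel ρ i j s * ((a m * if k m = i then (A m).indicator (σ (k m)) s else 0) *
        (a m' * if k m' = j then (A m').indicator (σ (k m')) s else 0)) := by
    intro m m'
    rw [Finset.sum_eq_single (k m) (fun i _ hi => by simp [hi.symm]) (by simp),
      Finset.sum_eq_single (k m') (fun i _ hi => by simp [hi.symm]) (by simp), if_pos rfl, if_pos rfl]
    by_cases h1 : s ∈ A m <;> by_cases h2 : s ∈ A m' <;> simp [h1, h2]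
    ring
  unfold corrForm
  simp_rw [h0, e, Finset.sum_mul_sum, Finset.mul_sum]
  symm
  calc _ = ∑ m, ∑ i, ∑ m', ∑ j, _ := Finset.sum_congr rfl fun _ _ => Finset.sum_comm
    _ = ∑ i, ∑ m, ∑ m', ∑ j, _ := Finset.sum_comm
    _ = ∑ i, ∑ m, ∑ j, ∑ m', _ :=
        Finset.sum_congr rfl fun _ _ => Finset.sum_congr rfl fun _ _ => Finset.sum_comm
    _ = _ := Finset.sum_congr rfl fun _ _ => Finset.sum_comm

lemma integral_corrForm_sum {ι : Type*} [Fintype ι] {ρ : ℝ → ℝ} {σ : Fin 2 → ℝ → ℝ} {T c : ℝ}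
    (hρm : Measurable ρ) (hρ : ∀ t, 0 ≤ t → ρ t ∈ Set.Icc (-1 : ℝ) 1) (hσm : ∀ i, Measurable (σ i))
    (hσ : ∀ i, ∀ t ∈ Set.Ioc 0 T, |σ i t| ≤ c) (a : ι → ℝ) (k : ι → Fin 2)
    {A : ι → Set ℝ} (hAm : ∀ m, MeasurableSet (A m)) (hA : ∀ m, A m ⊆ Set.Ioc 0 T) :
    ∫ s in Set.Ioi (0 : ℝ),
      corrForm ρ (∑ m, a m • (Pi.single (k m) ((A m).indicator (σ (k m))) : Fin 2 → ℝ → ℝ)) s =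
      ∑ m, ∑ m', a m * a m' *
        ∫ s in A m ∩ A m', corrKernel ρ (k m) (k m') s * (σ (k m) s * σ (k m') s) := by
  have hsub : ∀ m m', A m ∩ A m' ⊆ Set.Ioc 0 T := fun m m' => Set.inter_subset_left.trans (hA m)
  have hint : ∀ m m', Integrable (fun s => a m * a m' * (A m ∩ A m').indicator
      (fun s => corrKernel ρ (k m) (k m') s * (σ (k m) s * σ (k m') s)) s)
      (volume.restrict (Set.Ioi (0 : ℝ))) := by
    intro m m'
    refine Integrable.const_mul ((integrable_indicator_iff ((hAm m).inter (hAm m'))).2 ?_) _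
    refine Measure.integrableOn_of_bounded (M := 1 * (c * c)) ?_ ((measurable_corrKernel hρm _ _).mul
      ((hσm _).mul (hσm _))).aestronglyMeasurable ?_
    · exact ((Measure.restrict_apply_le _ _).trans_lt
        ((measure_mono (hsub m m')).trans_lt measure_Ioc_lt_top)).ne
    · filter_upwards [ae_restrict_mem ((hAm m).inter (hAm m'))] with s hs
      have h1 := hsub m m' hs
      have h2 := hσ (k m) s h1
      rw [Real.norm_eq_abs, abs_mul, abs_mul]
      exact mul_le_mul (abs_corrKernel_le hρ _ _ h1.1.le)
        (mul_le_mul h2 (hσ _ s h1) (abs_nonneg _) ((abs_nonneg _).trans h2)) (by positivity) zero_le_one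
  simp_rw [corrForm_sum]
  rw [integral_finsetSum _ fun m _ => integrable_finsetSum _ fun m' _ => hint m m']
  refine Finset.sum_congr rfl fun m _ => ?_
  rw [integral_finsetSum _ fun m' _ => hint m m']
  refine Finset.sum_congr rfl fun m' _ => ?_
  have hpos : A m ∩ A m' ⊆ Set.Ioi 0 := fun s hs => (hsub m m' hs).1
  rw [integral_const_mul, setIntegral_indicator ((hAm m).inter (hAm m')),
    Set.inter_eq_right.2 hpos]

section Increments

variable {Ω : Type*} [MeasurableSpace Ω] {P : Measure Ω} {ρ : ℝ → ℝ} {σ : Fin 2 → ℝ → ℝ} {T : ℝ≥0}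
  {B X : Fin 2 → ℝ≥0 → Ω → ℝ}

/-- The component that the index of a cell refers to. -/
def compIdx {α β : Type*} : α ⊕ β → Fin 2 := Sum.elim (fun _ => 0) (fun _ => 1)

/-- The cell with a given index. -/
def cellOf (S : Scheme T) : Fin (S 0).N ⊕ Fin (S 1).N → Set ℝ :=
  Sum.elim (fun i => (S 0).cell i) (fun j => (S 1).cell j)

/-- The vector of the increments over the cells. -/
def incVec (S : Scheme T) (x : Fin 2 → ℝ≥0 → ℝ) : Fin (S 0).N ⊕ Fin (S 1).N → ℝ :=
  Sum.elim (fun i => x 0 ((S 0).pt (i + 1)) - x 0 ((S 0).pt i))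
    (fun j => x 1 ((S 1).pt (j + 1)) - x 1 ((S 1).pt j))

/-- The two off-diagonal blocks carry half of the coupling each and give equal contributions. -/
lemma hyEstimator_eq (S : Scheme T) (x : Fin 2 → ℝ≥0 → ℝ) :
    hyEstimator S x = incVec S x ⬝ᵥ hyMatrix S *ᵥ incVec S x := by
  rw [hyEstimator, pairSum_eq, hyMatrix, couplingMatrix, incVec, Matrix.fromBlocks_mulVec]
  simp only [Matrix.zero_mulVec, zero_add, add_zero, Sum.elim_comp_inl, Sum.elim_comp_inr,
    sumElim_dotProduct_sumElim, Matrix.smul_mulVec, dotProduct_smul]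
  rw [Matrix.dotProduct_mulVec _ (_)ᵀ, Matrix.vecMul_transpose, dotProduct_comm (Matrix.of _ *ᵥ _),
    ← add_smul, add_halves, one_smul, dotProduct]
  refine Finset.sum_congr rfl fun i _ => ?_
  rw [Matrix.mulVec, dotProduct, Finset.mul_sum]
  refine Finset.sum_congr rfl fun j _ => ?_
  rw [Matrix.of_apply, overlapEntry]
  ring

/-- One formula for all four blocks: distinct cells of one partition are disjoint, so the
off-diagonal entries within a component vanish. It identifies `incCov` with the isometry. -/
lemma incCov_apply (S : Scheme T) (m m' : Fin (S 0).N ⊕ Fin (S 1).N) :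
    incCov ρ σ S m m' = ∫ s in cellOf S m ∩ cellOf S m',
      corrKernel ρ (compIdx m) (compIdx m') s * (σ (compIdx m) s * σ (compIdx m') s) := by
  have hd : ∀ (p : TimePartition T) (i i' : Fin p.N) (f : ℝ → ℝ), i ≠ i' →
      ∫ s in p.cell i ∩ p.cell i', f s = 0 := fun p i i' f h => by
    rw [(p.pairwise_disjoint_cell (Fin.val_ne_of_ne h)).inter_eq, setIntegral_empty]
  rcases m with i | j <;> rcases m' with i' | j'
  · simp only [incCov, blockCovMatrix, Matrix.fromBlocks_apply₁₁, Matrix.diagonal_apply, cellOf,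
      compIdx, Sum.elim_inl, corrKernel, if_true, one_mul]
    split_ifs with h
    · subst h; simp only [Set.inter_self, vv, sq]
    · rw [hd _ _ _ _ h]
  · simp [incCov, blockCovMatrix, cellOf, compIdx, corrKernel, crossEntry, v, mul_assoc]
  · simp only [incCov, blockCovMatrix, Matrix.fromBlocks_apply₂₁, Matrix.transpose_apply,
      Matrix.of_apply, crossEntry, v, cellOf, compIdx, Sum.elim_inl, Sum.elim_inr, corrKernel,
      one_ne_zero, if_false]
    rw [Set.inter_comm]
    exact integral_congr_ae (Eventually.of_forall fun s => by simp; ring)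
  · simp only [incCov, blockCovMatrix, Matrix.fromBlocks_apply₂₂, Matrix.diagonal_apply, cellOf,
      compIdx, Sum.elim_inr, corrKernel, if_true, one_mul]
    split_ifs with h
    · subst h; simp only [Set.inter_self, vv, sq]
    · rw [hd _ _ _ _ h]

/-- The equation is given from time 0 only; the increment is a difference of two such integrals. -/
lemma isGaussianIntegral_increment {c : ℝ} (hσm : ∀ i, Measurable (σ i))
    (hσ : ∀ i, ∀ t ∈ Set.Ioc (0 : ℝ) T, |σ i t| ≤ c) (hB : IsCorrelatedBM P ρ B)
    (hX : IsDriftlessDiffusion P T σ B X) (i : Fin 2) {s t : ℝ≥0} (hst : s ≤ t) (ht : t ≤ T) :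
    IsGaussianIntegral P B (Pi.single i ((Set.Ioc (s : ℝ) t).indicator (σ i))) (X i t - X i s) := by
  have hm : ∀ t ≤ T, IsGaussianIntegral P B (Pi.single i ((Set.Ioc (0 : ℝ) t).indicator (σ i)))
      (fun ω => X i t ω - X i 0 ω) := by
    intro t ht
    refine .of_isWienerIntegral (hX.sde i t ht) ?_
      ((hX.measurable i t).sub (hX.measurable i 0)).aestronglyMeasurable
    rw [memLp_indicator_iff_restrict measurableSet_Ioc]
    have : IsFiniteMeasure ((volume.restrict (Set.Ioi (0 : ℝ))).restrict (Set.Ioc (0 : ℝ) t)) :=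
      ⟨by rw [Measure.restrict_apply_univ]
          exact (Measure.restrict_apply_le _ _).trans_lt measure_Ioc_lt_top⟩
    refine MemLp.of_bound (hσm i).aestronglyMeasurable c ?_
    filter_upwards [ae_restrict_mem measurableSet_Ioc] with s hs
    exact hσ i s ⟨hs.1, hs.2.trans (NNReal.coe_le_coe.2 ht)⟩
  have := (hm t ht).sub hB (hm s (hst.trans ht))
  rw [← Pi.single_sub] at this
  convert this using 1
  · congr 1
    ext u
    have h1 : (s : ℝ) ≤ t := hst
    have h2 : (0 : ℝ) ≤ s := s.coe_nonneg
    simp only [Pi.sub_apply, Set.indicator_apply, Set.mem_Ioc]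
    by_cases e1 : u ≤ s
    · simp [e1, e1.trans h1, not_lt.2 e1]
    · simp [e1, not_le.1 e1, h2.trans_lt (not_le.1 e1)]
  · ext ω
    simp

lemma dotProduct_incCov (hρm : Measurable ρ)
    (hρ : ∀ t, 0 ≤ t → ρ t ∈ Set.Icc (-1 : ℝ) 1) (hσm : ∀ i, Measurable (σ i)) {c : ℝ}
    (hσ : ∀ i, ∀ t ∈ Set.Ioc (0 : ℝ) T, |σ i t| ≤ c)
    (S : Scheme T) (u : Fin (S 0).N ⊕ Fin (S 1).N → ℝ) :
    u ⬝ᵥ incCov ρ σ S *ᵥ u = ∫ s in Set.Ioi (0 : ℝ), corrForm ρ (∑ m, u m •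
      (Pi.single (compIdx m) ((cellOf S m).indicator (σ (compIdx m))) : Fin 2 → ℝ → ℝ)) s := by
  rw [integral_corrForm_sum hρm hρ hσm hσ u compIdx
    (by rintro (i | j) <;> exact measurableSet_Ioc)
    (by rintro (i | j) <;> exact TimePartition.cell_subset _ _)]
  simp only [dotProduct, Matrix.mulVec, Finset.mul_sum, incCov_apply]
  exact Finset.sum_congr rfl fun m _ => Finset.sum_congr rfl fun m' _ => by ring

lemma posSemidef_incCov (hρm : Measurable ρ)
    (hρ : ∀ t, 0 ≤ t → ρ t ∈ Set.Icc (-1 : ℝ) 1) (hσm : ∀ i, Measurable (σ i)) {c : ℝ}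
    (hσ : ∀ i, ∀ t ∈ Set.Ioc (0 : ℝ) T, |σ i t| ≤ c)
    (S : Scheme T) : (incCov ρ σ S).PosSemidef := by
  refine .of_dotProduct_mulVec_nonneg ?_ fun u => ?_
  · simp [Matrix.IsHermitian, incCov, blockCovMatrix, Matrix.fromBlocks_transpose]
  · rw [star_trivial, dotProduct_incCov hρm hρ hσm hσ]
    exact setIntegral_nonneg measurableSet_Ioi fun s hs => corrForm_nonneg hρ _ (le_of_lt hs)

/-- Cramér–Wold: every linear combination of increments is a Gaussian integral of a deterministic
pair, so its characteristic function is determined by the quadratic form of `incCov`. -/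
lemma map_incVec (hρm : Measurable ρ)
    (hρ : ∀ t, 0 ≤ t → ρ t ∈ Set.Icc (-1 : ℝ) 1) (hσm : ∀ i, Measurable (σ i)) {c : ℝ}
    (hσ : ∀ i, ∀ t ∈ Set.Ioc (0 : ℝ) T, |σ i t| ≤ c)
    (hB : IsCorrelatedBM P ρ B) (hX : IsDriftlessDiffusion P T σ B X) (S : Scheme T) :
    P.map (fun ω => WithLp.toLp 2 (incVec S fun i t => X i t ω)) =
      multivariateGaussian 0 (incCov ρ σ S) := by
  have : IsProbabilityMeasure P := hB.gaussian.isProbabilityMeasure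
  have hmeas : Measurable fun ω => WithLp.toLp 2 (incVec S fun i t => X i t ω) := by
    refine (WithLp.measurable_toLp 2 _).comp (measurable_pi_lambda _ ?_)
    rintro (i | j)
    · exact (hX.measurable _ _).sub (hX.measurable _ _)
    · exact (hX.measurable _ _).sub (hX.measurable _ _)
  have := Measure.isProbabilityMeasure_map (μ := P) hmeas.aemeasurable
  refine Measure.ext_of_charFun (funext fun u => ?_)
  rw [charFun_multivariateGaussian (posSemidef_incCov hρm hρ hσm hσ S), charFun_apply,
    integral_map hmeas.aemeasurable (by fun_prop), dotProduct_incCov hρm hρ hσm hσ]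
  have hG := IsGaussianIntegral.sum hB Finset.univ fun m (_ : m ∈ Finset.univ) =>
    IsGaussianIntegral.smul (u m) (show IsGaussianIntegral P B
      (Pi.single (compIdx m) ((cellOf S m).indicator (σ (compIdx m))))
      (fun ω => incVec S (fun i t => X i t ω) m) by
      rcases m with i | j
      · exact isGaussianIntegral_increment hσm hσ hB hX 0 ((S 0).pt_monotone (Nat.le_succ _))
          ((S 0).pt_le _)
      · exact isGaussianIntegral_increment hσm hσ hB hX 1 ((S 1).pt_monotone (Nat.le_succ _))
          ((S 1).pt_le _))
  have e := hG.integral_cexp hB hρm hρ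
  rw [inner_zero_right, Complex.ofReal_zero, zero_mul, zero_sub, ← neg_div]
  refine Eq.trans ?_ e
  refine integral_congr_ae (Eventually.of_forall fun ω => ?_)
  simp [PiLp.inner_apply, Finset.sum_apply]

/-- The normalized error for a fixed sampling scheme is a centred quadratic form of independent
standard normal variables. -/
theorem exists_map_normError (hρm : Measurable ρ)
    (hρ : ∀ t, 0 ≤ t → ρ t ∈ Set.Icc (-1 : ℝ) 1) (hσm : ∀ i, Measurable (σ i)) {c : ℝ}
    (hσ : ∀ i, ∀ t ∈ Set.Ioc (0 : ℝ) T, |σ i t| ≤ c)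
    (hB : IsCorrelatedBM P ρ B) (hX : IsDriftlessDiffusion P T σ B X)
    (S : Scheme T) {b : ℝ} (hb : 0 < b) :
    ∃ l : Fin (S 0).N ⊕ Fin (S 1).N → ℝ,
      P.map (fun ω => normError ρ σ b S fun i t => X i t ω) = chiLaw l ∧
      2 * ∑ k, l k ^ 2 = lam2 ρ σ b S ∧ b ^ (1 / 2 : ℝ) * lam3 ρ σ b S = 8 * ∑ k, l k ^ 3 ∧
      ∀ k, |l k| ≤ 3 * c ^ 2 * maxLag S * b ^ (-(1 / 2) : ℝ) := by
  have hσc : ∀ i j, ∀ t ∈ Set.Ioc (0 : ℝ) T, |σ i t| * |σ j t| ≤ c ^ 2 := fun i j t ht => by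
    rw [sq]
    exact mul_le_mul (hσ i t ht) (hσ j t ht) (abs_nonneg _) ((abs_nonneg _).trans (hσ i t ht))
  have hvb : ∀ t ∈ Set.Ioc (0 : ℝ) T, |ρ t * σ 0 t * σ 1 t| ≤ c ^ 2 := fun t ht => by
    rw [mul_assoc, abs_mul, abs_mul]
    exact (mul_le_of_le_one_left (by positivity) (abs_le.2 (hρ t ht.1.le))).trans (hσc 0 1 t ht)
  have hvvb : ∀ i, ∀ t ∈ Set.Ioc (0 : ℝ) T, |σ i t ^ 2| ≤ c ^ 2 := fun i t ht => by
    rw [sq, abs_mul]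
    exact hσc i i t ht
  have hv : IntegrableOn (fun t => ρ t * σ 0 t * σ 1 t) (Set.Ioc (0 : ℝ) T) :=
    Measure.integrableOn_of_bounded (M := c ^ 2) measure_Ioc_lt_top.ne
      ((hρm.mul (hσm 0)).mul (hσm 1)).aestronglyMeasurable
      ((ae_restrict_mem measurableSet_Ioc).mono hvb)
  have hH : (hyMatrix S).IsHermitian := by
    simp [Matrix.IsHermitian, hyMatrix, couplingMatrix, Matrix.fromBlocks_transpose]
    rfl
  obtain ⟨l, h1, h2, h3, h4, h5⟩ :=
    exists_map_quadForm_multivariateGaussian (posSemidef_incCov hρm hρ hσm hσ S) hH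
  -- The sum of the `l_k` is `θ`, so subtracting `θ` from `∑ l_k ξ_k²` centres each square.
  rw [trace_hyMatrix S hv] at h2
  rw [trace_hyMatrix_sq S hv] at h3
  rw [trace_hyMatrix_cube S hv] at h4
  have hl := h5 _ (sum_abs_hyMatrix_mul_incCov_le S (sq_nonneg c) hvb hvvb)
  set β := b ^ (-(1 / 2) : ℝ) with hβ
  have hβ0 : 0 < β := Real.rpow_pos_of_pos hb _
  have hβ2 : β ^ 2 = b⁻¹ := by
    rw [hβ, ← Real.rpow_natCast, ← Real.rpow_mul hb.le, ← Real.rpow_neg_one]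
    norm_num
  have hβb : b ^ (1 / 2 : ℝ) * β = 1 := by
    rw [hβ, ← Real.rpow_add hb]
    norm_num
  refine ⟨fun k => β * l k, ?_, ?_, ?_, fun k => ?_⟩
  · have hmeas : Measurable fun ω => WithLp.toLp 2 (incVec S fun i t => X i t ω) := by
      refine (WithLp.measurable_toLp 2 _).comp (measurable_pi_lambda _ ?_)
      rintro (i | j)
      · exact (hX.measurable _ _).sub (hX.measurable _ _)
      · exact (hX.measurable _ _).sub (hX.measurable _ _)
    have hq : Measurable fun y : EuclideanSpace ℝ (Fin (S 0).N ⊕ Fin (S 1).N) =>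
        y.ofLp ⬝ᵥ hyMatrix S *ᵥ y.ofLp := by
      simp only [dotProduct, Matrix.mulVec]
      fun_prop
    have ha : Measurable fun x : ℝ => β * (x - theta T ρ σ) := by fun_prop
    have e1 : (fun ω => normError ρ σ b S fun i t => X i t ω) = (fun x => β * (x - theta T ρ σ)) ∘
        (fun y : EuclideanSpace ℝ (Fin (S 0).N ⊕ Fin (S 1).N) =>
          y.ofLp ⬝ᵥ hyMatrix S *ᵥ y.ofLp) ∘ fun ω => WithLp.toLp 2 (incVec S fun i t => X i t ω) := by
      ext ω
      simp only [normError, hyEstimator_eq, Function.comp_apply, hβ]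
    have e2 : (fun ξ : Fin (S 0).N ⊕ Fin (S 1).N → ℝ => ∑ k, β * l k * (ξ k ^ 2 - 1)) =
        (fun x => β * (x - theta T ρ σ)) ∘ fun ξ => ∑ k, l k * ξ k ^ 2 := by
      ext ξ
      rw [Function.comp_apply, ← h2, ← Finset.sum_sub_distrib, Finset.mul_sum]
      exact Finset.sum_congr rfl fun k _ => by ring
    rw [e1, ← Measure.map_map ha (hq.comp hmeas), ← Measure.map_map hq hmeas,
      map_incVec hρm hρ hσm hσ hB hX, h1, chiLaw, e2, Measure.map_map ha (by fun_prop)]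
  · simp_rw [mul_pow]
    rw [← Finset.mul_sum, h3, hβ2, lam2]
    ring
  · simp_rw [mul_pow]
    rw [← Finset.mul_sum, h4, lam3, inv_pow b 2 |>.symm, ← hβ2]
    -- With `β = b^{-1/2}` the factor `b^{1/2} b^{-2}` equals `β³`, since `b^{-2} = β⁴` and `b^{1/2}
    -- β = 1`.
    linear_combination 8 * β ^ 3 * mu3 ρ σ S * hβb
  · rw [abs_mul, abs_of_pos hβ0, mul_comm]
    exact mul_le_mul_of_nonneg_right (hl k) hβ0.le

end Increments

end HY

/-! ### Conditioning on the random sampling scheme. -/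

namespace HY

/-- A grid point of mesh `1 / k` near `t`, indexed by the natural number `m = ⌈t k⌉₊`. -/
noncomputable def gridPoint (T : ℝ≥0) (k m : ℕ) : Set.Icc (0 : ℝ≥0) T :=
  ⟨min T (m / k), zero_le, min_le_left _ _⟩

/-- Evaluation of a path at time `t` as a limit along grid points. -/
noncomputable def gridEval {T : ℝ≥0} (x : Set.Icc (0 : ℝ≥0) T → ℝ) (t : ℝ≥0) : ℝ :=
  limsup (fun k : ℕ => x (gridPoint T k ⌈(t : ℝ) * k⌉₊)) atTop

lemma gridEval_eq {T : ℝ≥0} {x : Set.Icc (0 : ℝ≥0) T → ℝ} (hx : Continuous x) {t : ℝ≥0} (ht : t ≤ T) :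
    gridEval x t = x ⟨t, zero_le, ht⟩ := by
  have h1 : Tendsto (fun k : ℕ => gridPoint T k ⌈(t : ℝ) * k⌉₊) atTop (𝓝 ⟨t, zero_le, ht⟩) := by
    rw [tendsto_subtype_rng]
    have h2 : Tendsto (fun k : ℕ => ((⌈(t : ℝ) * k⌉₊ : ℝ≥0) / k)) atTop (𝓝 t) := by
      rw [← NNReal.tendsto_coe]
      push_cast
      exact (tendsto_nat_ceil_mul_div_atTop t.coe_nonneg).comp tendsto_natCast_atTop_atTop
    have h3 := (tendsto_const_nhds (x := T)).min h2
    rwa [min_eq_right ht] at h3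
  exact ((hx.tendsto _).comp h1).limsup_eq

/-- Evaluation at a variable time is in general not measurable for the product σ-algebra on all
paths. At level `k` the grid version uses countably many fixed coordinates; it agrees with
evaluation on continuous paths. -/
lemma measurable_gridEval (T : ℝ≥0) :
    Measurable fun q : (Set.Icc (0 : ℝ≥0) T → ℝ) × ℝ≥0 => gridEval q.1 q.2 := by
  refine Measurable.limsup fun k => ?_
  have h1 : Measurable fun q : (Set.Icc (0 : ℝ≥0) T → ℝ) × ℕ => q.1 (gridPoint T k q.2) :=
    measurable_from_prod_countable_left fun m =>
      measurable_pi_apply (gridPoint T k m)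
  exact h1.comp (measurable_fst.prodMk
    (Nat.measurable_ceil.comp ((measurable_coe_nnreal_real.comp measurable_snd).mul_const _)))

lemma measurable_comp_pair {α β γ δ : Type*} [MeasurableSpace α] [MeasurableSpace β]
    [MeasurableSpace γ] [MeasurableSpace δ] {G : β → γ → δ} (hG : Measurable fun q : β × γ => G q.1 q.2)
    {f : α → β} {g : α → γ} (hf : Measurable f) (hg : Measurable g) :
    Measurable fun a => G (f a) (g a) :=
  hG.comp (hf.prodMk hg)

/-- Handles sums whose number of terms is itself a function of the random scheme. -/
lemma measurable_natIndexed {α : Type*} [MeasurableSpace α] {N : α → ℕ} (hN : Measurable N)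
    {f : ℕ → α → ℝ} (hf : ∀ n, Measurable (f n)) : Measurable fun a => f (N a) a :=
  (measurable_from_prod_countable_left (f := fun q : α × ℕ => f q.2 q.1) hf).comp
    (measurable_id.prodMk hN)

section Measurability

variable {T : ℝ≥0}

lemma measurable_numCells (i : Fin 2) : Measurable fun S : Scheme T => (S i).N :=
  (measurable_fst.comp (comap_measurable fun p : TimePartition T => (p.N, p.pt))).comp
    (measurable_pi_apply i)

lemma measurable_pt (i : Fin 2) (k : ℕ) : Measurable fun S : Scheme T => (S i).pt k :=
  ((measurable_pi_apply k).comp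
    (measurable_snd.comp (comap_measurable fun p : TimePartition T => (p.N, p.pt)))).comp
    (measurable_pi_apply i)

lemma measurable_overlap (i j : ℕ) :
    Measurable fun S : Scheme T => overlap ((S 0).cell i) ((S 1).cell j) := by
  have h : ∀ S : Scheme T, overlap ((S 0).cell i) ((S 1).cell j) =
      {S : Scheme T | max ((S 0).pt i) ((S 1).pt j) < min ((S 0).pt (i + 1)) ((S 1).pt (j + 1))}.indicator
        1 S := by
    intro S
    unfold overlap
    rw [TimePartition.cell, TimePartition.cell, Set.Ioc_inter_Ioc, Set.nonempty_Ioc, Set.indicator_apply]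
    simp only [Set.mem_ofPred_eq, ← NNReal.coe_lt_coe, NNReal.coe_max, NNReal.coe_min, Pi.one_apply]
  simp_rw [h]
  exact measurable_one.indicator (measurableSet_lt ((measurable_pt 0 i).max (measurable_pt 1 j))
    ((measurable_pt 0 (i + 1)).min (measurable_pt 1 (j + 1))))

lemma measurable_normError_gridEval (ρ : ℝ → ℝ) (σ : Fin 2 → ℝ → ℝ) (b : ℝ) :
    Measurable fun q : Scheme T × (Fin 2 → Set.Icc (0 : ℝ≥0) T → ℝ) =>
      normError ρ σ b q.1 fun i t => gridEval (q.2 i) t := by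
  have hev : ∀ i k, Measurable fun q : Scheme T × (Fin 2 → Set.Icc (0 : ℝ≥0) T → ℝ) =>
      gridEval (q.2 i) ((q.1 i).pt k) := by
    intro i k
    have e1 : Measurable fun q : Scheme T × (Fin 2 → Set.Icc (0 : ℝ≥0) T → ℝ) => q.2 i :=
      (measurable_pi_apply i).comp measurable_snd
    have e2 : Measurable fun q : Scheme T × (Fin 2 → Set.Icc (0 : ℝ≥0) T → ℝ) => (q.1 i).pt k :=
      (measurable_pt i k).comp measurable_fst
    exact measurable_comp_pair (measurable_gridEval T) e1 e2
  let g : ℕ → ℕ → Scheme T × (Fin 2 → Set.Icc (0 : ℝ≥0) T → ℝ) → ℝ := fun i j q =>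
    (gridEval (q.2 0) ((q.1 0).pt (i + 1)) - gridEval (q.2 0) ((q.1 0).pt i)) *
      (gridEval (q.2 1) ((q.1 1).pt (j + 1)) - gridEval (q.2 1) ((q.1 1).pt j)) *
      overlap ((q.1 0).cell i) ((q.1 1).cell j)
  have hg : ∀ i j, Measurable (g i j) := fun i j =>
    (((hev 0 _).sub (hev 0 _)).mul ((hev 1 _).sub (hev 1 _))).mul
      ((measurable_overlap i j).comp measurable_fst)
  have h1 : ∀ i, Measurable fun q : Scheme T × (Fin 2 → Set.Icc (0 : ℝ≥0) T → ℝ) =>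
      ∑ j ∈ Finset.range (q.1 1).N, g i j q := fun i =>
    measurable_natIndexed (f := fun m q => ∑ j ∈ Finset.range m, g i j q)
      ((measurable_numCells 1).comp measurable_fst) fun m =>
        Finset.measurable_fun_sum _ fun j _ => hg i j
  have h2 : Measurable fun q : Scheme T × (Fin 2 → Set.Icc (0 : ℝ≥0) T → ℝ) =>
      ∑ i ∈ Finset.range (q.1 0).N, ∑ j ∈ Finset.range (q.1 1).N, g i j q :=
    measurable_natIndexed (f := fun n q => ∑ i ∈ Finset.range n, ∑ j ∈ Finset.range (q.1 1).N, g i j q)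
      ((measurable_numCells 0).comp measurable_fst) fun n =>
        Finset.measurable_fun_sum _ fun i _ => h1 i
  exact (h2.sub_const _).const_mul _

end Measurability

/-- The conditional law of a function of two independent variables. -/
theorem condDistrib_comp_ae_eq_map {Ω 𝒮 𝒳 : Type*} [MeasurableSpace Ω] [MeasurableSpace 𝒮]
    [MeasurableSpace 𝒳] {P : Measure Ω} [IsProbabilityMeasure P] {S : Ω → 𝒮} {x : Ω → 𝒳} {Y : Ω → ℝ}
    (hS : Measurable S) (hx : Measurable x) (hind : IndepFun S x P) {F : 𝒮 × 𝒳 → ℝ}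
    (hF : Measurable F) (hY : Y =ᵐ[P] fun ω => F (S ω, x ω)) :
    ∀ᵐ ω ∂P, condDistrib Y S P (S ω) = P.map fun ω' => F (S ω, x ω') := by
  have := Measure.isProbabilityMeasure_map (μ := P) hx.aemeasurable
  have := Measure.isProbabilityMeasure_map (μ := P) hS.aemeasurable
  -- The candidate kernel freezes the first variable and averages over the law of the second.
  -- Independence makes the joint law a product, and uniqueness of the conditional distribution
  -- identifies the two.
  set κ : Kernel 𝒮 ℝ := (Kernel.deterministic id measurable_id ×ₖ Kernel.const 𝒮 (P.map x)).map F
  have hκ : ∀ s, κ s = P.map fun ω' => F (s, x ω') := by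
    intro s
    rw [Kernel.map_apply _ hF, Kernel.prod_apply, Kernel.deterministic_apply, Kernel.const_apply,
      Measure.dirac_prod, Measure.map_map hF (by fun_prop), Measure.map_map (by fun_prop) hx]
    rfl
  have hYm : AEMeasurable Y P := (hF.comp (hS.prodMk hx)).aemeasurable.congr hY.symm
  have key : condDistrib Y S P =ᵐ[P.map S] κ := by
    refine condDistrib_ae_eq_of_measure_eq_compProd S hYm ?_
    have hG : Measurable fun q : 𝒮 × 𝒳 => (q.1, F q) := measurable_fst.prodMk hF
    have h1 : P.map (fun ω => (S ω, Y ω)) = (P.map fun ω => (S ω, x ω)).map fun q => (q.1, F q) := by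
      rw [Measure.map_map hG (hS.prodMk hx)]
      refine Measure.map_congr ?_
      filter_upwards [hY] with ω hω
      simp [hω]
    rw [h1, (indepFun_iff_map_prod_eq_prod_map_map hS.aemeasurable hx.aemeasurable).1 hind]
    ext A hA
    rw [Measure.map_apply hG hA, Measure.prod_apply (hG hA), Measure.compProd_apply hA]
    refine lintegral_congr fun s => ?_
    have hFs : Measurable fun ω' => F (s, x ω') := hF.comp (measurable_const.prodMk hx)
    rw [hκ, Measure.map_apply hFs (measurable_prodMk_left hA), Measure.map_apply hx (measurable_prodMk_left (hG hA))]
    rfl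
  filter_upwards [ae_of_ae_map hS.aemeasurable key] with ω hω
  rw [hω, hκ]

/-- The error sees the paths through their increments on `[0, T]` only, so the initial values can be
subtracted; independence is assumed for the paths so centred. -/
lemma normError_congr {T : ℝ≥0} (ρ : ℝ → ℝ) (σ : Fin 2 → ℝ → ℝ) (b : ℝ) (S : Scheme T)
    {x y : Fin 2 → ℝ≥0 → ℝ} (h : ∀ i, ∀ s ≤ T, ∀ t ≤ T, x i t - x i s = y i t - y i s) :
    normError ρ σ b S x = normError ρ σ b S y := by
  simp only [normError, hyEstimator,
    fun i k => h i _ ((S i).pt_le k) _ ((S i).pt_le (k + 1))]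

/-- The conditional law of the normalized error given the sampling scheme is its law for the fixed
scheme. -/
theorem condLaw_ae_eq {Ω : Type*} [MeasurableSpace Ω] {P : Measure Ω} [IsProbabilityMeasure P]
    {T : ℝ≥0} {ρ : ℝ → ℝ} {σ : Fin 2 → ℝ → ℝ} (b : ℝ) {B X : Fin 2 → ℝ≥0 → Ω → ℝ} {S : Ω → Scheme T}
    (hX : IsDriftlessDiffusion P T σ B X) (hS : Measurable S)
    (hind : IndepFun S (fun ω (i : Fin 2) (t : Set.Icc (0 : ℝ≥0) T) => X i t ω - X i 0 ω) P) :
    ∀ᵐ ω ∂P, condLaw P ρ σ b X S (S ω) =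
      P.map fun ω' => normError ρ σ b (S ω) fun i t => X i t ω' := by
  have hx : Measurable fun ω (i : Fin 2) (t : Set.Icc (0 : ℝ≥0) T) => X i t ω - X i 0 ω :=
    measurable_pi_lambda _ fun i => measurable_pi_lambda _ fun t =>
      (hX.measurable i t).sub (hX.measurable i 0)
  -- One null set serves all schemes at once, because it depends only on the continuity of the two
  -- paths.
  have hpath : ∀ᵐ ω ∂P, ∀ s : Scheme T, normError ρ σ b s (fun i t => X i t ω) =
      normError ρ σ b s fun i t =>
        gridEval (fun u : Set.Icc (0 : ℝ≥0) T => X i u ω - X i 0 ω) t := by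
    filter_upwards [hX.continuous 0, hX.continuous 1] with ω h0 h1 s
    refine normError_congr ρ σ b s fun i u hu t ht => ?_
    have hc : Continuous fun u : Set.Icc (0 : ℝ≥0) T => X i u ω - X i 0 ω := by
      refine Continuous.sub ?_ continuous_const
      fin_cases i
      · exact continuousOn_iff_continuous_domRestrict.1 h0
      · exact continuousOn_iff_continuous_domRestrict.1 h1
    rw [gridEval_eq hc ht, gridEval_eq hc hu]
    ring
  have h := condDistrib_comp_ae_eq_map hS hx hind (measurable_normError_gridEval ρ σ b)
    (Y := fun ω => normError ρ σ b (S ω) fun i t => X i t ω)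
    (hpath.mono fun ω hω => hω (S ω))
  filter_upwards [h] with ω hω
  rw [condLaw, hω]
  exact Measure.map_congr (hpath.mono fun ω' hω' => (hω' (S ω)).symm)

end HY

/-! ### Polynomial growth of the test functions and the main theorem. -/

namespace HY

lemma exists_one_add_rpow_le_exp {γ s : ℝ} (hγ : 0 < γ) (hs : 0 < s) :
    ∃ A : ℝ, 0 ≤ A ∧ ∀ x : ℝ, 1 + |x| ^ γ ≤ A * Real.exp (s / 2 * |x|) := by
  set n := ⌈γ⌉₊
  refine ⟨1 + n.factorial * (2 / s) ^ n * Real.exp (s / 2), by positivity, fun x => ?_⟩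
  have hx := abs_nonneg x
  set y := |x|
  have h1 : y ^ γ ≤ (1 + y) ^ n := by
    calc y ^ γ ≤ (1 + y) ^ γ := Real.rpow_le_rpow hx (by linarith) hγ.le
      _ ≤ (1 + y) ^ (n : ℝ) := Real.rpow_le_rpow_of_exponent_le (by linarith) (Nat.le_ceil γ)
      _ = _ := Real.rpow_natCast _ _
  have h2 := Real.pow_div_factorial_le_exp (s / 2 * (1 + y)) (by positivity) n
  rw [div_le_iff₀ (by positivity), mul_pow] at h2
  have h3 : (1 + y) ^ n ≤ n.factorial * (2 / s) ^ n * Real.exp (s / 2) * Real.exp (s / 2 * y) := by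
    have e : (2 / s) ^ n * (s / 2) ^ n = 1 := by
      rw [← mul_pow, div_mul_div_comm, mul_comm, div_self (by positivity), one_pow]
    calc (1 + y) ^ n = (2 / s) ^ n * ((s / 2) ^ n * (1 + y) ^ n) := by rw [← mul_assoc, e, one_mul]
      _ ≤ (2 / s) ^ n * (Real.exp (s / 2 * (1 + y)) * n.factorial) :=
          mul_le_mul_of_nonneg_left h2 (by positivity)
      _ = _ := by rw [mul_add, mul_one, Real.exp_add]; ring
  have h4 : 1 ≤ Real.exp (s / 2 * y) := Real.one_le_exp (by positivity)
  rw [add_mul, one_mul]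
  linarith

end HY

open HY

/-- Second-order expansion of the conditional law of the normalized Hayashi-Yoshida estimator given
an independent random sampling scheme `S n`. The conditional expectations are integrals with respect
to the regular conditional distribution of `b_n^{-1/2} (θ̂_n - θ)` given `S n`, so the suprema over
the uncountable class of test functions are taken outside one single null set. -/
theorem mainTheorem3
    (T : ℝ≥0) (hT : 0 < T) (ρ : ℝ → ℝ) (σ : Fin 2 → ℝ → ℝ)
    (hρm : Measurable ρ) (hρ : ∀ t, 0 ≤ t → ρ t ∈ Set.Icc (-1 : ℝ) 1)
    (hσm : ∀ i, Measurable (σ i)) (hσ : ∀ i t, 0 ≤ t → 0 < σ i t)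
    (hσb : ∀ i, BddAbove (σ i '' Set.Icc (0 : ℝ) T))
    (b : ℕ → ℝ) (hb : ∀ n, 0 < b n) (hb0 : Tendsto b atTop (𝓝 0))
    (M γ η C r₀ : ℝ) (hM : 0 < M) (hγ : 0 < γ) (hη : 0 < η) (hC : 0 < C) (hr₀ : 0 < r₀)
    (a : ℝ) (ha : a ∈ Set.Ioo (3 / 4 : ℝ) 1)
    (c c₀ c₁ : ℝ) (hc : 0 < c) (hc₀ : 0 < c₀) (hc₁ : 0 < c₁) :
    ∃ ε : ℕ → ℝ, ε =O[atTop] (fun n => b n ^ (2 * a - 1)) ∧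
      ∀ cstar : ℝ, c < cstar → c₀ < cstar → c₁ < cstar →
      ∀ (Ω : Type*) [MeasurableSpace Ω] (P : Measure Ω) [IsProbabilityMeasure P]
        (B X : Fin 2 → ℝ≥0 → Ω → ℝ) (S : ℕ → Ω → Scheme T),
        IsCorrelatedBM P ρ B → IsDriftlessDiffusion P T σ B X →
        (∀ n, Measurable (S n)) →
        (∀ n, IndepFun (S n)
          (fun ω (i : Fin 2) (t : Set.Icc (0 : ℝ≥0) T) => X i t ω - X i 0 ω) P) →
        ∀ n, ∀ᵐ ω ∂P,
          (c₀ < lam2 ρ σ (b n) (S n ω) ∧ lam2 ρ σ (b n) (S n ω) < c₁ ∧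
              maxLag (S n ω) ≤ b n ^ a →
            ∀ f ∈ growthClass M γ ∩ smoothClass C η r₀ cstar,
              Integrable f (condLaw P ρ σ (b n) X (S n) (S n ω)) ∧
              |∫ x, f x ∂(condLaw P ρ σ (b n) X (S n) (S n ω))
                - ∫ z, f z * psiDensity (b n) (lam2 ρ σ (b n) (S n ω))
                    (lam3 ρ σ (b n) (S n ω)) z| ≤ ε n) ∧
          ((lam2 ρ σ (b n) (S n ω) - c) ^ 2 ≤ b n ^ (2 * a - 1) ∧
              maxLag (S n ω) ≤ b n ^ a →
            ∀ f ∈ growthClass M γ ∩ smoothClass C η r₀ cstar,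
              Integrable f (condLaw P ρ σ (b n) X (S n) (S n ω)) ∧
              |∫ x, f x ∂(condLaw P ρ σ (b n) X (S n) (S n ω))
                - ∫ z, f z * psiTildeDensity (b n) c (lam2 ρ σ (b n) (S n ω))
                    (lam3 ρ σ (b n) (S n ω)) z| ≤ ε n) := by
  obtain ⟨u₀, hu₀⟩ := hσb 0
  obtain ⟨u₁, hu₁⟩ := hσb 1
  have hσc : ∀ i, ∀ t ∈ Set.Ioc (0 : ℝ) T, |σ i t| ≤ max u₀ u₁ := by
    intro i t ht
    rw [abs_of_pos (hσ i t ht.1.le)]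
    fin_cases i
    · exact (hu₀ (Set.mem_image_of_mem _ (Set.Ioc_subset_Icc_self ht))).trans (le_max_left _ _)
    · exact (hu₁ (Set.mem_image_of_mem _ (Set.Ioc_subset_Icc_self ht))).trans (le_max_right _ _)
  obtain ⟨β, hβ⟩ := hb0.bddAbove_range
  have hbβ : ∀ n, b n ≤ β := fun n => hβ (Set.mem_range_self n)
  have hβ0 : 0 < β := (hb 0).trans_le (hbβ 0)
  have ha2 : 0 < a - 1 / 2 := by linarith [ha.1]
  -- The second entry comes from the eigenvalue bound; the lower bound 1 makes `|λ̄₂ - c| ≤ δ n`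
  -- follow from the event in the second claim.
  set D : ℝ := max 1 (3 * max u₀ u₁ ^ 2)
  have hD1 : 1 ≤ D := le_max_left _ _
  have hD0 : 0 < D := zero_lt_one.trans_le hD1
  set δ : ℕ → ℝ := fun n => D * b n ^ (a - 1 / 2)
  set δm : ℝ := D * β ^ (a - 1 / 2)
  have hδ0 : ∀ n, 0 < δ n := fun n => mul_pos hD0 (Real.rpow_pos_of_pos (hb n) _)
  have hδm : ∀ n, δ n ≤ δm := fun n =>
    mul_le_mul_of_nonneg_left (Real.rpow_le_rpow (hb n).le (hbβ n) ha2.le) hD0.le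
  have hδm0 : 0 < δm := mul_pos hD0 (Real.rpow_pos_of_pos hβ0 _)
  have hδsq : ∀ n, δ n ^ 2 = D ^ 2 * b n ^ (2 * a - 1) := fun n => by
    simp only [δ]
    rw [mul_pow, ← Real.rpow_natCast (b n ^ _), ← Real.rpow_mul (hb n).le]
    congr 2
    push_cast
    ring
  -- The strip is chosen once for all `n`, narrow enough that all transforms exist on it even for
  -- the largest value of `δ n`; any `s > 0` suffices for polynomially growing `f`.
  set s : ℝ := 1 / (4 * δm)
  have hs : 0 < s := by positivity
  have hδs : δm * s ≤ 1 / 4 := by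
    simp only [s]
    rw [mul_one_div, div_le_div_iff₀ (by positivity) (by norm_num)]
    linarith
  obtain ⟨A, hA, hAx⟩ := exists_one_add_rpow_le_exp hγ hs
  obtain ⟨K₁, hK₁, H₁⟩ := exists_chiLaw_expansion c₁ hc₀ hs hδs
  obtain ⟨K₂, hK₂, H₂⟩ := exists_chiLaw_expansion_fixed hc hs hδs
  have hMA : 0 ≤ M * A := mul_nonneg hM.le hA
  -- Sum of the two constants, so that one sequence serves both claims. It is fixed before the
  -- probability space, the processes and the schemes are introduced.
  refine ⟨fun n => M * A * (K₁ + K₂) * δ n ^ 2, ?_, ?_⟩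
  · simp_rw [hδsq, ← mul_assoc]
    exact (isBigO_refl _ _).const_mul_left _
  intro cstar _ _ _ Ω _ P _ B X S hB hX hS hind n
  -- The exceptional null set is chosen before any test function; afterwards everything is
  -- deterministic for the frozen scheme.
  filter_upwards [condLaw_ae_eq (ρ := ρ) (b n) hX (hS n) (hind n)] with ω hω
  rw [hω]
  obtain ⟨l, hl, hl2, hl3, hlk⟩ := exists_map_normError hρm hρ hσm hσc hB hX (S n ω) (hb n)
  rw [hl, ← hl2]
  have hbound : maxLag (S n ω) ≤ b n ^ a → ∀ k, |l k| ≤ δ n := by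
    intro hr k
    have hpow : b n ^ a * b n ^ (-(1 / 2) : ℝ) = b n ^ (a - 1 / 2) := by
      rw [← Real.rpow_add (hb n), sub_eq_add_neg]
    calc |l k| ≤ 3 * max u₀ u₁ ^ 2 * maxLag (S n ω) * b n ^ (-(1 / 2) : ℝ) := hlk k
      _ ≤ 3 * max u₀ u₁ ^ 2 * b n ^ a * b n ^ (-(1 / 2) : ℝ) := by
          have := Real.rpow_pos_of_pos (hb n) (-(1 / 2) : ℝ)
          gcongr
      _ = 3 * max u₀ u₁ ^ 2 * b n ^ (a - 1 / 2) := by rw [mul_assoc, hpow]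
      _ ≤ _ := mul_le_mul_of_nonneg_right (le_max_right _ _) (Real.rpow_nonneg (hb n).le _)
  have hgrowth : ∀ f ∈ growthClass M γ ∩ smoothClass C η r₀ cstar,
      ∀ x, |f x| ≤ M * A * Real.exp (s / 2 * |x|) := by
    intro f hf x
    rw [mul_assoc]
    exact (hf.1.2 x).trans (mul_le_mul_of_nonneg_left (hAx x) hM.le)
  refine ⟨?_, ?_⟩
  · rintro ⟨h0, h1, hr⟩ f hf
    obtain ⟨hi, hd⟩ := H₁ _ l (δ n) (hδ0 n) (hδm n) (hbound hr) h0.le h1.le (b n) _ hl3 (M * A) f hMA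
      hf.1.1 (hgrowth f hf)
    refine ⟨hi, hd.trans ?_⟩
    have : 0 ≤ M * A * δ n ^ 2 * K₂ := by positivity
    linarith
  · rintro ⟨h0, hr⟩ f hf
    have hc2 : |2 * ∑ k, l k ^ 2 - c| ≤ δ n := by
      refine abs_le_of_sq_le_sq (h0.trans ?_) (hδ0 n).le
      rw [hδsq]
      exact le_mul_of_one_le_left (Real.rpow_nonneg (hb n).le _) (one_le_pow₀ hD1)
    obtain ⟨hi, hd⟩ := H₂ _ l (δ n) (hδ0 n) (hδm n) (hbound hr) hc2 (b n) _ hl3 (M * A) f hMA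
      hf.1.1 (hgrowth f hf)
    refine ⟨hi, hd.trans ?_⟩
    have : 0 ≤ M * A * δ n ^ 2 * K₁ := by positivity
    linarith
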